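/- **Setting.** Let $V=\{1,\dots,n\}$ with $n\ge 2$, and let $f:2^V\to\mathbb R$ be submodular with $f(\emptyset)=0$ and $f(\{i\})\ge 0$ for all $i$. Write $f^*=\min_S f(S)$, $u_f=(f(\{i\}))_{i\in V}$, $S_\ell^V=\{x\in[0,1]^V:\|x\|_1\le \ell\}$ and, for $y\in\mathbb R^V$, $y_-^{\ell}(V)=\min_{w\in S_\ell^V}\langle y,w\rangle$ and $y(S)=\sum_{i\in S}y_i$. A vector $y$ is a *$(\delta,k)$ dual certificate* for $f$ if $f^*\le y_-^{k+1}(V)+\delta$ and $f(S)\ge y(S)$ for every $S\subseteq V$ with $|S|\le k$. For a permutation $\pi$ of $V$, with $\pi[i]=\{\pi(1),\dots,\pi(i)\}$, the induced subgradient $g_\pi\in\mathbb R^V$ is $(g_\pi)_{\pi(i)}=f(\pi[i])-f(\pi[i-1])$. **The algorithm.** Let $A\ge1$ be an integer. Put $U_\infty=2k\|u_f\|_\infty+\phi$, $U_1=2\|u_f\|_1+\phi$ and $r(x)=\sum_i x_i\log x_i$. *SubmodularFTRL$(f,k,\phi,\delta)$* sets $M(\delta)=\lceil A\,k\,U_\infty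 U_1\log n/\delta^2\rceil$, $\eta=\delta/(U_\infty U_1)$, $x_0=\frac kn\mathbf 1$, and for $t=0,\dots,M(\delta)-1$: it lets $\pi_t$ sort the coordinates of $x_t$ in decreasing order (ties are broken by increasing value of $\sum_{t'<t}h_{t'}$, then by index); it applies vSampling, i.e. with $v=2u_f-g_{\pi_t}$ and $p_j=v_j/\|v\|_1$ it samples $j$ with probability $p_j$ and puts $h_t=\mathbf 1_j\,(g_{\pi_t})_j/p_j$ ($h_t=0$ if $v=0$); and it sets $x_{t+1}=\arg\min_{x\in S_k^V}\ \eta\sum_{t'\le t}\langle h_{t'},x\rangle+r(x)$. It returns $(\pi_t)_{0\le t<M(\delta)}$. *StochDualCertificate$(f,k,\phi,\delta)$ with $N$ repetitions* concatenates the outputs of $N$ independent runs of SubmodularFTRL$(f,k,\phi,\delta/2)$. **Machine model.** Time is counted on a randomized real random access machine: arrays of natural and of real numbers; natural-number addition, truncated subtraction and halving, real-number addition, subtraction, multiplication, division and logarithm, comparisons, memory accesses, coin flips with a computed bias, and outputs of a number are unit-cost steps; one call of the evaluation oracle for $f$ costs $\mathsf{EO}$ (in addition to unit-cost bookkeeping).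 The input is $n,k,N,\phi,\delta$ and the vector $u_f$. **Theorem.** For all $c,C>0$ there are integers $A\ge 1$, $p,q\ge 0$, a real $B>0$, depending only on $c$ and $C$, and one fixed program such that for every $n\ge2$, every $f$ as above, every integer $k\ge1$, all reals $\phi\ge|f^*|$ and $0<\delta\le\phi$ with $\phi\ge c\,\|u_f\|_\infty/k$, and every integer $N\ge N_0:=\lceil k^4\phi^2/\delta^2\rceil$, the following hold with $m=N\cdot M(\delta/2)$: 1. StochDualCertificate outputs exactly $m$ permutations $\pi^{(1)},\dots,\pi^{(m)}$, and if $N=N_0$ then $$m\ \le\ B(\log n)^p\;k^6\,\delta^{-4}\,\phi^2\,(\|u_f\|_\infty+\phi)(\|u_f\|_1+\phi).$$ 2. With probability at least $1-n^{-C}$, the vector $y=\frac1m\sum_{t=1}^m g_{\pi^{(t)}}$ is a $(\delta,k)$ dual certificate for $f$. 3. The program, run on the input above, outputs a list of permutations with exactly the distribution of the output of StochDualCertificate, and on every run of positive probability its running time is at most $B(\log n)^p\,m\,(\mathsf{EO}+n^q)$, for every $\mathsf{EO}\ge0$. -/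

import Mathlib

open scoped BigOperators

/-! ### Submodular functions on subsets of `V = {0, …, n-1}` -/

/-- Diminishing marginal differences. -/
def IsSubmodular {n : ℕ} (f : Finset (Fin n) → ℝ) : Prop :=
  ∀ S T : Finset (Fin n), S ⊆ T → ∀ i ∉ T, f (insert i T) - f T ≤ f (insert i S) - f S

/-- `f^*`, the minimum of `f` over all subsets. -/
noncomputable def minValue {n : ℕ} (f : Finset (Fin n) → ℝ) : ℝ :=
  ⨅ S : Finset (Fin n), f S

/-- The vector `u_f`, `(u_f)_i = f({i})`. -/
def upperVec {n : ℕ} (f : Finset (Fin n) → ℝ) : Fin n → ℝ := fun i => f {i}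

/-- The `ℓ₁`-norm; the `ℓ_∞`-norm is the norm `‖·‖` that Mathlib puts on `Fin n → ℝ`. -/
def l1norm {n : ℕ} (x : Fin n → ℝ) : ℝ := ∑ i, |x i|

/-- The truncated simplex `S_ℓ^V = {x ∈ [0,1]^V : ‖x‖₁ ≤ ℓ}`. -/
def truncSimplex (n l : ℕ) : Set (Fin n → ℝ) :=
  {x | (∀ i, 0 ≤ x i ∧ x i ≤ 1) ∧ l1norm x ≤ (l : ℝ)}

/-- `y_-^ℓ(V) = min_{w ∈ S_ℓ^V} ⟨y, w⟩`. -/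
noncomputable def sparseNeg {n : ℕ} (y : Fin n → ℝ) (l : ℕ) : ℝ :=
  sInf ((fun w : Fin n → ℝ => ∑ i, y i * w i) '' truncSimplex n l)

/-- `(δ, k)` dual certificates. -/
def IsDualCertificate {n : ℕ} (f : Finset (Fin n) → ℝ) (δ : ℝ) (k : ℕ) (y : Fin n → ℝ) : Prop :=
  minValue f ≤ sparseNeg y (k + 1) + δ ∧
    ∀ S : Finset (Fin n), S.card ≤ k → ∑ i ∈ S, y i ≤ f S

/-- `π[i]`, the set of the first `i` elements of the permutation `π`
(`π j` is the element in position `j`, and `π.symm v` is the position of `v`). -/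
def prefixSet {n : ℕ} (π : Equiv.Perm (Fin n)) (i : ℕ) : Finset (Fin n) :=
  Finset.univ.filter fun v => (π.symm v : ℕ) < i

/-- The subgradient `g_π` induced by `π`: the marginal of each element over its predecessors. -/
def subgrad {n : ℕ} (f : Finset (Fin n) → ℝ) (π : Equiv.Perm (Fin n)) : Fin n → ℝ :=
  fun v => f (prefixSet π ((π.symm v : ℕ) + 1)) - f (prefixSet π (π.symm v : ℕ))

/-- `y = (1/m) ∑_t g_{π^(t)}` for a list of `m` permutations. -/
noncomputable def avgSubgrad {n : ℕ} (f : Finset (Fin n) → ℝ)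
    (L : List (Equiv.Perm (Fin n))) : Fin n → ℝ :=
  fun v => (L.map fun π => subgrad f π v).sum / (L.length : ℝ)

/-! ### The randomized algorithm -/

/-- The vector `v = 2 u_f - g_π`. -/
def sampleVec {n : ℕ} (f : Finset (Fin n) → ℝ) (π : Equiv.Perm (Fin n)) : Fin n → ℝ :=
  fun i => 2 * upperVec f i - subgrad f π i

open Classical in
/-- `vSampling`: sample `j` with probability `p_j = v_j / ‖v‖₁` and return the vector whose only
nonzero entry is `(g_π)_j / p_j`, in position `j`.  If `v = 0`, which for a submodular `f` with
`u_f ≥ 0` and `f ∅ = 0` happens only for `f = 0`, then `g_π = 0` and the vector returned is `0`. -/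
noncomputable def vSampling {n : ℕ} (f : Finset (Fin n) → ℝ) (π : Equiv.Perm (Fin n)) :
    PMF (Fin n → ℝ) :=
  if h : (∑' j, ENNReal.ofReal (sampleVec f π j)) ≠ 0 then
    (PMF.normalize (fun j => ENNReal.ofReal (sampleVec f π j)) h
      (by rw [tsum_fintype]; exact ENNReal.sum_ne_top.2 fun _ _ => ENNReal.ofReal_ne_top)).map
      fun j => Pi.single j (subgrad f π j / (sampleVec f π j / l1norm (sampleVec f π)))
  else PMF.pure 0

/-- The entropy regularizer `r(x) = ∑ x_i log x_i` (with `0 log 0 = 0`). -/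
noncomputable def entropyReg {n : ℕ} (x : Fin n → ℝ) : ℝ := ∑ i, x i * Real.log (x i)

/-- `argmin_{x ∈ S_k^V} η ⟨H, x⟩ + r(x)`: the minimizer exists by compactness and is unique by
strict convexity. -/
noncomputable def ftrlPoint {n : ℕ} (k : ℕ) (η : ℝ) (H : Fin n → ℝ) : Fin n → ℝ :=
  Classical.epsilon fun x => x ∈ truncSimplex n k ∧
    IsMinOn (fun z : Fin n → ℝ => η * (∑ i, H i * z i) + entropyReg z) (truncSimplex n k) x

/-- The permutation `π_x` that sorts the coordinates of `x` in decreasing order.  Coordinates that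
are equal in `x` are sorted by increasing accumulated loss `H`, and then by index. -/
noncomputable def sortPerm {n : ℕ} (x H : Fin n → ℝ) : Equiv.Perm (Fin n) :=
  Tuple.sort fun i => toLex (-(x i), H i)

/-- `U_∞ = 2 k ‖u_f‖_∞ + φ`. -/
noncomputable def Uinf {n : ℕ} (f : Finset (Fin n) → ℝ) (k : ℕ) (φ : ℝ) : ℝ :=
  2 * k * ‖upperVec f‖ + φ

/-- `U_1 = 2 ‖u_f‖₁ + φ`. -/
noncomputable def Uone {n : ℕ} (f : Finset (Fin n) → ℝ) (φ : ℝ) : ℝ :=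
  2 * l1norm (upperVec f) + φ

/-- The number `M = ⌈A k U_∞ U_1 log n / δ²⌉` of iterations of one run with accuracy `δ`. -/
noncomputable def ftrlIters {n : ℕ} (A : ℕ) (f : Finset (Fin n) → ℝ) (k : ℕ) (φ δ : ℝ) : ℕ :=
  ⌈(A : ℝ) * k * Uinf f k φ * Uone f φ * Real.log n / δ ^ 2⌉₊

/-- The data kept between two iterations: the current point `x_t`, the accumulated loss
`H = ∑_{t' < t} h_{t'}`, and the permutations `π_{x_0}, …, π_{x_{t-1}}` so far. -/
structure FTRLState (n : ℕ) where
  point : Fin n → ℝ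
  loss : Fin n → ℝ
  perms : List (Equiv.Perm (Fin n))

/-- One iteration of `SubmodularFTRL` with step size `η`. -/
noncomputable def ftrlStep {n : ℕ} (f : Finset (Fin n) → ℝ) (k : ℕ) (η : ℝ) (s : FTRLState n) :
    PMF (FTRLState n) :=
  (vSampling f (sortPerm s.point s.loss)).map fun h =>
    { point := ftrlPoint k η (s.loss + h)
      loss := s.loss + h
      perms := s.perms ++ [sortPerm s.point s.loss] }

/-- The state after `t` iterations, started from `x_0 = (k/n) 1_V`. -/
noncomputable def ftrlLoop {n : ℕ} (f : Finset (Fin n) → ℝ) (k : ℕ) (η : ℝ) :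
    ℕ → PMF (FTRLState n)
  | 0 => PMF.pure { point := fun _ => (k : ℝ) / n, loss := 0, perms := [] }
  | t + 1 => (ftrlLoop f k η t).bind (ftrlStep f k η)

/-- `SubmodularFTRL(f, k, φ, δ)`: the law of the list `π_{x_0}, …, π_{x_{M-1}}`, with step size
`η = δ / (U_∞ U_1)`. -/
noncomputable def submodularFTRL {n : ℕ} (A : ℕ) (f : Finset (Fin n) → ℝ) (k : ℕ) (φ δ : ℝ) :
    PMF (List (Equiv.Perm (Fin n))) :=
  (ftrlLoop f k (δ / (Uinf f k φ * Uone f φ)) (ftrlIters A f k φ δ)).map FTRLState.perms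

/-- `StochDualCertificate(f, k, φ, δ)`: the law of the concatenated outputs of `N` independent
runs of `SubmodularFTRL(f, k, φ, δ/2)`. -/
noncomputable def stochDualCertificate {n : ℕ} (A : ℕ) (f : Finset (Fin n) → ℝ) (k : ℕ)
    (φ δ : ℝ) : ℕ → PMF (List (Equiv.Perm (Fin n)))
  | 0 => PMF.pure []
  | N + 1 => (stochDualCertificate A f k φ δ N).bind fun L =>
      (submodularFTRL A f k φ (δ / 2)).map fun L' => L ++ L'

/-! ### Machine model: a randomized real random access machine with an evaluation oracle

The memory consists of arrays of natural numbers and arrays of real numbers.  Every operation of an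
expression, every comparison, every memory access, every coin flip and every output of a number
counts as one elementary step; calls of the evaluation oracle are also counted separately. -/

/-- Natural number expressions; `get a i` reads cell `i` of array `a`. -/
inductive NExp : Type
  | lit (c : ℕ) : NExp
  | get (a : ℕ) (i : NExp) : NExp
  | add (e₁ e₂ : NExp) : NExp
  | sub (e₁ e₂ : NExp) : NExp
  | half (e : NExp) : NExp

/-- Real number expressions. -/
inductive RExp : Type
  | lit (c : ℕ) : RExp
  | cast (e : NExp) : RExp
  | get (a : ℕ) (i : NExp) : RExp
  | add (e₁ e₂ : RExp) : RExp
  | sub (e₁ e₂ : RExp) : RExp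
  | mul (e₁ e₂ : RExp) : RExp
  | div (e₁ e₂ : RExp) : RExp
  | log (e : RExp) : RExp

/-- Tests. -/
inductive BExp : Type
  | nle (e₁ e₂ : NExp) : BExp
  | rle (e₁ e₂ : RExp) : BExp
  | not (b : BExp) : BExp
  | and (b₁ b₂ : BExp) : BExp

/-- Programs.  `query a i s` asks the oracle for the value of `f` at the set whose indicator is
stored in the natural number array `s`, and writes it to cell `i` of the real array `a`;
`flip a i p` writes the outcome of a coin with bias `p` to cell `i` of the natural number array
`a`; `loop e c` is `for (t = 0; t < e; t++) c`, for the real number `e` evaluated once. -/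
inductive Cmd : Type
  | skip : Cmd
  | nset (a : ℕ) (i : NExp) (e : NExp) : Cmd
  | rset (a : ℕ) (i : NExp) (e : RExp) : Cmd
  | flip (a : ℕ) (i : NExp) (p : RExp) : Cmd
  | query (a : ℕ) (i : NExp) (s : ℕ) : Cmd
  | emit (e : NExp) : Cmd
  | seq (c₁ c₂ : Cmd) : Cmd
  | ite (b : BExp) (c₁ c₂ : Cmd) : Cmd
  | loop (e : RExp) (c : Cmd) : Cmd

/-- Memory, output, number of oracle calls and number of elementary steps so far. -/
structure Mem where
  nat : ℕ → ℕ → ℕ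
  real : ℕ → ℕ → ℝ
  out : List ℕ
  queries : ℕ
  steps : ℕ

/-- Count `c` elementary steps. -/
def Mem.charge (m : Mem) (c : ℕ) : Mem := { m with steps := m.steps + c }

/-- Write to an array of natural numbers. -/
def Mem.setNat (m : Mem) (a i v : ℕ) : Mem :=
  { m with nat := Function.update m.nat a (Function.update (m.nat a) i v) }

/-- Write to an array of real numbers. -/
noncomputable def Mem.setReal (m : Mem) (a i : ℕ) (v : ℝ) : Mem :=
  { m with real := Function.update m.real a (Function.update (m.real a) i v) }

def NExp.eval (m : Mem) : NExp → ℕ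
  | .lit c => c
  | .get a i => m.nat a (i.eval m)
  | .add e₁ e₂ => e₁.eval m + e₂.eval m
  | .sub e₁ e₂ => e₁.eval m - e₂.eval m
  | .half e => e.eval m / 2

/-- The number of nodes of an expression, that is, of operations in its evaluation. -/
def NExp.cost : NExp → ℕ
  | .lit _ => 1
  | .get _ i => i.cost + 1
  | .add e₁ e₂ => e₁.cost + e₂.cost + 1
  | .sub e₁ e₂ => e₁.cost + e₂.cost + 1
  | .half e => e.cost + 1

noncomputable def RExp.eval (m : Mem) : RExp → ℝ
  | .lit c => (c : ℝ)
  | .cast e => (e.eval m : ℝ)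
  | .get a i => m.real a (i.eval m)
  | .add e₁ e₂ => e₁.eval m + e₂.eval m
  | .sub e₁ e₂ => e₁.eval m - e₂.eval m
  | .mul e₁ e₂ => e₁.eval m * e₂.eval m
  | .div e₁ e₂ => e₁.eval m / e₂.eval m
  | .log e => Real.log (e.eval m)

def RExp.cost : RExp → ℕ
  | .lit _ => 1
  | .cast e => e.cost + 1
  | .get _ i => i.cost + 1
  | .add e₁ e₂ => e₁.cost + e₂.cost + 1
  | .sub e₁ e₂ => e₁.cost + e₂.cost + 1
  | .mul e₁ e₂ => e₁.cost + e₂.cost + 1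
  | .div e₁ e₂ => e₁.cost + e₂.cost + 1
  | .log e => e.cost + 1

def BExp.holds (m : Mem) : BExp → Prop
  | .nle e₁ e₂ => e₁.eval m ≤ e₂.eval m
  | .rle e₁ e₂ => e₁.eval m ≤ e₂.eval m
  | .not b => ¬ b.holds m
  | .and b₁ b₂ => b₁.holds m ∧ b₂.holds m

def BExp.cost : BExp → ℕ
  | .nle e₁ e₂ => e₁.cost + e₂.cost + 1
  | .rle e₁ e₂ => e₁.cost + e₂.cost + 1
  | .not b => b.cost + 1
  | .and b₁ b₂ => b₁.cost + b₂.cost + 1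

/-- A coin that shows `true` with probability `p` (cut off to `[0,1]`). -/
noncomputable def coin (p : ℝ) : PMF Bool :=
  PMF.ofFintype
    (fun b => cond b (min (ENNReal.ofReal p) 1) (1 - min (ENNReal.ofReal p) 1))
    (by rw [Fintype.sum_bool]; exact add_tsub_cancel_of_le (min_le_right _ _))

/-- Run a randomized memory transformation `t` times. -/
noncomputable def repeatRun (F : Mem → PMF Mem) : ℕ → Mem → PMF Mem
  | 0, m => PMF.pure m
  | t + 1, m => (F m).bind (repeatRun F t)

open Classical in
/-- The law of the memory after a program is run with oracle `f`. -/
noncomputable def Cmd.exec {n : ℕ} (f : Finset (Fin n) → ℝ) : Cmd → Mem → PMF Mem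
  | .skip, m => PMF.pure m
  | .nset a i e, m =>
      PMF.pure ((m.setNat a (i.eval m) (e.eval m)).charge (i.cost + e.cost + 1))
  | .rset a i e, m =>
      PMF.pure ((m.setReal a (i.eval m) (e.eval m)).charge (i.cost + e.cost + 1))
  | .flip a i p, m => (coin (p.eval m)).map fun b =>
      (m.setNat a (i.eval m) (if b then 1 else 0)).charge (i.cost + p.cost + 1)
  | .query a i s, m =>
      PMF.pure { (m.setReal a (i.eval m)
          (f (Finset.univ.filter fun v : Fin n => m.nat s (v : ℕ) ≠ 0))).charge (i.cost + 1) with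
        queries := m.queries + 1 }
  | .emit e, m => PMF.pure ({ m with out := m.out ++ [e.eval m] }.charge (e.cost + 1))
  | .seq c₁ c₂, m => (c₁.exec f m).bind (c₂.exec f)
  | .ite b c₁ c₂, m =>
      if b.holds m then c₁.exec f (m.charge (b.cost + 1)) else c₂.exec f (m.charge (b.cost + 1))
  | .loop e c, m =>
      repeatRun (fun m' => c.exec f (m'.charge 1)) ⌈e.eval m⌉₊ (m.charge (e.cost + 1))

/-- The running time when one call of the evaluation oracle takes time `EO`. -/
def Mem.time (m : Mem) (EO : ℝ) : ℝ := m.queries * EO + m.steps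

/-- The initial memory: `n, k, N` in array `0` of natural numbers, `φ, δ` in array `0` and the
vector `u_f` in array `1` of real numbers; every other cell is `0`. -/
noncomputable def inputMem {n : ℕ} (f : Finset (Fin n) → ℝ) (k N : ℕ) (φ δ : ℝ) : Mem where
  nat := fun a i => if a = 0 then (if i = 0 then n else if i = 1 then k else if i = 2 then N else 0)
    else 0
  real := fun a i =>
    if a = 0 then (if i = 0 then φ else if i = 1 then δ else 0)
    else if a = 1 then (if h : i < n then upperVec f ⟨i, h⟩ else 0)
    else 0
  out := []
  queries := 0
  steps := 0

/-- A list of permutations written out as the list of all their values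
`π(0), …, π(n-1)`, one permutation after the other. -/
def encodePerms {n : ℕ} (L : List (Equiv.Perm (Fin n))) : List ℕ :=
  L.flatMap fun π => List.ofFn fun i => (π i : ℕ)

/-!
The permutations of the algorithm do not depend on the points `x_t`: by exchanging two coordinates,
and by strict convexity of `x log x`, the minimizer of the regularized loss decreases where the
accumulated loss `H` increases and is constant where `H` is, and ties in `x_t` are broken by `H`.
So `π_t` sorts `H` (`submodularFTRL_eq_lossRun`), and the regret can be analysed with any other
algorithm whose points are sorted by `H`, in any other truncated simplex and with any step size.

The analysis uses exponential weights on the sets `T` with at most `k + 1` elements.  The weights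
of the sets containing an element are sorted by `H`, so the Lovász extension at that point is
evaluated by `g_π` and is at least `f^*`; hence the expected total weight `∑ exp(-η H(T))` grows by
a controlled factor in each step (`expect_hedgeWeight_le`).  The sampled vector `h` is unbiased
with entries bounded by `U_1` and second moments bounded by `U_1 v_j`, so for each fixed `T` the
accumulated difference between `H(T)` and `∑ g_π(T)` has a supermartingale too
(`expect_lossStep_deviation_le`).  Its correction term contains `-∑ g_π(T)` itself and is absorbed
at the end, which is why no uniform bound on `|g_π(T)|` is needed.  The two are combined by the
arithmetic-geometric mean inequality into an exponential moment of the list of permutations alone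
(`expect_lossRun_le`); this moment is multiplicative over the runs, and Markov's inequality with a
union bound over `T` gives `y(T) ≥ f^* - δ` for all `T` at once
(`stochDualCertificate_isDualCertificate`).  The minimum over the truncated simplex is attained at
such a `T` (`le_sparseNeg`), and the other half of a dual certificate holds surely, because each
`g_π` lies in the base polytope (`subgrad_sum_le`).

The program keeps only the loss `H`.  To use `O(log n)` oracle calls per iteration it samples by
descending a binary tree over the positions of `π`: a segment of positions has `v`-weight
`2 u_f - (f(π[b]) - f(π[a]))`, which needs one new value of `f` per halving
(`vSampling_eq_map_iter_treeStep`).  It is verified by a coupling of its runs with those of the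
algorithm that carries the bounds on queries and steps (`certificateCmd_coupled`).
-/

open scoped ENNReal

/-! ### Prefixes, subgradients and the base polytope -/

theorem minValue_le {n : ℕ} (f : Finset (Fin n) → ℝ) (S : Finset (Fin n)) : minValue f ≤ f S :=
  ciInf_le (Set.finite_range f).bddBelow S

theorem prefixSet_zero {n : ℕ} (π : Equiv.Perm (Fin n)) : prefixSet π 0 = ∅ := by
  simp [prefixSet]

theorem prefixSet_self {n : ℕ} (π : Equiv.Perm (Fin n)) : prefixSet π n = Finset.univ := by
  simp [prefixSet]

theorem notMem_prefixSet {n : ℕ} (π : Equiv.Perm (Fin n)) (i : Fin n) :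
    π i ∉ prefixSet π i := by
  simp [prefixSet]

theorem prefixSet_succ {n : ℕ} (π : Equiv.Perm (Fin n)) (i : Fin n) :
    prefixSet π (i + 1) = insert (π i) (prefixSet π i) := by
  ext v
  simp only [prefixSet, Finset.mem_filter, Finset.mem_univ, true_and, Finset.mem_insert]
  rw [← Equiv.symm_apply_eq, Fin.ext_iff]
  omega

theorem subgrad_apply {n : ℕ} (f : Finset (Fin n) → ℝ) (π : Equiv.Perm (Fin n)) (i : Fin n) :
    subgrad f π (π i) = f (prefixSet π (i + 1)) - f (prefixSet π i) := by
  simp [subgrad]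

/-- A sum over elements of `V` as a sum over positions, extended by zero beyond position `n`. -/
theorem sum_eq_sum_positions {n : ℕ} (π : Equiv.Perm (Fin n)) (F : Fin n → ℝ) :
    ∑ v, F v = ∑ i ∈ Finset.range n, if h : i < n then F (π ⟨i, h⟩) else 0 := by
  rw [← Equiv.sum_comp π F, Finset.sum_range]
  exact Finset.sum_congr rfl fun i _ => by simp

/-- The subgradient `g_π` lies in the base polytope: `g_π(S) ≤ f(S)`. -/
theorem subgrad_sum_le {n : ℕ} {f : Finset (Fin n) → ℝ} (h0 : f ∅ = 0) (hf : IsSubmodular f)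
    (π : Equiv.Perm (Fin n)) (S : Finset (Fin n)) : ∑ v ∈ S, subgrad f π v ≤ f S := by
  have key : ∀ t : ℕ, t ≤ n →
      ∑ i ∈ Finset.range t, (if h : i < n then
        (if π ⟨i, h⟩ ∈ S then subgrad f π (π ⟨i, h⟩) else 0) else 0) ≤ f (S ∩ prefixSet π t) := by
    intro t
    induction t with
    | zero => intro _; simp [prefixSet_zero, h0]
    | succ t ih =>
      intro ht
      have ht' : t < n := ht
      rw [Finset.sum_range_succ, dif_pos ht']
      have ih := ih ht'.le
      have e := prefixSet_succ π ⟨t, ht'⟩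
      have hn := notMem_prefixSet π ⟨t, ht'⟩
      have ha := subgrad_apply f π ⟨t, ht'⟩
      simp only at e hn ha
      rw [e] at ha ⊢
      by_cases hS : π ⟨t, ht'⟩ ∈ S
      · rw [if_pos hS, ha, Finset.inter_insert_of_mem hS]
        have := hf (S ∩ prefixSet π t) (prefixSet π t) Finset.inter_subset_right _ hn
        linarith
      · rw [if_neg hS, Finset.inter_insert_of_notMem hS]
        linarith
  have := key n le_rfl
  rw [prefixSet_self, Finset.inter_univ] at this
  rw [← Finset.sum_ite_mem_eq S, sum_eq_sum_positions π]
  exact this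

theorem subgrad_le_upperVec {n : ℕ} {f : Finset (Fin n) → ℝ} (h0 : f ∅ = 0) (hf : IsSubmodular f)
    (π : Equiv.Perm (Fin n)) (v : Fin n) : subgrad f π v ≤ upperVec f v := by
  simpa [upperVec] using subgrad_sum_le h0 hf π {v}

theorem sum_subgrad {n : ℕ} {f : Finset (Fin n) → ℝ} (h0 : f ∅ = 0) (π : Equiv.Perm (Fin n)) :
    ∑ v, subgrad f π v = f Finset.univ := by
  rw [sum_eq_sum_positions π]
  have : ∀ i ∈ Finset.range n, (if h : i < n then subgrad f π (π ⟨i, h⟩) else 0) =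
      f (prefixSet π (i + 1)) - f (prefixSet π i) := by
    intro i hi
    rw [dif_pos (Finset.mem_range.1 hi)]
    exact subgrad_apply f π ⟨i, _⟩
  rw [Finset.sum_congr rfl this, Finset.sum_range_sub fun i => f (prefixSet π i)]
  simp [prefixSet_zero, prefixSet_self, h0]

/-- Abel summation: a nonincreasing nonnegative sequence of weights turns a lower bound for the
partial sums into a lower bound for the weighted sum. -/
theorem abel_lower_bound (a x : ℕ → ℝ) (m : ℝ) (ha0 : a 0 = 0) (ha : ∀ i, m ≤ a i)
    (hx : ∀ i, x (i + 1) ≤ x i) (N : ℕ) :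
    m * (x 0 - x N) + a N * x N ≤ ∑ i ∈ Finset.range N, (a (i + 1) - a i) * x i := by
  induction N with
  | zero => simp [ha0]
  | succ N ih =>
    rw [Finset.sum_range_succ]
    nlinarith [mul_nonneg (sub_nonneg.2 (ha (N + 1))) (sub_nonneg.2 (hx N))]

/-- The Lovász extension is at least `X f^*` at a point of `[0, X]^V` that is sorted by `π`. -/
theorem minValue_mul_le_sum_subgrad {n : ℕ} {f : Finset (Fin n) → ℝ} (h0 : f ∅ = 0)
    (π : Equiv.Perm (Fin n)) (x : Fin n → ℝ) (X : ℝ) (hX : ∀ v, x v ≤ X) (hX0 : 0 ≤ X)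
    (hx0 : ∀ v, 0 ≤ x v) (hx : Antitone (x ∘ π)) :
    minValue f * X ≤ ∑ v, subgrad f π v * x v := by
  rw [sum_eq_sum_positions π]
  -- the coordinates of `x` by position, followed by zeros
  set y : ℕ → ℝ := fun i => if h : i < n then x (π ⟨i, h⟩) else 0 with hy
  have hm : minValue f ≤ 0 := h0 ▸ minValue_le f ∅
  have hya : ∀ i, y (i + 1) ≤ y i := by
    intro i
    by_cases h1 : i + 1 < n
    · simp only [hy, dif_pos h1, dif_pos (Nat.lt_of_succ_lt h1)]
      exact hx (by simp [Fin.le_def])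
    · simp only [hy, dif_neg h1]
      split_ifs
      · exact hx0 _
      · exact le_rfl
  have key := abel_lower_bound (fun i => f (prefixSet π i)) y (minValue f)
    (by simp [prefixSet_zero, h0]) (fun i => minValue_le f _) hya n
  have hyn : y n = 0 := by simp [hy]
  have hy0 : y 0 ≤ X := by
    simp only [hy]
    split_ifs
    · exact hX _
    · exact hX0
  have e : ∀ i ∈ Finset.range n, (if h : i < n then subgrad f π (π ⟨i, h⟩) * x (π ⟨i, h⟩) else 0) =
      (f (prefixSet π (i + 1)) - f (prefixSet π i)) * y i := by
    intro i hi
    have hi := Finset.mem_range.1 hi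
    simp only [hy, dif_pos hi]
    rw [← subgrad_apply f π ⟨i, hi⟩]
  rw [Finset.sum_congr rfl e]
  rw [hyn] at key
  nlinarith

/-! ### The sampling vector -/

theorem sampleVec_nonneg {n : ℕ} {f : Finset (Fin n) → ℝ} (h0 : f ∅ = 0) (hf : IsSubmodular f)
    (hu : ∀ i, 0 ≤ upperVec f i) (π : Equiv.Perm (Fin n)) (i : Fin n) : 0 ≤ sampleVec f π i := by
  have := subgrad_le_upperVec h0 hf π i
  have := hu i
  simp only [sampleVec]
  linarith

theorem abs_subgrad_le_sampleVec {n : ℕ} {f : Finset (Fin n) → ℝ} (h0 : f ∅ = 0)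
    (hf : IsSubmodular f) (hu : ∀ i, 0 ≤ upperVec f i) (π : Equiv.Perm (Fin n)) (i : Fin n) :
    |subgrad f π i| ≤ sampleVec f π i := by
  have := subgrad_le_upperVec h0 hf π i
  have := hu i
  simp only [sampleVec]
  exact abs_le.2 ⟨by linarith, by linarith⟩

theorem l1norm_of_nonneg {n : ℕ} {x : Fin n → ℝ} (hx : ∀ i, 0 ≤ x i) : l1norm x = ∑ i, x i :=
  Finset.sum_congr rfl fun i _ => abs_of_nonneg (hx i)

theorem sum_sampleVec {n : ℕ} {f : Finset (Fin n) → ℝ} (h0 : f ∅ = 0) (π : Equiv.Perm (Fin n)) :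
    ∑ i, sampleVec f π i = 2 * ∑ i, upperVec f i - f Finset.univ := by
  simp only [sampleVec, Finset.sum_sub_distrib, ← Finset.mul_sum, sum_subgrad h0]

theorem sum_sampleVec_le_Uone {n : ℕ} {f : Finset (Fin n) → ℝ} (h0 : f ∅ = 0)
    (hu : ∀ i, 0 ≤ upperVec f i) {φ : ℝ} (hφ : |minValue f| ≤ φ) (π : Equiv.Perm (Fin n)) :
    ∑ i, sampleVec f π i ≤ Uone f φ := by
  rw [sum_sampleVec h0, Uone, l1norm_of_nonneg hu]
  have := minValue_le f Finset.univ
  have := (abs_le.1 hφ).1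
  linarith

/-! ### Expectations in `ℝ≥0∞` of functions on discrete probability spaces -/

/-- The expectation of an extended nonnegative function. -/
noncomputable def PMF.expect {α : Type*} (p : PMF α) (φ : α → ℝ≥0∞) : ℝ≥0∞ := ∑' a, p a * φ a

theorem PMF.expect_mono {α : Type*} (p : PMF α) {φ ψ : α → ℝ≥0∞} (h : ∀ a ∈ p.support, φ a ≤ ψ a) :
    p.expect φ ≤ p.expect ψ := by
  refine ENNReal.tsum_le_tsum fun a => ?_
  by_cases ha : p a = 0
  · simp [ha]
  · exact mul_le_mul_right (h a ((p.mem_support_iff a).2 ha)) _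

theorem PMF.expect_pure {α : Type*} (a : α) (φ : α → ℝ≥0∞) : (PMF.pure a).expect φ = φ a := by
  classical
  rw [PMF.expect, tsum_eq_single a]
  · simp
  · intro b hb
    simp [hb]

theorem PMF.expect_bind {α β : Type*} (p : PMF α) (q : α → PMF β) (φ : β → ℝ≥0∞) :
    (p.bind q).expect φ = p.expect fun a => (q a).expect φ := by
  simp only [PMF.expect, PMF.bind_apply, ← ENNReal.tsum_mul_right, ← ENNReal.tsum_mul_left]
  rw [ENNReal.tsum_comm]
  simp only [mul_assoc]

theorem PMF.expect_map {α β : Type*} (p : PMF α) (g : α → β) (φ : β → ℝ≥0∞) :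
    (p.map g).expect φ = p.expect (φ ∘ g) := by
  rw [← PMF.bind_pure_comp, PMF.expect_bind]
  simp only [Function.comp_apply, PMF.expect_pure]
  rfl

theorem PMF.expect_const_mul {α : Type*} (p : PMF α) (c : ℝ≥0∞) (φ : α → ℝ≥0∞) :
    (p.expect fun a => c * φ a) = c * p.expect φ := by
  simp only [PMF.expect, ← ENNReal.tsum_mul_left]
  exact tsum_congr fun a => by ring

theorem PMF.expect_add {α : Type*} (p : PMF α) (φ ψ : α → ℝ≥0∞) :
    (p.expect fun a => φ a + ψ a) = p.expect φ + p.expect ψ := by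
  simp only [PMF.expect, mul_add, ENNReal.tsum_add]

theorem PMF.expect_finset_sum {α ι : Type*} (p : PMF α) (s : Finset ι) (φ : ι → α → ℝ≥0∞) :
    (p.expect fun a => ∑ i ∈ s, φ i a) = ∑ i ∈ s, p.expect (φ i) := by
  simp only [PMF.expect, Finset.mul_sum]
  exact Summable.tsum_finsetSum fun i _ => ENNReal.summable

/-- Markov's inequality. -/
theorem PMF.mul_toOuterMeasure_le_expect {α : Type*} (p : PMF α) (φ : α → ℝ≥0∞) (c : ℝ≥0∞)
    (S : Set α) (h : ∀ a ∈ S, c ≤ φ a) : c * p.toOuterMeasure S ≤ p.expect φ := by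
  classical
  rw [PMF.toOuterMeasure_apply, ← ENNReal.tsum_mul_left]
  refine ENNReal.tsum_le_tsum fun a => ?_
  by_cases ha : a ∈ S
  · rw [Set.indicator_of_mem ha, mul_comm]
    exact mul_le_mul_right (h a ha) _
  · simp [Set.indicator_of_notMem ha]

/-- An expectation under `vSampling` is a finite sum. -/
theorem expect_vSampling {n : ℕ} {f : Finset (Fin n) → ℝ} {π : Equiv.Perm (Fin n)}
    (hv : ∀ i, 0 ≤ sampleVec f π i) (hs : 0 < ∑ i, sampleVec f π i) (φ : (Fin n → ℝ) → ℝ≥0∞) :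
    (vSampling f π).expect φ = ∑ j, ENNReal.ofReal (sampleVec f π j / ∑ i, sampleVec f π i) *
      φ (Pi.single j (subgrad f π j / (sampleVec f π j / ∑ i, sampleVec f π i))) := by
  have e : (∑' j, ENNReal.ofReal (sampleVec f π j)) = ENNReal.ofReal (∑ i, sampleVec f π i) := by
    rw [tsum_fintype, ENNReal.ofReal_sum_of_nonneg fun i _ => hv i]
  have h : (∑' j, ENNReal.ofReal (sampleVec f π j)) ≠ 0 := by
    rw [e]; simpa using hs
  rw [vSampling, dif_pos h, PMF.expect_map, PMF.expect, tsum_fintype]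
  refine Finset.sum_congr rfl fun j _ => ?_
  rw [PMF.normalize_apply, e, Function.comp_apply, l1norm_of_nonneg hv, ENNReal.ofReal_div_of_pos hs,
    ← div_eq_mul_inv]

theorem vSampling_of_sum_eq_zero {n : ℕ} {f : Finset (Fin n) → ℝ} {π : Equiv.Perm (Fin n)}
    (hv : ∀ i, 0 ≤ sampleVec f π i) (hs : ∑ i, sampleVec f π i = 0) :
    vSampling f π = PMF.pure 0 := by
  have e : (∑' j, ENNReal.ofReal (sampleVec f π j)) = ENNReal.ofReal (∑ i, sampleVec f π i) := by
    rw [tsum_fintype, ENNReal.ofReal_sum_of_nonneg fun i _ => hv i]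
  rw [vSampling, dif_neg]
  rw [e, hs]
  simp

/-! ### Exponential moments of one step -/

theorem abs_sum_subgrad_le {n : ℕ} {f : Finset (Fin n) → ℝ} (h0 : f ∅ = 0)
    (hf : IsSubmodular f) (hu : ∀ i, 0 ≤ upperVec f i) (π : Equiv.Perm (Fin n))
    (T : Finset (Fin n)) : |∑ i ∈ T, subgrad f π i| ≤ ∑ i, sampleVec f π i :=
  calc |∑ i ∈ T, subgrad f π i| ≤ ∑ i ∈ T, |subgrad f π i| := Finset.abs_sum_le_sum_abs _ _
    _ ≤ ∑ i ∈ T, sampleVec f π i :=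
      Finset.sum_le_sum fun i _ => abs_subgrad_le_sampleVec h0 hf hu π i
    _ ≤ ∑ i, sampleVec f π i := Finset.sum_le_sum_of_subset_of_nonneg (Finset.subset_univ T)
      fun i _ _ => sampleVec_nonneg h0 hf hu π i

/-- The bound of `expect_exp_vSampling_le` is nonnegative. -/
theorem expect_vSampling_bound_nonneg {n : ℕ} {f : Finset (Fin n) → ℝ} (h0 : f ∅ = 0)
    (hf : IsSubmodular f) (hu : ∀ i, 0 ≤ upperVec f i) (π : Equiv.Perm (Fin n))
    (T : Finset (Fin n)) {a U : ℝ} (hU : ∑ i, sampleVec f π i ≤ U) (ha : |a| * U ≤ 1) :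
    0 ≤ 1 + a * ∑ i ∈ T, subgrad f π i + a ^ 2 * U * ∑ i ∈ T, sampleVec f π i := by
  have hv := sampleVec_nonneg h0 hf hu π
  have h1 : |a * ∑ i ∈ T, subgrad f π i| ≤ 1 := by
    rw [abs_mul]
    exact (mul_le_mul_of_nonneg_left ((abs_sum_subgrad_le h0 hf hu π T).trans hU)
      (abs_nonneg a)).trans ha
  have h2 : 0 ≤ a ^ 2 * U * ∑ i ∈ T, sampleVec f π i :=
    mul_nonneg (mul_nonneg (sq_nonneg a) ((Finset.sum_nonneg fun i _ => hv i).trans hU))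
      (Finset.sum_nonneg fun i _ => hv i)
  have := (abs_le.1 h1).1
  linarith

/-- The sampled vector `h` has entries bounded by `‖v‖₁` and second moments
`E h_j² = g_j² ‖v‖₁ / v_j ≤ ‖v‖₁ v_j`, so `exp z ≤ 1 + z + z²` bounds the moment generating
function of `h(T)` in terms of `g(T)` and `v(T)`. -/
theorem expect_exp_vSampling_le {n : ℕ} {f : Finset (Fin n) → ℝ} (h0 : f ∅ = 0)
    (hf : IsSubmodular f) (hu : ∀ i, 0 ≤ upperVec f i) (π : Equiv.Perm (Fin n))
    (T : Finset (Fin n)) {a U : ℝ} (hU : ∑ i, sampleVec f π i ≤ U) (ha : |a| * U ≤ 1) :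
    ((vSampling f π).expect fun h => ENNReal.ofReal (Real.exp (a * ∑ i ∈ T, h i))) ≤
      ENNReal.ofReal
        (1 + a * ∑ i ∈ T, subgrad f π i + a ^ 2 * U * ∑ i ∈ T, sampleVec f π i) := by
  have hv := sampleVec_nonneg h0 hf hu π
  have hg := abs_subgrad_le_sampleVec h0 hf hu π
  rcases (Finset.sum_nonneg fun i (_ : i ∈ Finset.univ) => hv i).eq_or_lt with hs | hs
  · rw [vSampling_of_sum_eq_zero hv hs.symm, PMF.expect_pure]
    have hz : ∀ i, sampleVec f π i = 0 := fun i =>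
      (Finset.sum_eq_zero_iff_of_nonneg fun i _ => hv i).1 hs.symm i (Finset.mem_univ i)
    have hz' : ∀ i, subgrad f π i = 0 := fun i =>
      abs_eq_zero.1 (le_antisymm ((hg i).trans (hz i).le) (abs_nonneg _))
    simp [hz, hz']
  · rw [expect_vSampling hv hs]
    set s := ∑ i, sampleVec f π i with hsdef
    set v := sampleVec f π
    set g := subgrad f π
    have term : ∀ j, v j / s * Real.exp (a * ∑ i ∈ T,
        (Pi.single j (g j / (v j / s)) : Fin n → ℝ) i) ≤
        v j / s + (if j ∈ T then a * g j + a ^ 2 * U * v j else 0) := by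
      intro j
      rw [Finset.sum_pi_single']
      split_ifs with hj
      · -- `v_j = 0` forces `g_j = 0`, and then the junk value of `g_j / 0` is harmless
        rcases (hv j).eq_or_lt with hz | hz
        · have : g j = 0 := abs_eq_zero.1 (le_antisymm ((hg j).trans hz.ge) (abs_nonneg _))
          simp [this, show v j = 0 from hz.symm]
        · have hp : 0 < v j / s := div_pos hz hs
          have hc : |g j / (v j / s)| ≤ s := by
            rw [abs_div, abs_of_pos hp, div_le_iff₀ hp, mul_div_cancel₀ _ hs.ne']
            exact hg j
          set c := g j / (v j / s) with hcdef
          have hgc : g j = v j / s * c := by rw [hcdef, mul_div_cancel₀ _ hp.ne']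
          have hac : |a * c| ≤ 1 := by
            rw [abs_mul]
            exact (mul_le_mul_of_nonneg_left (hc.trans hU) (abs_nonneg a)).trans ha
          have h1 : Real.exp (a * c) ≤ 1 + a * c + (a * c) ^ 2 := by
            have := (abs_le.1 (Real.abs_exp_sub_one_sub_id_le hac)).2
            linarith
          have h2 : v j / s * c ^ 2 ≤ U * v j := by
            have hc2 : c ^ 2 ≤ s ^ 2 := sq_le_sq' (abs_le.1 hc).1 (abs_le.1 hc).2
            calc v j / s * c ^ 2 ≤ v j / s * s ^ 2 := mul_le_mul_of_nonneg_left hc2 hp.le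
              _ = s * v j := by field_simp
              _ ≤ U * v j := mul_le_mul_of_nonneg_right hU hz.le
          calc v j / s * Real.exp (a * c) ≤ v j / s * (1 + a * c + (a * c) ^ 2) :=
                mul_le_mul_of_nonneg_left h1 hp.le
            _ = v j / s + a * (v j / s * c) + a ^ 2 * (v j / s * c ^ 2) := by ring
            _ ≤ v j / s + a * g j + a ^ 2 * (U * v j) := by
                rw [← hgc]
                have := mul_le_mul_of_nonneg_left h2 (sq_nonneg a)
                linarith
            _ = _ := by ring
      · simp
    have e : ∀ j ∈ Finset.univ, ENNReal.ofReal (v j / s) * ENNReal.ofReal (Real.exp (a * ∑ i ∈ T,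
        (Pi.single j (g j / (v j / s)) : Fin n → ℝ) i)) = ENNReal.ofReal (v j / s *
        Real.exp (a * ∑ i ∈ T, (Pi.single j (g j / (v j / s)) : Fin n → ℝ) i)) :=
      fun j _ => (ENNReal.ofReal_mul (div_nonneg (hv j) hs.le)).symm
    rw [Finset.sum_congr rfl e, ← ENNReal.ofReal_sum_of_nonneg fun j _ =>
      mul_nonneg (div_nonneg (hv j) hs.le) (Real.exp_pos _).le]
    refine ENNReal.ofReal_le_ofReal ((Finset.sum_le_sum fun j _ => term j).trans (le_of_eq ?_))
    rw [Finset.sum_add_distrib, ← Finset.sum_div, ← hsdef, div_self hs.ne', Finset.sum_ite_mem,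
      Finset.univ_inter, Finset.sum_add_distrib, ← Finset.mul_sum, ← Finset.mul_sum]
    ring

/-! ### Exponential weights on small sets -/

/-- The subsets of `V` with at most `l` elements. -/
def smallSets (n l : ℕ) : Finset (Finset (Fin n)) := Finset.univ.filter fun T => T.card ≤ l

theorem mem_smallSets {n l : ℕ} {T : Finset (Fin n)} : T ∈ smallSets n l ↔ T.card ≤ l := by
  simp [smallSets]

theorem smallSets_nonempty (n l : ℕ) : 0 < (smallSets n l).card :=
  Finset.card_pos.2 ⟨∅, by simp [mem_smallSets]⟩

theorem card_smallSets_le (n l : ℕ) : (smallSets n l).card ≤ (n + 1) ^ l := by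
  have : smallSets n l ⊆ (Finset.univ : Finset (Fin l → Option (Fin n))).image fun g =>
      Finset.univ.filter fun v => ∃ i, g i = some v := by
    intro T hT
    rw [mem_smallSets] at hT
    rw [Finset.mem_image]
    refine ⟨fun i => if h : (i : ℕ) < T.card then some (T.equivFin.symm ⟨i, h⟩ : Fin n) else none,
      Finset.mem_univ _, ?_⟩
    ext v
    simp only [Finset.mem_filter, Finset.mem_univ, true_and]
    constructor
    · rintro ⟨i, hi⟩
      split_ifs at hi with h
      exact Option.some.inj hi ▸ (T.equivFin.symm ⟨i, h⟩).2
    · intro hv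
      have hlt := (T.equivFin ⟨v, hv⟩).2
      exact ⟨⟨T.equivFin ⟨v, hv⟩, hlt.trans_le hT⟩, by simp⟩
  refine (Finset.card_le_card this).trans (Finset.card_image_le.trans ?_)
  simp

/-- The total weight `∑ exp(-η H(T))` over the sets `T` with at most `l` elements. -/
noncomputable def hedgeWeight {n : ℕ} (l : ℕ) (η : ℝ) (H : Fin n → ℝ) : ℝ :=
  ∑ T ∈ smallSets n l, Real.exp (-η * ∑ i ∈ T, H i)

theorem hedgeWeight_zero (n l : ℕ) (η : ℝ) :
    hedgeWeight l η (0 : Fin n → ℝ) = (smallSets n l).card := by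
  simp [hedgeWeight]

/-- The weight of the sets that contain `v`; divided by `hedgeWeight` this is the point of the
truncated simplex that exponential weights play. -/
noncomputable def hedgeMarginal {n : ℕ} (l : ℕ) (η : ℝ) (H : Fin n → ℝ) (v : Fin n) : ℝ :=
  ∑ T ∈ smallSets n l, if v ∈ T then Real.exp (-η * ∑ i ∈ T, H i) else 0

theorem sum_hedge_mul {n : ℕ} (l : ℕ) (η : ℝ) (H x : Fin n → ℝ) :
    ∑ T ∈ smallSets n l, Real.exp (-η * ∑ i ∈ T, H i) * ∑ i ∈ T, x i =
      ∑ v, x v * hedgeMarginal l η H v := by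
  simp only [hedgeMarginal, Finset.mul_sum]
  rw [Finset.sum_comm]
  refine Finset.sum_congr rfl fun T _ => ?_
  rw [← Finset.sum_ite_mem_eq T]
  refine Finset.sum_congr rfl fun v _ => ?_
  split_ifs <;> ring

theorem hedgeMarginal_nonneg {n : ℕ} (l : ℕ) (η : ℝ) (H : Fin n → ℝ) (v : Fin n) :
    0 ≤ hedgeMarginal l η H v :=
  Finset.sum_nonneg fun T _ => by split_ifs <;> positivity

theorem hedgeMarginal_le {n : ℕ} (l : ℕ) (η : ℝ) (H : Fin n → ℝ) (v : Fin n) :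
    hedgeMarginal l η H v ≤ hedgeWeight l η H :=
  Finset.sum_le_sum fun T _ => by
    split_ifs
    · exact le_rfl
    · positivity

/-- Exchanging `a` and `b` shows that an element with smaller loss has a larger marginal. -/
theorem hedgeMarginal_antitone {n : ℕ} (l : ℕ) {η : ℝ} (hη : 0 ≤ η) (H : Fin n → ℝ) {a b : Fin n}
    (hab : H a ≤ H b) : hedgeMarginal l η H b ≤ hedgeMarginal l η H a := by
  simp only [hedgeMarginal, ← Finset.sum_filter]
  have hinj : Set.InjOn (fun T : Finset (Fin n) => T.map (Equiv.swap a b).toEmbedding)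
      (((smallSets n l).filter fun T => b ∈ T : Finset _) : Set (Finset (Fin n))) :=
    fun T _ T' _ h => Finset.map_injective _ h
  have hle : ∀ T ∈ (smallSets n l).filter (fun T => b ∈ T),
      Real.exp (-η * ∑ i ∈ T, H i) ≤
        Real.exp (-η * ∑ i ∈ T.map (Equiv.swap a b).toEmbedding, H i) := by
    intro T hT
    have hb := (Finset.mem_filter.1 hT).2
    rw [Real.exp_le_exp]
    have : ∑ i ∈ T.map (Equiv.swap a b).toEmbedding, H i ≤ ∑ i ∈ T, H i := by
      rw [Finset.sum_map]
      by_cases ha : a ∈ T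
      · refine le_of_eq ?_
        refine Finset.sum_equiv (Equiv.swap a b) (fun i => ?_) fun i _ => rfl
        by_cases h1 : i = a
        · simp [h1, ha, hb]
        by_cases h2 : i = b
        · simp [h2, ha, hb]
        rw [Equiv.swap_apply_of_ne_of_ne h1 h2]
      · refine Finset.sum_le_sum fun i hi => ?_
        have h1 : i ≠ a := fun h => ha (h ▸ hi)
        by_cases h2 : i = b
        · simp [h2, hab]
        · simp [Equiv.swap_apply_of_ne_of_ne h1 h2]
    nlinarith
  refine (Finset.sum_le_sum hle).trans ?_
  rw [← Finset.sum_image (f := fun T => Real.exp (-η * ∑ i ∈ T, H i)) hinj]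
  refine Finset.sum_le_sum_of_subset_of_nonneg (fun T hT => ?_) fun T _ _ => (Real.exp_pos _).le
  obtain ⟨T', hT', rfl⟩ := Finset.mem_image.1 hT
  rw [Finset.mem_filter, mem_smallSets] at hT' ⊢
  refine ⟨by rw [Finset.card_map]; exact hT'.1, Finset.mem_map.2 ⟨b, hT'.2, by simp⟩⟩

/-- The expected growth of the total weight in one step. -/
noncomputable def growthRate {n : ℕ} (f : Finset (Fin n) → ℝ) (l : ℕ) (η U : ℝ) : ℝ :=
  η * -minValue f + η ^ 2 * U * (2 * l * ‖upperVec f‖ + -minValue f)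

/-- One step of exponential weights: the expected total weight grows by a factor of at most
`exp (growthRate)`, because the subgradient is taken at a point that it sorts, where the Lovász
extension is at least `f^*`. -/
theorem expect_hedgeWeight_le {n : ℕ} {f : Finset (Fin n) → ℝ} (h0 : f ∅ = 0)
    (hf : IsSubmodular f) (hu : ∀ i, 0 ≤ upperVec f i) (l : ℕ) {η U : ℝ} (hη : 0 ≤ η)
    (hU : ∀ π, ∑ i, sampleVec f π i ≤ U) (ha : η * U ≤ 1) (H : Fin n → ℝ) :
    ((vSampling f (Tuple.sort H)).expect fun h => ENNReal.ofReal (hedgeWeight l η (H + h))) ≤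
      ENNReal.ofReal (hedgeWeight l η H * Real.exp (growthRate f l η U)) := by
  set π := Tuple.sort H with hπ
  set w : Finset (Fin n) → ℝ := fun T => Real.exp (-η * ∑ i ∈ T, H i) with hw
  have hwpos : ∀ T, 0 < w T := fun T => Real.exp_pos _
  have hU0 : 0 ≤ U :=
    (Finset.sum_nonneg fun i _ => sampleVec_nonneg h0 hf hu π i).trans (hU π)
  have ha' : |-η| * U ≤ 1 := by rwa [abs_neg, abs_of_nonneg hη]
  have hsplit : ∀ h : Fin n → ℝ, ENNReal.ofReal (hedgeWeight l η (H + h)) =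
      ∑ T ∈ smallSets n l, ENNReal.ofReal (w T) *
        ENNReal.ofReal (Real.exp (-η * ∑ i ∈ T, h i)) := by
    intro h
    rw [hedgeWeight, ENNReal.ofReal_sum_of_nonneg fun T _ => (Real.exp_pos _).le]
    refine Finset.sum_congr rfl fun T _ => ?_
    rw [← ENNReal.ofReal_mul (hwpos T).le, hw, ← Real.exp_add]
    simp only [Pi.add_apply, Finset.sum_add_distrib, mul_add]
  simp only [hsplit]
  rw [PMF.expect_finset_sum]
  simp only [PMF.expect_const_mul]
  refine (Finset.sum_le_sum fun T _ =>
    mul_le_mul_right (expect_exp_vSampling_le h0 hf hu π T (hU π) ha') _).trans ?_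
  simp only [← ENNReal.ofReal_mul (hwpos _).le]
  rw [← ENNReal.ofReal_sum_of_nonneg fun T _ => mul_nonneg (hwpos T).le
    (expect_vSampling_bound_nonneg h0 hf hu π T (hU π) ha')]
  refine ENNReal.ofReal_le_ofReal ?_
  set W := hedgeWeight l η H with hW
  have hWsum : W = ∑ T ∈ smallSets n l, w T := rfl
  have hW0 : 0 ≤ W := hWsum ▸ Finset.sum_nonneg fun T _ => (hwpos T).le
  have hgsum : minValue f * W ≤ ∑ T ∈ smallSets n l, w T * ∑ i ∈ T, subgrad f π i := by
    rw [sum_hedge_mul]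
    exact minValue_mul_le_sum_subgrad h0 π _ W (hedgeMarginal_le l η H) hW0
      (hedgeMarginal_nonneg l η H)
      fun i j hij => hedgeMarginal_antitone l hη H (Tuple.monotone_sort H hij)
  have husum : ∑ T ∈ smallSets n l, w T * ∑ i ∈ T, upperVec f i ≤ l * ‖upperVec f‖ * W := by
    rw [hWsum, Finset.mul_sum]
    refine Finset.sum_le_sum fun T hT => ?_
    rw [mul_comm]
    refine mul_le_mul_of_nonneg_right ?_ (hwpos T).le
    calc ∑ i ∈ T, upperVec f i ≤ T.card • ‖upperVec f‖ :=
          Finset.sum_le_card_nsmul _ _ _ fun i _ => (Real.le_norm_self _).trans (norm_le_pi_norm _ i)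
      _ ≤ l * ‖upperVec f‖ := by
          rw [nsmul_eq_mul]
          exact mul_le_mul_of_nonneg_right (by exact_mod_cast mem_smallSets.1 hT) (norm_nonneg _)
  have hexp : ∑ T ∈ smallSets n l, w T * (1 + -η * ∑ i ∈ T, subgrad f π i +
      (-η) ^ 2 * U * ∑ i ∈ T, sampleVec f π i) = W - η * ∑ T ∈ smallSets n l,
      w T * ∑ i ∈ T, subgrad f π i + η ^ 2 * U * (2 * ∑ T ∈ smallSets n l, w T *
      ∑ i ∈ T, upperVec f i - ∑ T ∈ smallSets n l, w T * ∑ i ∈ T, subgrad f π i) := by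
    rw [hWsum]
    simp only [Finset.mul_sum _ _ η, Finset.mul_sum _ _ (2 : ℝ), ← Finset.sum_sub_distrib,
      ← Finset.sum_add_distrib, Finset.mul_sum _ _ (η ^ 2 * U)]
    refine Finset.sum_congr rfl fun T _ => ?_
    simp only [sampleVec, Finset.sum_sub_distrib, ← Finset.mul_sum]
    ring
  rw [hexp]
  have h1 : W * (1 + growthRate f l η U) ≤ W * Real.exp (growthRate f l η U) :=
    mul_le_mul_of_nonneg_left (by linarith [Real.add_one_le_exp (growthRate f l η U)]) hW0
  refine le_trans ?_ h1
  have h2 := mul_le_mul_of_nonneg_left hgsum hη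
  have h3 : 0 ≤ η ^ 2 * U := mul_nonneg (sq_nonneg η) hU0
  have h4 := mul_le_mul_of_nonneg_left hgsum h3
  have h5 := mul_le_mul_of_nonneg_left husum h3
  simp only [growthRate]
  nlinarith

/-! ### Iterated steps and the two supermartingales -/

/-- The law after `t` steps of a Markov chain with kernel `G`. -/
noncomputable def PMF.iter {α : Type*} (G : α → PMF α) : ℕ → α → PMF α
  | 0, a => PMF.pure a
  | t + 1, a => (G a).bind (PMF.iter G t)

theorem PMF.iter_succ' {α : Type*} (G : α → PMF α) (t : ℕ) (a : α) :
    PMF.iter G (t + 1) a = (PMF.iter G t a).bind G := by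
  induction t generalizing a with
  | zero => simp [PMF.iter]
  | succ t ih =>
    change (G a).bind (PMF.iter G (t + 1)) = ((G a).bind (PMF.iter G t)).bind G
    rw [PMF.bind_bind]
    congr 1
    funext b
    exact ih b

theorem PMF.expect_iter_le {α : Type*} {G : α → PMF α} {Φ : α → ℝ≥0∞}
    (h : ∀ a, (G a).expect Φ ≤ Φ a) (t : ℕ) (a : α) : (PMF.iter G t a).expect Φ ≤ Φ a := by
  induction t generalizing a with
  | zero => rw [PMF.iter, PMF.expect_pure]
  | succ t ih =>
    rw [PMF.iter, PMF.expect_bind]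
    exact (PMF.expect_mono _ fun b _ => ih b).trans (h a)

/-- One iteration in terms of the accumulated loss alone: the permutation sorts the losses. -/
noncomputable def lossStep {n : ℕ} (f : Finset (Fin n) → ℝ)
    (s : (Fin n → ℝ) × List (Equiv.Perm (Fin n))) :
    PMF ((Fin n → ℝ) × List (Equiv.Perm (Fin n))) :=
  (vSampling f (Tuple.sort s.1)).map fun h => (s.1 + h, s.2 ++ [Tuple.sort s.1])

/-- The permutations of `M` iterations started with zero loss. -/
noncomputable def lossRun {n : ℕ} (f : Finset (Fin n) → ℝ) (M : ℕ) :
    PMF (List (Equiv.Perm (Fin n))) :=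
  (PMF.iter (lossStep f) M (0, [])).map Prod.snd

/-- `g_π(T)` with the correction terms of both supermartingales. -/
noncomputable def stepCost {n : ℕ} (f : Finset (Fin n) → ℝ) (l : ℕ) (η U : ℝ)
    (T : Finset (Fin n)) (π : Equiv.Perm (Fin n)) : ℝ :=
  growthRate f l η U + (η * ∑ i ∈ T, subgrad f π i + η ^ 2 * U * ∑ i ∈ T, sampleVec f π i)

/-- The first supermartingale: the total weight, discounted by its growth rate. -/
theorem expect_lossStep_weight_le {n : ℕ} {f : Finset (Fin n) → ℝ} (h0 : f ∅ = 0)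
    (hf : IsSubmodular f) (hu : ∀ i, 0 ≤ upperVec f i) (l : ℕ) {η U : ℝ} (hη : 0 ≤ η)
    (hU : ∀ π, ∑ i, sampleVec f π i ≤ U) (ha : η * U ≤ 1)
    (s : (Fin n → ℝ) × List (Equiv.Perm (Fin n))) :
    ((lossStep f s).expect fun s => ENNReal.ofReal
      (hedgeWeight l η s.1 * Real.exp (-(s.2.length * growthRate f l η U)))) ≤
    ENNReal.ofReal (hedgeWeight l η s.1 * Real.exp (-(s.2.length * growthRate f l η U))) := by
  rw [lossStep, PMF.expect_map]
  have hW : ∀ H : Fin n → ℝ, 0 ≤ hedgeWeight l η H := fun H =>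
    Finset.sum_nonneg fun T _ => (Real.exp_pos _).le
  simp only [Function.comp_def, List.length_append, List.length_singleton]
  set κ := growthRate f l η U with hκ
  have e : ∀ h : Fin n → ℝ, ENNReal.ofReal (hedgeWeight l η (s.1 + h) *
      Real.exp (-(((s.2.length + 1 : ℕ) : ℝ) * κ))) =
      ENNReal.ofReal (Real.exp (-(((s.2.length + 1 : ℕ) : ℝ) * κ))) *
        ENNReal.ofReal (hedgeWeight l η (s.1 + h)) := fun h => by
    rw [mul_comm, ENNReal.ofReal_mul (Real.exp_pos _).le]
  simp only [e]
  rw [PMF.expect_const_mul]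
  refine (mul_le_mul_right (expect_hedgeWeight_le h0 hf hu l hη hU ha s.1) _).trans ?_
  rw [← ENNReal.ofReal_mul (Real.exp_pos _).le]
  refine ENNReal.ofReal_le_ofReal (le_of_eq ?_)
  rw [← hκ, mul_comm, mul_assoc, ← Real.exp_add]
  push_cast
  ring_nf

/-- The second supermartingale: the sampled loss `H(T)` against `∑ g_π(T)`, with a correction
proportional to the conditional variance. -/
theorem expect_lossStep_deviation_le {n : ℕ} {f : Finset (Fin n) → ℝ} (h0 : f ∅ = 0)
    (hf : IsSubmodular f) (hu : ∀ i, 0 ≤ upperVec f i) {η U : ℝ} (hη : 0 ≤ η)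
    (hU : ∀ π, ∑ i, sampleVec f π i ≤ U) (ha : η * U ≤ 1) (T : Finset (Fin n))
    (s : (Fin n → ℝ) × List (Equiv.Perm (Fin n))) :
    ((lossStep f s).expect fun s => ENNReal.ofReal (Real.exp (η * ∑ i ∈ T, s.1 i -
      (s.2.map fun π => η * ∑ i ∈ T, subgrad f π i +
        η ^ 2 * U * ∑ i ∈ T, sampleVec f π i).sum))) ≤
    ENNReal.ofReal (Real.exp (η * ∑ i ∈ T, s.1 i -
      (s.2.map fun π => η * ∑ i ∈ T, subgrad f π i +
        η ^ 2 * U * ∑ i ∈ T, sampleVec f π i).sum)) := by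
  rw [lossStep, PMF.expect_map]
  simp only [Function.comp_def, List.map_append, List.sum_append, List.map_singleton,
    List.sum_singleton]
  set b : Equiv.Perm (Fin n) → ℝ := fun π => η * ∑ i ∈ T, subgrad f π i +
        η ^ 2 * U * ∑ i ∈ T, sampleVec f π i
  set π := Tuple.sort s.1
  have e : ∀ h : Fin n → ℝ, ENNReal.ofReal (Real.exp (η * ∑ i ∈ T, (s.1 + h) i -
      ((s.2.map b).sum + b π))) =
      ENNReal.ofReal (Real.exp (η * ∑ i ∈ T, s.1 i - ((s.2.map b).sum + b π))) *
        ENNReal.ofReal (Real.exp (η * ∑ i ∈ T, h i)) := fun h => by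
    rw [← ENNReal.ofReal_mul (Real.exp_pos _).le, ← Real.exp_add]
    simp only [Pi.add_apply, Finset.sum_add_distrib, mul_add]
    ring_nf
  change PMF.expect _ (fun h => ENNReal.ofReal (Real.exp (η * ∑ i ∈ T, (s.1 + h) i -
      ((s.2.map b).sum + b π)))) ≤ _
  simp only [e]
  rw [PMF.expect_const_mul]
  refine (mul_le_mul_right (expect_exp_vSampling_le h0 hf hu π T (hU π)
    (by rwa [abs_of_nonneg hη])) _).trans ?_
  rw [← ENNReal.ofReal_mul (Real.exp_pos _).le]
  refine ENNReal.ofReal_le_ofReal ?_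
  have hbound : 1 + η * ∑ i ∈ T, subgrad f π i + η ^ 2 * U * ∑ i ∈ T, sampleVec f π i ≤
      Real.exp (b π) := by
    have := Real.add_one_le_exp (b π)
    simp only [b] at this ⊢
    linarith
  refine (mul_le_mul_of_nonneg_left hbound (Real.exp_pos _).le).trans ?_
  · rw [← Real.exp_add]
    exact Real.exp_le_exp.2 (by linarith)

/-- The exponential moment of a run: the arithmetic-geometric mean of the two supermartingales
dominates a functional of the list of permutations alone. -/
theorem expect_lossRun_le {n : ℕ} {f : Finset (Fin n) → ℝ} (h0 : f ∅ = 0)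
    (hf : IsSubmodular f) (hu : ∀ i, 0 ≤ upperVec f i) {l : ℕ} {η U : ℝ} (hη : 0 ≤ η)
    (hU : ∀ π, ∑ i, sampleVec f π i ≤ U) (ha : η * U ≤ 1) {T : Finset (Fin n)}
    (hT : T.card ≤ l) (M : ℕ) :
    ((lossRun f M).expect fun L => ENNReal.ofReal
      (Real.exp (-(L.map (stepCost f l η U T)).sum / 2))) ≤
    ENNReal.ofReal (Real.exp (Real.log (smallSets n l).card / 2)) := by
  set W0 : ℝ := ((smallSets n l).card : ℝ) with hW0
  have hW0pos : 0 < W0 := by rw [hW0]; exact_mod_cast smallSets_nonempty n l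
  set κ := growthRate f l η U with hκ
  set b : Equiv.Perm (Fin n) → ℝ := fun π => η * ∑ i ∈ T, subgrad f π i +
        η ^ 2 * U * ∑ i ∈ T, sampleVec f π i with hb
  have hA := PMF.expect_iter_le (expect_lossStep_weight_le h0 hf hu l hη hU ha) M (0, [])
  have hB := PMF.expect_iter_le (expect_lossStep_deviation_le h0 hf hu hη hU ha T) M (0, [])
  simp only [hedgeWeight_zero, List.length_nil, Nat.cast_zero, zero_mul, neg_zero, Real.exp_zero,
    mul_one, Pi.zero_apply, Finset.sum_const_zero, mul_zero, List.map_nil, List.sum_nil,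
    sub_zero] at hA hB
  rw [lossRun, PMF.expect_map]
  have hpt : ∀ s : (Fin n → ℝ) × List (Equiv.Perm (Fin n)),
      ENNReal.ofReal (Real.exp (-(s.2.map (stepCost f l η U T)).sum / 2)) ≤
      ENNReal.ofReal (Real.exp (Real.log W0 / 2) / 2 / W0) *
        ENNReal.ofReal (hedgeWeight l η s.1 * Real.exp (-(s.2.length * κ))) +
      ENNReal.ofReal (Real.exp (Real.log W0 / 2) / 2) *
        ENNReal.ofReal (Real.exp (η * ∑ i ∈ T, s.1 i - (s.2.map b).sum)) := by
    intro s
    have hc1 : 0 ≤ Real.exp (Real.log W0 / 2) / 2 / W0 := by positivity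
    have hc2 : 0 ≤ Real.exp (Real.log W0 / 2) / 2 := by positivity
    have hWn : 0 ≤ hedgeWeight l η s.1 := Finset.sum_nonneg fun T _ => (Real.exp_pos _).le
    rw [← ENNReal.ofReal_mul hc1, ← ENNReal.ofReal_mul hc2, ← ENNReal.ofReal_add
      (mul_nonneg hc1 (mul_nonneg hWn (Real.exp_pos _).le)) (mul_nonneg hc2 (Real.exp_pos _).le)]
    refine ENNReal.ofReal_le_ofReal ?_
    have hsum : (s.2.map (stepCost f l η U T)).sum = s.2.length * κ + (s.2.map b).sum := by
      have : stepCost f l η U T = fun π => κ + b π := rfl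
      rw [this, List.sum_map_add]
      simp
    set X := -η * ∑ i ∈ T, s.1 i - s.2.length * κ - Real.log W0 with hX
    set Y := η * ∑ i ∈ T, s.1 i - (s.2.map b).sum with hY
    have hw : Real.exp (-η * ∑ i ∈ T, s.1 i) ≤ hedgeWeight l η s.1 :=
      Finset.single_le_sum (f := fun T => Real.exp (-η * ∑ i ∈ T, s.1 i))
        (fun T _ => (Real.exp_pos _).le) (mem_smallSets.2 hT)
    have hXle : Real.exp X ≤ hedgeWeight l η s.1 * Real.exp (-(s.2.length * κ)) / W0 := by
      rw [hX, Real.exp_sub, Real.exp_log hW0pos, sub_eq_add_neg, Real.exp_add]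
      gcongr
    have hamgm : Real.exp ((X + Y) / 2) ≤ (Real.exp X + Real.exp Y) / 2 := by
      have h1 : Real.exp X = Real.exp (X / 2) ^ 2 := by rw [← Real.exp_nat_mul]; ring_nf
      have h2 : Real.exp Y = Real.exp (Y / 2) ^ 2 := by rw [← Real.exp_nat_mul]; ring_nf
      have h3 : Real.exp ((X + Y) / 2) = Real.exp (X / 2) * Real.exp (Y / 2) := by
        rw [← Real.exp_add]; ring_nf
      rw [h1, h2, h3]
      nlinarith [sq_nonneg (Real.exp (X / 2) - Real.exp (Y / 2))]
    calc Real.exp (-(s.2.map (stepCost f l η U T)).sum / 2)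
        = Real.exp (Real.log W0 / 2) * Real.exp ((X + Y) / 2) := by
          rw [← Real.exp_add, hsum, hX, hY]; ring_nf
      _ ≤ Real.exp (Real.log W0 / 2) * ((hedgeWeight l η s.1 * Real.exp (-(s.2.length * κ)) / W0 +
            Real.exp Y) / 2) := by
          refine mul_le_mul_of_nonneg_left (hamgm.trans ?_) (Real.exp_pos _).le
          linarith
      _ = _ := by ring
  refine (PMF.expect_mono _ fun s _ => hpt s).trans ?_
  rw [PMF.expect_add, PMF.expect_const_mul, PMF.expect_const_mul]
  refine (add_le_add (mul_le_mul_right hA _) (mul_le_mul_right hB _)).trans ?_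
  rw [← ENNReal.ofReal_mul (by positivity), ← ENNReal.ofReal_mul (by positivity),
    ← ENNReal.ofReal_add (by positivity) (by positivity)]
  refine ENNReal.ofReal_le_ofReal (le_of_eq ?_)
  rw [← hW0]
  field_simp
  norm_num

/-! ### The minimizer of the regularized loss is sorted by the loss -/

theorem isCompact_truncSimplex (n l : ℕ) : IsCompact (truncSimplex n l) := by
  have h : truncSimplex n l = Set.Icc (0 : Fin n → ℝ) 1 ∩ {x | l1norm x ≤ (l : ℝ)} := by
    ext x
    simp only [truncSimplex, Set.mem_ofPred_eq, Set.mem_inter_iff, Set.mem_Icc, Pi.le_def,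
      Pi.zero_apply, Pi.one_apply, forall_and]
  rw [h]
  refine isCompact_Icc.inter_right (isClosed_le ?_ continuous_const)
  unfold l1norm
  fun_prop

theorem zero_mem_truncSimplex (n l : ℕ) : (0 : Fin n → ℝ) ∈ truncSimplex n l := by
  simp [truncSimplex, l1norm]

theorem ftrlPoint_spec {n : ℕ} (k : ℕ) (η : ℝ) (H : Fin n → ℝ) :
    ftrlPoint k η H ∈ truncSimplex n k ∧
      IsMinOn (fun z : Fin n → ℝ => η * (∑ i, H i * z i) + entropyReg z) (truncSimplex n k)
        (ftrlPoint k η H) := by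
  refine Classical.epsilon_spec (p := fun x => x ∈ truncSimplex n k ∧
    IsMinOn (fun z : Fin n → ℝ => η * (∑ i, H i * z i) + entropyReg z) (truncSimplex n k) x) ?_
  refine (isCompact_truncSimplex n k).exists_isMinOn ⟨0, zero_mem_truncSimplex n k⟩ ?_
  refine Continuous.continuousOn (Continuous.add (by fun_prop) ?_)
  exact continuous_finsetSum _ fun i _ => Real.continuous_mul_log.comp (continuous_apply i)

theorem sum_eq_add_add_sum_compl {n : ℕ} {i j : Fin n} (hij : i ≠ j) (F : Fin n → ℝ) :
    ∑ v, F v = F i + F j + ∑ v ∈ {i, j}ᶜ, F v := by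
  rw [← Finset.sum_add_sum_compl {i, j}, Finset.sum_pair hij]

/-- Replacing two coordinates of a feasible point by numbers in `[0,1]` with the same sum keeps it
feasible, so optimality compares the objective on these two coordinates only. -/
theorem ftrlPoint_pair_le {n : ℕ} (k : ℕ) (η : ℝ) (H : Fin n → ℝ) {i j : Fin n} (hij : i ≠ j)
    {a b : ℝ} (ha0 : 0 ≤ a) (ha1 : a ≤ 1) (hb0 : 0 ≤ b) (hb1 : b ≤ 1)
    (hab : a + b = ftrlPoint k η H i + ftrlPoint k η H j) :
    η * (H i * ftrlPoint k η H i + H j * ftrlPoint k η H j) +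
        (ftrlPoint k η H i * Real.log (ftrlPoint k η H i) +
          ftrlPoint k η H j * Real.log (ftrlPoint k η H j)) ≤
      η * (H i * a + H j * b) + (a * Real.log a + b * Real.log b) := by
  obtain ⟨⟨hx, hx1⟩, hmin⟩ := ftrlPoint_spec k η H
  set x := ftrlPoint k η H
  set z : Fin n → ℝ := Function.update (Function.update x i a) j b with hz
  have hzi : z i = a := by simp [hz, hij]
  have hzj : z j = b := by simp [hz]
  have hzo : ∀ v ∈ ({i, j}ᶜ : Finset (Fin n)), z v = x v := by
    intro v hv
    simp only [Finset.mem_compl, Finset.mem_insert, Finset.mem_singleton, not_or] at hv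
    simp [hz, hv.1, hv.2]
  have hz01 : ∀ v, 0 ≤ z v ∧ z v ≤ 1 := by
    intro v
    by_cases h1 : v = j
    · rw [h1, hzj]; exact ⟨hb0, hb1⟩
    by_cases h2 : v = i
    · rw [h2, hzi]; exact ⟨ha0, ha1⟩
    rw [hzo v (by simp [h1, h2])]
    exact hx v
  have hzmem : z ∈ truncSimplex n k := by
    refine ⟨hz01, le_trans (le_of_eq ?_) hx1⟩
    rw [l1norm_of_nonneg fun v => (hz01 v).1, l1norm_of_nonneg fun v => (hx v).1,
      sum_eq_add_add_sum_compl hij z, sum_eq_add_add_sum_compl hij x, hzi, hzj, hab,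
      Finset.sum_congr rfl hzo]
  have h := hmin hzmem
  simp only [Set.mem_ofPred_eq, entropyReg] at h
  rw [sum_eq_add_add_sum_compl hij (fun v => H v * z v),
    sum_eq_add_add_sum_compl hij (fun v => H v * x v),
    sum_eq_add_add_sum_compl hij (fun v => z v * Real.log (z v)),
    sum_eq_add_add_sum_compl hij (fun v => x v * Real.log (x v)), hzi, hzj,
    Finset.sum_congr rfl fun v hv => show H v * z v = H v * x v by rw [hzo v hv],
    Finset.sum_congr rfl fun v hv => show z v * Real.log (z v) = x v * Real.log (x v) by
      rw [hzo v hv]] at h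
  linarith

theorem ftrlPoint_le_of_lt {n : ℕ} (k : ℕ) {η : ℝ} (hη : 0 < η) (H : Fin n → ℝ) {i j : Fin n}
    (hij : H i < H j) : ftrlPoint k η H j ≤ ftrlPoint k η H i := by
  obtain ⟨⟨hx, _⟩, _⟩ := ftrlPoint_spec k η H
  have hne : i ≠ j := fun h => hij.ne (congrArg H h)
  have h := ftrlPoint_pair_le k η H hne (hx j).1 (hx j).2 (hx i).1 (hx i).2 (add_comm _ _)
  by_contra! hc
  nlinarith [mul_pos hη (mul_pos (sub_pos.2 hij) (sub_pos.2 hc))]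

/-- Strict convexity of `x log x` forces equal coordinates where the losses are equal. -/
theorem ftrlPoint_eq_of_eq {n : ℕ} (k : ℕ) (η : ℝ) (H : Fin n → ℝ) {i j : Fin n}
    (hij : H i = H j) : ftrlPoint k η H i = ftrlPoint k η H j := by
  obtain ⟨⟨hx, _⟩, _⟩ := ftrlPoint_spec k η H
  by_contra hc
  have hne : i ≠ j := fun h => hc (congrArg _ h)
  set x := ftrlPoint k η H with hxdef
  have hm0 : 0 ≤ (x i + x j) / 2 := by linarith [(hx i).1, (hx j).1]
  have hm1 : (x i + x j) / 2 ≤ 1 := by linarith [(hx i).2, (hx j).2]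
  have h := ftrlPoint_pair_le k η H hne hm0 hm1 hm0 hm1 (by rw [← hxdef]; ring)
  rw [← hxdef] at h
  have hs := Real.strictConvexOn_mul_log.2 (Set.mem_Ici.2 (hx i).1) (Set.mem_Ici.2 (hx j).1) hc
    (by norm_num : (0 : ℝ) < 1 / 2) (by norm_num : (0 : ℝ) < 1 / 2) (by norm_num)
  simp only [smul_eq_mul] at hs
  have e : 1 / 2 * x i + 1 / 2 * x j = (x i + x j) / 2 := by ring
  rw [e] at hs
  rw [hij] at h
  nlinarith

/-- If `x` is constant where `H` is and decreases where `H` increases, then sorting by decreasing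
`x` with ties broken by `H` is sorting by `H`. -/
theorem sortPerm_eq_sort {n : ℕ} {x H : Fin n → ℝ} (hlt : ∀ i j, H i < H j → x j ≤ x i)
    (heq : ∀ i j, H i = H j → x i = x j) : sortPerm x H = Tuple.sort H := by
  refine Tuple.eq_sort_iff.2 ⟨?_, ?_⟩
  · intro a b hab
    have h := Tuple.monotone_sort (fun i => toLex (-(x i), H i)) hab
    simp only [Function.comp_apply, Prod.Lex.toLex_le_toLex] at h ⊢
    rw [sortPerm]
    rcases h with h | h
    · by_contra! hc
      linarith [hlt _ _ hc]
    · exact h.2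
  · intro a b hab h
    rw [sortPerm] at h ⊢
    refine (Tuple.eq_sort_iff.1 (rfl : Tuple.sort (fun i => toLex (-(x i), H i)) = _)).2 a b hab ?_
    rw [h, heq _ _ h]

/-- The algorithm outputs the permutations that sort the accumulated losses. -/
theorem submodularFTRL_eq_lossRun {n : ℕ} (A : ℕ) (f : Finset (Fin n) → ℝ) (k : ℕ) (φ δ : ℝ)
    (hη : 0 < δ / (Uinf f k φ * Uone f φ)) :
    submodularFTRL A f k φ δ = lossRun f (ftrlIters A f k φ δ) := by
  set η := δ / (Uinf f k φ * Uone f φ) with hηdef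
  have key : ∀ t : ℕ, (∀ s ∈ (ftrlLoop f k η t).support,
      sortPerm s.point s.loss = Tuple.sort s.loss) ∧
      (ftrlLoop f k η t).map (fun s => (s.loss, s.perms)) =
        PMF.iter (lossStep f) t (0, []) := by
    intro t
    induction t with
    | zero =>
      constructor
      · intro s hs
        rw [ftrlLoop, PMF.support_pure, Set.mem_singleton_iff] at hs
        subst hs
        exact sortPerm_eq_sort (fun _ _ _ => le_rfl) fun _ _ _ => rfl
      · rw [ftrlLoop, PMF.pure_map, PMF.iter]
    | succ t ih =>
      obtain ⟨ih1, ih2⟩ := ih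
      constructor
      · intro s hs
        rw [ftrlLoop, PMF.mem_support_bind_iff] at hs
        obtain ⟨s', _, hs⟩ := hs
        rw [ftrlStep, PMF.mem_support_map_iff] at hs
        obtain ⟨h, _, rfl⟩ := hs
        exact sortPerm_eq_sort (fun i j hij => ftrlPoint_le_of_lt k hη _ hij)
          fun i j hij => ftrlPoint_eq_of_eq k η _ hij
      · rw [ftrlLoop, PMF.iter_succ', ← ih2, PMF.map_bind, PMF.bind_map]
        have : ∀ s ∈ (ftrlLoop f k η t).support,
            (ftrlStep f k η s).map (fun s => (s.loss, s.perms)) =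
              lossStep f (s.loss, s.perms) := by
          intro s hs
          rw [ftrlStep, ih1 s hs, PMF.map_comp]
          rfl
        ext y
        rw [PMF.bind_apply, PMF.bind_apply]
        refine tsum_congr fun s => ?_
        by_cases hs : ftrlLoop f k η t s = 0
        · rw [hs, zero_mul, zero_mul]
        · rw [this s ((PMF.mem_support_iff _ _).2 hs)]
          rfl
  rw [submodularFTRL, ← hηdef, lossRun, ← (key _).2, PMF.map_comp]
  rfl

theorem length_of_mem_support_lossRun {n : ℕ} {f : Finset (Fin n) → ℝ} {M : ℕ}
    {L : List (Equiv.Perm (Fin n))} (hL : L ∈ (lossRun f M).support) : L.length = M := by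
  have key : ∀ (t : ℕ) (a s : (Fin n → ℝ) × List (Equiv.Perm (Fin n))),
      s ∈ (PMF.iter (lossStep f) t a).support → s.2.length = a.2.length + t := by
    intro t
    induction t with
    | zero =>
      intro a s hs
      rw [PMF.iter, PMF.support_pure, Set.mem_singleton_iff] at hs
      rw [hs, add_zero]
    | succ t ih =>
      intro a s hs
      rw [PMF.iter, PMF.mem_support_bind_iff] at hs
      obtain ⟨b, hb, hs⟩ := hs
      rw [lossStep, PMF.mem_support_map_iff] at hb
      obtain ⟨h, _, rfl⟩ := hb
      rw [ih _ _ hs]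
      simp only [List.length_append, List.length_singleton]
      ring
  rw [lossRun, PMF.mem_support_map_iff] at hL
  obtain ⟨s, hs, rfl⟩ := hL
  simpa using key M _ s hs

/-! ### Reduction of `y_-^ℓ(V)` to sets -/

/-- The minimum of a linear function on the truncated simplex is attained at the indicator of a
set: the minimizing set lies below a threshold `τ ≤ 0`. -/
theorem le_sparseNeg {n : ℕ} {y : Fin n → ℝ} {l : ℕ} (hl : 0 < l) {b : ℝ}
    (hb : ∀ T : Finset (Fin n), T.card ≤ l → b ≤ ∑ i ∈ T, y i) : b ≤ sparseNeg y l := by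
  refine le_csInf ⟨_, 0, zero_mem_truncSimplex n l, rfl⟩ ?_
  rintro _ ⟨w, ⟨hw, hw1⟩, rfl⟩
  simp only
  rw [l1norm_of_nonneg fun i => (hw i).1] at hw1
  obtain ⟨T, hT, hmin⟩ := Finset.exists_min_image (smallSets n l) (fun T => ∑ i ∈ T, y i)
    (Finset.card_pos.1 (smallSets_nonempty n l))
  rw [mem_smallSets] at hT
  refine (hb T hT).trans ?_
  have hneg : ∀ i ∈ T, y i ≤ 0 := by
    intro i hi
    have h := hmin (T.erase i) (mem_smallSets.2 ((Finset.card_erase_le).trans hT))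
    rw [← Finset.add_sum_erase T y hi] at h
    linarith
  obtain ⟨τ, hτ, hin, hout, hslack⟩ : ∃ τ ≤ 0, (∀ i ∈ T, y i ≤ τ) ∧ (∀ i ∉ T, τ ≤ y i) ∧
      (τ = 0 ∨ T.card = l) := by
    rcases hT.lt_or_eq with hlt | heq
    · refine ⟨0, le_rfl, hneg, fun i hi => ?_, Or.inl rfl⟩
      have h := hmin (insert i T) (mem_smallSets.2 (by rw [Finset.card_insert_of_notMem hi]; omega))
      rw [Finset.sum_insert hi] at h
      linarith
    · obtain ⟨j, hj, hmax⟩ := Finset.exists_max_image T y (Finset.card_pos.1 (heq ▸ hl))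
      refine ⟨y j, hneg j hj, hmax, fun i hi => ?_, Or.inr heq⟩
      have hi' : i ∉ T.erase j := fun h => hi (Finset.mem_of_mem_erase h)
      have h := hmin (insert i (T.erase j)) (mem_smallSets.2 (by
        rw [Finset.card_insert_of_notMem hi', Finset.card_erase_of_mem hj]; omega))
      rw [Finset.sum_insert hi', ← Finset.add_sum_erase T y hj] at h
      linarith
  have hterm : ∀ i, (if i ∈ T then y i else 0) + τ * (w i - if i ∈ T then 1 else 0) ≤
      y i * w i := by
    intro i
    have := hw i
    split_ifs with h
    · nlinarith [hin i h]
    · nlinarith [hout i h]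
  have hsum := Finset.sum_le_sum fun i (_ : i ∈ Finset.univ) => hterm i
  rw [Finset.sum_add_distrib, Finset.sum_ite_mem_eq, ← Finset.mul_sum, Finset.sum_sub_distrib,
    Finset.sum_ite_mem_eq T (fun _ => (1 : ℝ)), Finset.sum_const, nsmul_eq_mul, mul_one] at hsum
  have : 0 ≤ τ * (∑ i, w i - T.card) := by
    rcases hslack with h | h
    · simp [h]
    · rw [h]
      exact mul_nonneg_of_nonpos_of_nonpos hτ (by linarith)
  linarith

/-! ### The average subgradient is a dual certificate with high probability -/

theorem sum_avgSubgrad {n : ℕ} (f : Finset (Fin n) → ℝ) (L : List (Equiv.Perm (Fin n)))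
    (S : Finset (Fin n)) :
    ∑ i ∈ S, avgSubgrad f L i = (L.map fun π => ∑ i ∈ S, subgrad f π i).sum / L.length := by
  simp only [avgSubgrad]
  rw [← Finset.sum_div]
  congr 1
  induction L with
  | nil => simp
  | cons π L ih => simp only [List.map_cons, List.sum_cons, Finset.sum_add_distrib, ih]

theorem list_sum_map_le {α : Type*} (L : List α) (F : α → ℝ) (b : ℝ) (h : ∀ a, F a ≤ b) :
    (L.map F).sum ≤ L.length * b := by
  induction L with
  | nil => simp
  | cons a L ih =>
    simp only [List.map_cons, List.sum_cons, List.length_cons, Nat.cast_add, Nat.cast_one]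
    linarith [h a]

/-- Expanding `v = 2 u_f - g_π` puts the variance correction into the factor `1 - η U` of
`∑ g_π(T)`. -/
theorem sum_stepCost {n : ℕ} (f : Finset (Fin n) → ℝ) (l : ℕ) (η U : ℝ) (T : Finset (Fin n))
    (L : List (Equiv.Perm (Fin n))) :
    (L.map (stepCost f l η U T)).sum = L.length * growthRate f l η U +
      η * (1 - η * U) * (L.map fun π => ∑ i ∈ T, subgrad f π i).sum +
      L.length * (η ^ 2 * U * (2 * ∑ i ∈ T, upperVec f i)) := by
  induction L with
  | nil => simp
  | cons π L ih =>
    simp only [List.map_cons, List.sum_cons, ih, List.length_cons, stepCost, sampleVec,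
      Finset.sum_sub_distrib, ← Finset.mul_sum]
    push_cast
    ring

/-- If the accumulated step costs of every set of at most `k + 1` elements are not too negative,
then the average subgradient is a dual certificate. -/
theorem isDualCertificate_of_sum_stepCost {n : ℕ} {f : Finset (Fin n) → ℝ} (h0 : f ∅ = 0)
    (hf : IsSubmodular f) {k : ℕ} (hk : 0 < k) {φ δ η : ℝ}
    (hφ : |minValue f| ≤ φ) (hδ : 0 < δ) (hδφ : δ ≤ φ) (hη : 0 < η) (hU : 0 < Uone f φ)
    (hηU : η * Uone f φ * Uinf f k φ = δ / 32) {L : List (Equiv.Perm (Fin n))}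
    (hL : 0 < L.length) (hgood : ∀ T : Finset (Fin n), T.card ≤ k + 1 →
      -(L.length * η * (δ / 4)) < (L.map (stepCost f (k + 1) η (Uone f φ) T)).sum) :
    IsDualCertificate f δ k (avgSubgrad f L) := by
  have hm : (0 : ℝ) < L.length := by exact_mod_cast hL
  set m : ℝ := (L.length : ℝ) with hmdef
  constructor
  · rw [← sub_le_iff_le_add]
    refine le_sparseNeg k.succ_pos fun T hT => ?_
    rw [sum_avgSubgrad]
    set Y := (L.map fun π => ∑ i ∈ T, subgrad f π i).sum / m with hY
    have hYm : (L.map fun π => ∑ i ∈ T, subgrad f π i).sum = m * Y := by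
      rw [hY, mul_div_cancel₀ _ hm.ne']
    have hg := hgood T hT
    rw [sum_stepCost, hYm, growthRate] at hg
    set U := Uone f φ with hUdef
    set V := Uinf f k φ with hVdef
    set ρ := ‖upperVec f‖ with hρ
    have hρ0 : 0 ≤ ρ := norm_nonneg _
    have hk1 : (1 : ℝ) ≤ k := by exact_mod_cast hk
    set P := -minValue f with hP
    have hP0 : 0 ≤ P := by
      have := minValue_le f ∅
      rw [h0] at this
      linarith
    have hPφ : P ≤ φ := by linarith [(abs_le.1 hφ).1]
    have hu : ∑ i ∈ T, upperVec f i ≤ (k + 1) * ρ :=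
      calc ∑ i ∈ T, upperVec f i ≤ T.card • ρ :=
            Finset.sum_le_card_nsmul _ _ _ fun i _ => (Real.le_norm_self _).trans
              (norm_le_pi_norm _ i)
        _ ≤ (k + 1) * ρ := by
            rw [nsmul_eq_mul]
            exact mul_le_mul_of_nonneg_right (by exact_mod_cast hT) hρ0
    have hV : V = 2 * k * ρ + φ := rfl
    have hkρ : ρ ≤ k * ρ := by nlinarith
    have hVφ : φ ≤ V := by nlinarith
    have hsum4 : 2 * ((k + 1 : ℕ) : ℝ) * ρ + P + 2 * ∑ i ∈ T, upperVec f i ≤ 4 * V := by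
      push_cast
      linarith
    have hηU0 : 0 ≤ η * U := (mul_pos hη hU).le
    -- dividing the hypothesis by `m η`
    have hdiv : 0 < P + δ / 4 + (1 - η * U) * Y +
        η * U * (2 * ((k + 1 : ℕ) : ℝ) * ρ + P + 2 * ∑ i ∈ T, upperVec f i) := by
      have hpos : 0 < m * η := mul_pos hm hη
      refine (mul_pos_iff_of_pos_left hpos).1 ?_
      linarith
    have hdev : η * U * (2 * ((k + 1 : ℕ) : ℝ) * ρ + P + 2 * ∑ i ∈ T, upperVec f i) ≤ δ / 8 :=
      (mul_le_mul_of_nonneg_left hsum4 hηU0).trans (by linarith)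
    have hηUφ : η * U * φ ≤ δ / 32 := hηU ▸ mul_le_mul_of_nonneg_left hVφ hηU0
    by_contra! hc
    have hc' : P + δ < -Y := by linarith
    have hηU1 : η * U ≤ 1 := by
      by_contra! h1
      nlinarith
    have h1 : (1 - η * U) * (P + δ) ≤ (1 - η * U) * -Y :=
      mul_le_mul_of_nonneg_left hc'.le (by linarith)
    have h2 : η * U * (P + δ) ≤ η * U * (2 * φ) :=
      mul_le_mul_of_nonneg_left (by linarith) hηU0
    linarith
  · intro S _
    rw [sum_avgSubgrad, div_le_iff₀ hm, mul_comm]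
    exact list_sum_map_le L _ _ fun π => subgrad_sum_le h0 hf π S

theorem Uinf_pos {n : ℕ} (f : Finset (Fin n) → ℝ) (k : ℕ) {φ : ℝ} (hφ : 0 < φ) :
    φ ≤ Uinf f k φ ∧ 0 < Uinf f k φ := by
  have : 0 ≤ 2 * (k : ℝ) * ‖upperVec f‖ := by positivity
  constructor <;> simp only [Uinf] <;> linarith

theorem Uone_pos {n : ℕ} (f : Finset (Fin n) → ℝ) {φ : ℝ} (hφ : 0 < φ) :
    φ ≤ Uone f φ ∧ 0 < Uone f φ := by
  have : 0 ≤ l1norm (upperVec f) := Finset.sum_nonneg fun i _ => abs_nonneg _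
  constructor <;> simp only [Uone] <;> linarith

theorem length_of_mem_support_stochDualCertificate {n : ℕ} (A : ℕ) (f : Finset (Fin n) → ℝ) (k : ℕ)
    {φ δ : ℝ} (hη : 0 < δ / 2 / (Uinf f k φ * Uone f φ)) (N : ℕ)
    {L : List (Equiv.Perm (Fin n))} (hL : L ∈ (stochDualCertificate A f k φ δ N).support) :
    L.length = N * ftrlIters A f k φ (δ / 2) := by
  induction N generalizing L with
  | zero =>
    rw [stochDualCertificate, PMF.support_pure, Set.mem_singleton_iff] at hL
    simp [hL]
  | succ N ih =>
    rw [stochDualCertificate, PMF.mem_support_bind_iff] at hL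
    obtain ⟨L1, h1, hL⟩ := hL
    rw [PMF.mem_support_map_iff] at hL
    obtain ⟨L2, h2, rfl⟩ := hL
    rw [submodularFTRL_eq_lossRun A f k φ _ hη] at h2
    rw [List.length_append, ih h1, length_of_mem_support_lossRun h2]
    ring

/-- The exponential moment is multiplicative over independent runs. -/
theorem expect_stochDualCertificate_le {n : ℕ} (A : ℕ) (f : Finset (Fin n) → ℝ) (k : ℕ)
    {φ δ : ℝ} {c : Equiv.Perm (Fin n) → ℝ} {b : ℝ}
    (h : ((submodularFTRL A f k φ (δ / 2)).expect fun L =>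
      ENNReal.ofReal (Real.exp (-(L.map c).sum / 2))) ≤ ENNReal.ofReal (Real.exp b)) (N : ℕ) :
    ((stochDualCertificate A f k φ δ N).expect fun L =>
      ENNReal.ofReal (Real.exp (-(L.map c).sum / 2))) ≤ ENNReal.ofReal (Real.exp (N * b)) := by
  induction N with
  | zero => simp [stochDualCertificate, PMF.expect_pure]
  | succ N ih =>
    rw [stochDualCertificate, PMF.expect_bind]
    have e : ∀ L : List (Equiv.Perm (Fin n)),
        (((submodularFTRL A f k φ (δ / 2)).map fun L' => L ++ L').expect fun L =>
          ENNReal.ofReal (Real.exp (-(L.map c).sum / 2))) ≤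
        ENNReal.ofReal (Real.exp b) * ENNReal.ofReal (Real.exp (-(L.map c).sum / 2)) := by
      intro L
      rw [PMF.expect_map]
      have e' : ∀ L' : List (Equiv.Perm (Fin n)),
          ENNReal.ofReal (Real.exp (-((L ++ L').map c).sum / 2)) =
          ENNReal.ofReal (Real.exp (-(L.map c).sum / 2)) *
            ENNReal.ofReal (Real.exp (-(L'.map c).sum / 2)) := by
        intro L'
        rw [← ENNReal.ofReal_mul (Real.exp_pos _).le, ← Real.exp_add, List.map_append,
          List.sum_append]
        ring_nf
      simp only [Function.comp_def, e']
      rw [PMF.expect_const_mul, mul_comm]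
      exact mul_le_mul_left h _
    refine (PMF.expect_mono _ fun L _ => e L).trans ?_
    rw [PMF.expect_const_mul]
    refine (mul_le_mul_right ih _).trans (le_of_eq ?_)
    rw [← ENNReal.ofReal_mul (Real.exp_pos _).le, ← Real.exp_add]
    push_cast
    ring_nf

theorem toOuterMeasure_ge_of_compl_le {α : Type*} (p : PMF α) (S : Set α) {ε : ℝ}
    (h : p.toOuterMeasure Sᶜ ≤ ENNReal.ofReal ε) (hε : 0 ≤ ε) :
    ENNReal.ofReal (1 - ε) ≤ p.toOuterMeasure S := by
  have h1 : (1 : ℝ≥0∞) ≤ p.toOuterMeasure S + p.toOuterMeasure Sᶜ := by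
    have := MeasureTheory.measure_union_le (μ := p.toOuterMeasure) S Sᶜ
    rw [Set.union_compl_self] at this
    refine le_trans (le_of_eq ?_) this
    exact ((PMF.toOuterMeasure_apply_eq_one_iff p Set.univ).2 (Set.subset_univ _)).symm
  rw [ENNReal.ofReal_sub _ hε, ENNReal.ofReal_one]
  exact tsub_le_iff_right.2 (h1.trans (add_le_add_right h _))

theorem log_card_smallSets_le {n k : ℕ} (hn : 2 ≤ n) (hk : 0 < k) :
    Real.log (smallSets n (k + 1)).card ≤ 4 * k * Real.log n := by
  have hn' : (2 : ℝ) ≤ n := by exact_mod_cast hn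
  have hk' : (1 : ℝ) ≤ k := by exact_mod_cast hk
  have h1 : ((smallSets n (k + 1)).card : ℝ) ≤ ((n : ℝ) ^ 2) ^ (k + 1) := by
    calc ((smallSets n (k + 1)).card : ℝ) ≤ ((n : ℝ) + 1) ^ (k + 1) := by
          exact_mod_cast card_smallSets_le n (k + 1)
      _ ≤ ((n : ℝ) ^ 2) ^ (k + 1) := by
          gcongr
          nlinarith
  have h2 := Real.log_le_log (by exact_mod_cast smallSets_nonempty n (k + 1)) h1
  rw [← pow_mul, Real.log_pow] at h2
  have h3 : 0 ≤ Real.log n := Real.log_nonneg (by linarith)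
  refine h2.trans ?_
  push_cast
  nlinarith

theorem le_ftrlIters {n : ℕ} (A : ℕ) (f : Finset (Fin n) → ℝ) (k : ℕ) (φ δ : ℝ) :
    (A : ℝ) * k * Uinf f k φ * Uone f φ * Real.log n / δ ^ 2 ≤ ftrlIters A f k φ δ :=
  Nat.le_ceil _

/-- The high-probability guarantee, for every number `N ≥ 1` of repetitions. -/
theorem stochDualCertificate_isDualCertificate {n : ℕ} {f : Finset (Fin n) → ℝ} (hn : 2 ≤ n)
    (h0 : f ∅ = 0) (hf : IsSubmodular f) (hu : ∀ i, 0 ≤ upperVec f i) {k : ℕ} (hk : 0 < k)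
    {C φ δ : ℝ} (hC : 0 < C) (hφ : |minValue f| ≤ φ) (hδ : 0 < δ) (hδφ : δ ≤ φ) {A : ℕ}
    (hA : 32 * (12 + 2 * C) ≤ A) {N : ℕ} (hN : 0 < N) :
    ENNReal.ofReal (1 - (n : ℝ) ^ (-C)) ≤ (stochDualCertificate A f k φ δ N).toOuterMeasure
      {L | IsDualCertificate f δ k (avgSubgrad f L)} := by
  have hφ0 : 0 < φ := hδ.trans_le hδφ
  obtain ⟨hVφ, hV⟩ := Uinf_pos f k hφ0
  obtain ⟨-, hU⟩ := Uone_pos f hφ0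
  have hη' : 0 < δ / 2 / (Uinf f k φ * Uone f φ) := by positivity
  have hn' : (2 : ℝ) ≤ n := by exact_mod_cast hn
  have hk' : (1 : ℝ) ≤ k := by exact_mod_cast hk
  have hN' : (1 : ℝ) ≤ N := by exact_mod_cast hN
  have hlog : 0 < Real.log n := Real.log_pos (by linarith)
  set U := Uone f φ with hUdef
  set V := Uinf f k φ with hVdef
  -- the analysis runs exponential weights with this step size, not with that of the algorithm
  set η : ℝ := δ / (32 * (U * V)) with hη
  have hη0 : 0 < η := by positivity
  have hηUV : η * U * V = δ / 32 := by rw [hη]; field_simp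
  have hηU : η * U ≤ 1 := by
    by_contra! h
    nlinarith
  set M := ftrlIters A f k φ (δ / 2) with hM
  set ℓ := Real.log (smallSets n (k + 1)).card with hℓ
  have hℓ4 : ℓ ≤ 4 * k * Real.log n := log_card_smallSets_le hn hk
  have hℓ0 : 0 ≤ ℓ := Real.log_natCast_nonneg _
  -- the log-cardinality `ℓ` enters once per run, and once more in the union bound
  have hbudget : N * ℓ + 2 * (ℓ + C * Real.log n) ≤ (N * M : ℝ) * η * (δ / 4) := by
    have hM1 : 4 * A * k * V * U * Real.log n / δ ^ 2 ≤ M := by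
      refine le_trans (le_of_eq ?_) (le_ftrlIters A f k φ (δ / 2))
      rw [← hUdef, ← hVdef]
      field_simp
      ring
    have hM2 : A * k * Real.log n / 32 ≤ M * η * (δ / 4) := by
      refine le_trans (le_of_eq ?_) (mul_le_mul_of_nonneg_right
        (mul_le_mul_of_nonneg_right hM1 hη0.le) (by linarith : 0 ≤ δ / 4))
      rw [hη]
      field_simp
    have hkl : 0 < k * Real.log n := by positivity
    have hM3 : (12 + 2 * C) * (k * Real.log n) ≤ M * η * (δ / 4) := by
      refine le_trans ?_ hM2
      have := mul_le_mul_of_nonneg_right hA hkl.le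
      linarith
    have h1 : C * Real.log n ≤ C * (k * Real.log n) :=
      mul_le_mul_of_nonneg_left (by nlinarith) hC.le
    have h2 : ℓ + 2 * (ℓ + C * Real.log n) ≤ M * η * (δ / 4) := by linarith
    have h3 : 0 ≤ 2 * (ℓ + C * Real.log n) := by positivity
    calc N * ℓ + 2 * (ℓ + C * Real.log n) ≤ N * (ℓ + 2 * (ℓ + C * Real.log n)) := by nlinarith
      _ ≤ N * (M * η * (δ / 4)) := mul_le_mul_of_nonneg_left h2 (by linarith)
      _ = _ := by ring
  have hMpos : 0 < M := by
    refine Nat.ceil_pos.2 ?_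
    have hA0 : (0 : ℝ) < A := lt_of_lt_of_le (by linarith) hA
    positivity
  set μ := stochDualCertificate A f k φ δ N with hμ
  refine toOuterMeasure_ge_of_compl_le _ _ ?_ (by positivity)
  set bad : Finset (Fin n) → Set (List (Equiv.Perm (Fin n))) := fun T =>
    {L | N * ℓ + 2 * (ℓ + C * Real.log n) ≤ -(L.map (stepCost f (k + 1) η U T)).sum} with hbad
  have hcover : μ.toOuterMeasure {L | IsDualCertificate f δ k (avgSubgrad f L)}ᶜ ≤
      μ.toOuterMeasure (⋃ T ∈ smallSets n (k + 1), bad T) := by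
    refine PMF.toOuterMeasure_mono _ ?_
    rintro L ⟨hL, hLs⟩
    by_contra hc
    apply hL
    have hlen := length_of_mem_support_stochDualCertificate A f k hη' N hLs
    refine isDualCertificate_of_sum_stepCost h0 hf hk hφ hδ hδφ hη0 hU hηUV
      (by rw [hlen]; exact Nat.mul_pos hN hMpos) fun T hT => ?_
    have hT' : L ∉ bad T := fun h => hc (Set.mem_biUnion (mem_smallSets.2 hT) h)
    simp only [hbad, Set.mem_ofPred_eq, not_le] at hT'
    rw [hlen]
    push_cast
    linarith
  have hone : ∀ T ∈ smallSets n (k + 1), μ.toOuterMeasure (bad T) ≤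
      ENNReal.ofReal (Real.exp (-(ℓ + C * Real.log n))) := by
    intro T hT
    have h1 := expect_stochDualCertificate_le A f k (δ := δ) (φ := φ)
      (c := stepCost f (k + 1) η U T) (b := ℓ / 2)
      (by
        rw [submodularFTRL_eq_lossRun A f k φ _ hη']
        exact expect_lossRun_le h0 hf hu hη0.le
          (fun π => sum_sampleVec_le_Uone h0 hu hφ π) hηU (mem_smallSets.1 hT) M) N
    have h2 := PMF.mul_toOuterMeasure_le_expect μ
      (fun L => ENNReal.ofReal (Real.exp (-(L.map (stepCost f (k + 1) η U T)).sum / 2)))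
      (ENNReal.ofReal (Real.exp (N * (ℓ / 2) + (ℓ + C * Real.log n)))) (bad T) (fun L hL => by
        refine ENNReal.ofReal_le_ofReal (Real.exp_le_exp.2 ?_)
        simp only [hbad, Set.mem_ofPred_eq] at hL
        linarith)
    have h3 := h2.trans h1
    have h4 : ENNReal.ofReal (Real.exp (N * (ℓ / 2))) =
        ENNReal.ofReal (Real.exp (N * (ℓ / 2) + (ℓ + C * Real.log n))) *
          ENNReal.ofReal (Real.exp (-(ℓ + C * Real.log n))) := by
      rw [← ENNReal.ofReal_mul (Real.exp_pos _).le, ← Real.exp_add]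
      ring_nf
    rw [h4] at h3
    exact (ENNReal.mul_le_mul_iff_right (by simpa using Real.exp_pos _) ENNReal.ofReal_ne_top).1 h3
  refine hcover.trans ((MeasureTheory.measure_biUnion_finset_le _ _).trans
    ((Finset.sum_le_sum hone).trans (le_of_eq ?_)))
  rw [Finset.sum_const, nsmul_eq_mul, ← ENNReal.ofReal_natCast, ← ENNReal.ofReal_mul (by positivity)]
  congr 1
  have hcard : (0 : ℝ) < (smallSets n (k + 1)).card := by
    exact_mod_cast smallSets_nonempty n (k + 1)
  rw [neg_add, Real.exp_add, hℓ, Real.exp_neg, Real.exp_log hcard,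
    Real.rpow_def_of_pos (by linarith), ← mul_assoc, mul_inv_cancel₀ hcard.ne', one_mul]
  ring_nf

/-- The number of iterations is positive and at most twice the real number that it rounds up. -/
theorem ftrlIters_bounds {n : ℕ} {f : Finset (Fin n) → ℝ} (hn : 2 ≤ n) {k A : ℕ} (hk : 0 < k)
    {φ δ : ℝ} (hδ : 0 < δ) (hδφ : δ ≤ φ) (hA : 0 < A) :
    0 < ftrlIters A f k φ (δ / 2) ∧ (ftrlIters A f k φ (δ / 2) : ℝ) ≤
      32 * A * Real.log n * (k ^ 2 * (‖upperVec f‖ + φ) * (l1norm (upperVec f) + φ) / δ ^ 2) := by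
  have hφ0 : 0 < φ := hδ.trans_le hδφ
  obtain ⟨hVφ, hV⟩ := Uinf_pos f k hφ0
  obtain ⟨hUφ, hU⟩ := Uone_pos f hφ0
  have hn' : (2 : ℝ) ≤ n := by exact_mod_cast hn
  have hk' : (1 : ℝ) ≤ k := by exact_mod_cast hk
  have hA' : (1 : ℝ) ≤ A := by exact_mod_cast hA
  have hlog : 1 / 2 ≤ Real.log n := by
    have := Real.log_le_log (by norm_num) hn'
    linarith [Real.log_two_gt_d9]
  set X : ℝ := (A : ℝ) * k * Uinf f k φ * Uone f φ * Real.log n / (δ / 2) ^ 2 with hX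
  have hX1 : 1 ≤ X := by
    rw [hX, le_div_iff₀ (by positivity)]
    have h1 : δ * δ ≤ Uinf f k φ * Uone f φ :=
      mul_le_mul (hδφ.trans hVφ) (hδφ.trans hUφ) hδ.le hV.le
    have h2 : 1 ≤ (A : ℝ) * k := by nlinarith
    have h3 : δ * δ ≤ (A * k : ℝ) * (Uinf f k φ * Uone f φ) :=
      h1.trans (le_mul_of_one_le_left (by positivity) h2)
    have h4 : 0 < δ * δ := mul_pos hδ hδ
    nlinarith
  refine ⟨Nat.ceil_pos.2 (by linarith), ?_⟩
  have h2X : (ftrlIters A f k φ (δ / 2) : ℝ) ≤ 2 * X := by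
    have := (Nat.ceil_lt_add_one (by linarith : 0 ≤ X)).le
    simp only [ftrlIters, ← hX]
    linarith
  refine h2X.trans ?_
  have h1 : Uinf f k φ ≤ 2 * k * (‖upperVec f‖ + φ) := by
    simp only [Uinf]
    nlinarith
  have h2 : Uone f φ ≤ 2 * (l1norm (upperVec f) + φ) := by
    simp only [Uone]
    nlinarith
  have h3 : Uinf f k φ * Uone f φ ≤
      2 * k * (‖upperVec f‖ + φ) * (2 * (l1norm (upperVec f) + φ)) :=
    mul_le_mul h1 h2 hU.le (by positivity)
  calc 2 * X = 8 * A * k * Real.log n / δ ^ 2 * (Uinf f k φ * Uone f φ) := by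
        rw [hX]; field_simp; norm_num
    _ ≤ 8 * A * k * Real.log n / δ ^ 2 *
        (2 * k * (‖upperVec f‖ + φ) * (2 * (l1norm (upperVec f) + φ))) :=
        mul_le_mul_of_nonneg_left h3 (by positivity)
    _ = _ := by ring

/-- The bound on the number of permutations. -/
theorem total_iterations_le {n : ℕ} {f : Finset (Fin n) → ℝ} (hn : 2 ≤ n) {k A : ℕ} (hk : 0 < k)
    {φ δ : ℝ} (hδ : 0 < δ) (hδφ : δ ≤ φ) (hA : 0 < A) :
    ((⌈(k : ℝ) ^ 4 * φ ^ 2 / δ ^ 2⌉₊ * ftrlIters A f k φ (δ / 2) : ℕ) : ℝ) ≤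
      64 * A * Real.log n * ((k : ℝ) ^ 6 * φ ^ 2 * (‖upperVec f‖ + φ) *
        (l1norm (upperVec f) + φ) / δ ^ 4) := by
  have hk' : (1 : ℝ) ≤ k := by exact_mod_cast hk
  have hX1 : 1 ≤ (k : ℝ) ^ 4 * φ ^ 2 / δ ^ 2 := by
    rw [le_div_iff₀ (by positivity), one_mul]
    have h1 : δ ^ 2 ≤ φ ^ 2 := by gcongr
    exact h1.trans (le_mul_of_one_le_left (sq_nonneg _) (one_le_pow₀ hk'))
  have hN : (⌈(k : ℝ) ^ 4 * φ ^ 2 / δ ^ 2⌉₊ : ℝ) ≤ 2 * ((k : ℝ) ^ 4 * φ ^ 2 / δ ^ 2) := by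
    have := (Nat.ceil_lt_add_one (by linarith : 0 ≤ (k : ℝ) ^ 4 * φ ^ 2 / δ ^ 2)).le
    linarith
  have hM := (ftrlIters_bounds (f := f) hn hk hδ hδφ hA).2
  rw [Nat.cast_mul]
  calc _ ≤ 2 * ((k : ℝ) ^ 4 * φ ^ 2 / δ ^ 2) * (32 * A * Real.log n *
        (k ^ 2 * (‖upperVec f‖ + φ) * (l1norm (upperVec f) + φ) / δ ^ 2)) :=
        mul_le_mul hN hM (Nat.cast_nonneg _) (by positivity)
    _ = _ := by
        ring

/-! ### Sampling by descending a binary tree -/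

/-- The total weight of the positions `a, …, b - 1`. -/
noncomputable def segWeight (w : ℕ → ℝ) (a b : ℕ) : ℝ := ∑ i ∈ Finset.Ico a b, w i

theorem segWeight_nonneg {w : ℕ → ℝ} (hw : ∀ i, 0 ≤ w i) (a b : ℕ) : 0 ≤ segWeight w a b :=
  Finset.sum_nonneg fun i _ => hw i

theorem segWeight_add (w : ℕ → ℝ) {a b c : ℕ} (hac : a ≤ c) (hcb : c ≤ b) :
    segWeight w a c + segWeight w c b = segWeight w a b :=
  Finset.sum_Ico_consecutive w hac hcb

/-- One step of the descent: a segment with at least two positions is halved, and one half is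
chosen with probability proportional to its weight. -/
noncomputable def treeStep (w : ℕ → ℝ) (p : ℕ × ℕ) : PMF (ℕ × ℕ) :=
  if p.1 + 2 ≤ p.2 then
    (coin (segWeight w p.1 ((p.1 + p.2) / 2) / segWeight w p.1 p.2)).map fun x =>
      if x then (p.1, (p.1 + p.2) / 2) else ((p.1 + p.2) / 2, p.2)
  else PMF.pure p

theorem coin_mul {x W : ℝ} (hx : 0 ≤ x) (hxW : x ≤ W) :
    ENNReal.ofReal W * coin (x / W) true = ENNReal.ofReal x ∧
      ENNReal.ofReal W * coin (x / W) false = ENNReal.ofReal (W - x) := by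
  have hW : 0 ≤ W := hx.trans hxW
  rcases hW.eq_or_lt with h | h
  · have : x = 0 := le_antisymm (h ▸ hxW) hx
    simp [← h, this]
  · have hle : x / W ≤ 1 := (div_le_one h).2 hxW
    have hmin : min (ENNReal.ofReal (x / W)) 1 = ENNReal.ofReal (x / W) :=
      min_eq_left (ENNReal.ofReal_le_one.2 hle)
    constructor
    · change ENNReal.ofReal W * min (ENNReal.ofReal (x / W)) 1 = _
      rw [hmin, ← ENNReal.ofReal_mul hW, mul_div_cancel₀ _ h.ne']
    · change ENNReal.ofReal W * (1 - min (ENNReal.ofReal (x / W)) 1) = _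
      rw [hmin, ← ENNReal.ofReal_one, ← ENNReal.ofReal_sub _ (div_nonneg hx hW),
        ← ENNReal.ofReal_mul hW, mul_sub, mul_one, mul_div_cancel₀ _ h.ne']

/-- The descent ends at position `i` with probability proportional to `w i`; the multiplied form
of the identity also covers segments of weight zero. -/
theorem segWeight_mul_iter_treeStep {w : ℕ → ℝ} (hw : ∀ i, 0 ≤ w i) (T : ℕ) {a b : ℕ}
    (hab : a < b) (hT : b - a ≤ 2 ^ T) (i : ℕ) :
    ENNReal.ofReal (segWeight w a b) * ((PMF.iter (treeStep w) T (a, b)).map Prod.fst) i =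
      if i ∈ Finset.Ico a b then ENNReal.ofReal (w i) else 0 := by
  induction T generalizing a b with
  | zero =>
    have hb : b = a + 1 := by simp at hT; omega
    subst hb
    rw [PMF.iter, PMF.pure_map, PMF.pure_apply, segWeight, Nat.Ico_succ_singleton,
      Finset.sum_singleton]
    simp only [Finset.mem_singleton]
    split_ifs with h
    · rw [h, mul_one]
    · rw [mul_zero]
  | succ T ih =>
    rw [PMF.iter, treeStep]
    simp only
    split_ifs with h hi hi
    all_goals try
      rw [PMF.pure_bind, ih hab (by have := Nat.one_le_two_pow (n := T); omega)]
      simp [hi]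
    all_goals
      set c := (a + b) / 2 with hc
      have hac : a < c := by omega
      have hcb : c < b := by omega
      have hT' : 2 ^ (T + 1) = 2 * 2 ^ T := by ring
      have h1 := ih hac (by omega)
      have h2 := ih hcb (by omega)
      have hadd := segWeight_add w hac.le hcb.le
      obtain ⟨ct, cf⟩ := coin_mul (segWeight_nonneg hw a c) (W := segWeight w a b)
        (by linarith [segWeight_nonneg hw c b])
      have e : segWeight w a b - segWeight w a c = segWeight w c b := by linarith
      rw [e] at cf
      rw [PMF.map_bind, PMF.bind_map, PMF.bind_apply, tsum_fintype, Fintype.sum_bool, mul_add,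
        ← mul_assoc, ← mul_assoc, ct, cf]
      simp only [Function.comp_apply, if_true, Bool.false_eq_true, if_false]
      rw [h1, h2]
      rw [Finset.mem_Ico] at hi
      by_cases hic : i < c
      · simp only [Finset.mem_Ico]
        split_ifs <;> first | omega | simp
      · simp only [Finset.mem_Ico]
        split_ifs <;> first | omega | simp

/-- `v`-weights and `u`-weights by position in `π`. -/
noncomputable def posWeight {n : ℕ} (f : Finset (Fin n) → ℝ) (π : Equiv.Perm (Fin n)) (i : ℕ) : ℝ :=
  if h : i < n then sampleVec f π (π ⟨i, h⟩) else 0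

/-- The sum of the entries of `u_f` over the first `i` positions of `π`. -/
noncomputable def prefixUpper {n : ℕ} (f : Finset (Fin n) → ℝ) (π : Equiv.Perm (Fin n)) (i : ℕ) :
    ℝ :=
  ∑ j ∈ Finset.range i, if h : j < n then upperVec f (π ⟨j, h⟩) else 0

/-- A segment's weight needs the values of `f` at its two end points only. -/
theorem segWeight_posWeight {n : ℕ} (f : Finset (Fin n) → ℝ) (π : Equiv.Perm (Fin n)) {a b : ℕ}
    (hab : a ≤ b) (hb : b ≤ n) : segWeight (posWeight f π) a b =
      2 * (prefixUpper f π b - prefixUpper f π a) -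
        (f (prefixSet π b) - f (prefixSet π a)) := by
  induction b, hab using Nat.le_induction with
  | base => simp [segWeight]
  | succ b hab ih =>
    have hb' : b < n := hb
    rw [segWeight, Finset.sum_Ico_succ_top hab]
    have ih := ih hb'.le
    rw [segWeight] at ih
    have e1 : prefixUpper f π (b + 1) = prefixUpper f π b + upperVec f (π ⟨b, hb'⟩) := by
      rw [prefixUpper, Finset.sum_range_succ, dif_pos hb', prefixUpper]
    have e2 := subgrad_apply f π ⟨b, hb'⟩
    simp only at e2
    rw [ih, e1, posWeight, dif_pos hb', sampleVec, e2]
    ring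

theorem segWeight_posWeight_total {n : ℕ} (f : Finset (Fin n) → ℝ) (π : Equiv.Perm (Fin n)) :
    segWeight (posWeight f π) 0 n = ∑ v, sampleVec f π v := by
  rw [sum_eq_sum_positions π, segWeight, ← Finset.range_eq_Ico]
  rfl

/-- The vector that `vSampling` returns when it samples the element in position `i`. -/
noncomputable def sampledVec {n : ℕ} (f : Finset (Fin n) → ℝ) (π : Equiv.Perm (Fin n)) (i : ℕ) :
    Fin n → ℝ :=
  if h : i < n then Pi.single (π ⟨i, h⟩) (subgrad f π (π ⟨i, h⟩) /
    (sampleVec f π (π ⟨i, h⟩) / l1norm (sampleVec f π))) else 0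

/-- `vSampling` is realized by the descent in the binary tree over the positions. -/
theorem vSampling_eq_map_iter_treeStep {n : ℕ} {f : Finset (Fin n) → ℝ} (h0 : f ∅ = 0)
    (hf : IsSubmodular f) (hu : ∀ i, 0 ≤ upperVec f i) (π : Equiv.Perm (Fin n)) (hn : 0 < n)
    {T : ℕ} (hT : n ≤ 2 ^ T) : vSampling f π =
      (PMF.iter (treeStep (posWeight f π)) T (0, n)).map fun p => sampledVec f π p.1 := by
  have hv := sampleVec_nonneg h0 hf hu π
  have hw : ∀ i, 0 ≤ posWeight f π i := fun i => by
    rw [posWeight]; split_ifs; exacts [hv _, le_rfl]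
  rw [show (fun p : ℕ × ℕ => sampledVec f π p.1) = sampledVec f π ∘ Prod.fst from rfl,
    ← PMF.map_comp]
  set q := (PMF.iter (treeStep (posWeight f π)) T (0, n)).map Prod.fst with hq
  have hqi := segWeight_mul_iter_treeStep hw T hn (by simpa using hT)
  rw [← hq, segWeight_posWeight_total] at hqi
  rcases (Finset.sum_nonneg fun i (_ : i ∈ Finset.univ) => hv i).eq_or_lt with hs | hs
  · rw [vSampling_of_sum_eq_zero hv hs.symm]
    -- every sampled vector is zero, since it is divided by `v_j / 0 = 0`
    have : sampledVec f π = Function.const ℕ 0 := by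
      funext i
      rw [sampledVec, l1norm_of_nonneg hv, ← hs]
      split_ifs <;> simp
    rw [this, PMF.map_const]
  · have e : (∑' j, ENNReal.ofReal (sampleVec f π j)) = ENNReal.ofReal (∑ i, sampleVec f π i) := by
      rw [tsum_fintype, ENNReal.ofReal_sum_of_nonneg fun i _ => hv i]
    have h : (∑' j, ENNReal.ofReal (sampleVec f π j)) ≠ 0 := by
      rw [e]; simpa using hs
    rw [vSampling, dif_pos h]
    set p := PMF.normalize (fun j => ENNReal.ofReal (sampleVec f π j)) h
      (by rw [e]; exact ENNReal.ofReal_ne_top) with hp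
    have hpj : ∀ j, p j = ENNReal.ofReal (sampleVec f π j) *
        (ENNReal.ofReal (∑ i, sampleVec f π i))⁻¹ := fun j => by
      rw [hp, PMF.normalize_apply, e]
    have hS0 : ENNReal.ofReal (∑ i, sampleVec f π i) ≠ 0 := by simpa using hs
    have hqv : ∀ i, q i = (if i ∈ Finset.Ico 0 n then ENNReal.ofReal (posWeight f π i) else 0) *
        (ENNReal.ofReal (∑ i, sampleVec f π i))⁻¹ := fun i => by
      rw [← hqi i, mul_comm, ← mul_assoc, ENNReal.inv_mul_cancel hS0 ENNReal.ofReal_ne_top,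
        one_mul]
    have hqp : q = p.map fun j => (π.symm j : ℕ) := by
      ext i
      rw [hqv, PMF.map_apply, tsum_fintype]
      by_cases hi : i < n
      · rw [if_pos (by simpa using hi)]
        refine ((Finset.sum_eq_single (π ⟨i, hi⟩) ?_ ?_).trans ?_).symm
        · intro j _ hj
          rw [if_neg]
          intro h
          apply hj
          rw [← π.symm_apply_eq.1]
          exact Fin.ext h.symm
        · simp
        · simp [hpj, posWeight, hi]
      · rw [if_neg (by simpa using hi), zero_mul]
        refine (Finset.sum_eq_zero fun j _ => ?_).symm
        rw [if_neg]
        intro h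
        exact hi (h ▸ (π.symm j).2)
    rw [hqp, PMF.map_comp]
    congr 1
    funext j
    simp [sampledVec]

/-! ### Ranks -/

theorem sort_symm_lt_iff {n : ℕ} (H : Fin n → ℝ) (i j : Fin n) :
    (Tuple.sort H).symm j < (Tuple.sort H).symm i ↔ H j < H i ∨ (H j = H i ∧ j < i) := by
  set π := Tuple.sort H with hπ
  obtain ⟨hm, ht⟩ := Tuple.eq_sort_iff.1 hπ
  have key : ∀ a b : Fin n, π.symm a < π.symm b → H a < H b ∨ (H a = H b ∧ a < b) := by
    intro a b hab
    have h1 := hm hab.le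
    simp only [Function.comp_apply, Equiv.apply_symm_apply] at h1
    rcases h1.lt_or_eq with h | h
    · exact Or.inl h
    · have := ht _ _ hab (by simpa using h)
      simp only [Equiv.apply_symm_apply] at this
      exact Or.inr ⟨h, this⟩
  refine ⟨key j i, fun h => ?_⟩
  by_contra! hc
  rcases hc.lt_or_eq with hlt | heq
  · rcases key i j hlt with h' | h' <;> rcases h with h | h
    · exact lt_asymm h h'
    · exact h'.ne h.1.symm
    · exact h.ne h'.1.symm
    · exact lt_asymm h.2 h'.2
  · have : i = j := π.symm.injective heq
    subst this
    rcases h with h | h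
    · exact lt_irrefl _ h
    · exact lt_irrefl _ h.2

/-- The position of an element in the sorted order is the number of elements before it. -/
theorem card_before_eq_sort_symm {n : ℕ} (H : Fin n → ℝ) (h : ℕ → ℝ)
    (hH : ∀ j : Fin n, h j = H j) (i : Fin n) :
    ((Finset.range n).filter fun j => ¬(h i ≤ h j ∧ ¬(h j ≤ h i ∧ ¬(i : ℕ) ≤ j))).card =
      ((Tuple.sort H).symm i : ℕ) := by
  set π := Tuple.sort H with hπ
  have e : ((Finset.range n).filter fun j => ¬(h i ≤ h j ∧ ¬(h j ≤ h i ∧ ¬(i : ℕ) ≤ j))) =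
      (Finset.Iio (π.symm i)).map (π.toEmbedding.trans Fin.valEmbedding) := by
    ext j
    simp only [Finset.mem_filter, Finset.mem_range, Finset.mem_map, Finset.mem_Iio,
      Function.Embedding.trans_apply, Equiv.coe_toEmbedding, Fin.valEmbedding_apply]
    constructor
    · rintro ⟨hj, hc⟩
      refine ⟨π.symm ⟨j, hj⟩, ?_, by simp⟩
      rw [hπ, sort_symm_lt_iff]
      have e1 := hH i
      have e2 := hH ⟨j, hj⟩
      simp only at e2
      rw [e1, e2] at hc
      by_contra hcon
      apply hc
      rw [not_or, not_lt, not_and, not_lt] at hcon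
      refine ⟨hcon.1, fun hh => hh.2 ?_⟩
      exact hcon.2 (le_antisymm hh.1 hcon.1)
    · rintro ⟨a, ha, rfl⟩
      refine ⟨(π a).2, ?_⟩
      have := (sort_symm_lt_iff H i (π a)).1 (by simpa [hπ] using ha)
      rw [hH, hH]
      rintro ⟨h1, h2⟩
      rcases this with h3 | ⟨h3, h4⟩
      · exact absurd h1 (not_le.2 h3)
      · exact h2 ⟨h3.le, not_le.2 h4⟩
  rw [e, Finset.card_map, Fin.card_Iio]

/-! ### Couplings and deterministic execution -/

/-- `P` and `Q` have a coupling supported on the relation `R`. -/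
def Coupled {α β : Type*} (P : PMF α) (Q : PMF β) (R : α → β → Prop) : Prop :=
  ∃ J : PMF (α × β), J.map Prod.fst = P ∧ J.map Prod.snd = Q ∧ ∀ x ∈ J.support, R x.1 x.2

theorem PMF.bind_congr_support {α β : Type*} (p : PMF α) {q r : α → PMF β}
    (h : ∀ a ∈ p.support, q a = r a) : p.bind q = p.bind r := by
  ext y
  rw [PMF.bind_apply, PMF.bind_apply]
  refine tsum_congr fun a => ?_
  by_cases ha : p a = 0
  · rw [ha, zero_mul, zero_mul]
  · rw [h a ((PMF.mem_support_iff _ _).2 ha)]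

theorem Coupled.pure {α β : Type*} {R : α → β → Prop} {a : α} {b : β} (h : R a b) :
    Coupled (PMF.pure a) (PMF.pure b) R := by
  refine ⟨PMF.pure (a, b), PMF.pure_map _ _, PMF.pure_map _ _, fun x hx => ?_⟩
  rw [PMF.support_pure, Set.mem_singleton_iff] at hx
  rw [hx]
  exact h

theorem Coupled.mono {α β : Type*} {P : PMF α} {Q : PMF β} {R R' : α → β → Prop}
    (h : Coupled P Q R) (hR : ∀ a b, R a b → R' a b) : Coupled P Q R' := by
  obtain ⟨J, h1, h2, h3⟩ := h
  exact ⟨J, h1, h2, fun x hx => hR _ _ (h3 x hx)⟩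

theorem Coupled.bind {α β γ ε : Type*} {P : PMF α} {Q : PMF β} {R : α → β → Prop}
    {F : α → PMF γ} {G : β → PMF ε} {R' : γ → ε → Prop} (h : Coupled P Q R)
    (hFG : ∀ a b, R a b → Coupled (F a) (G b) R') : Coupled (P.bind F) (Q.bind G) R' := by
  classical
  obtain ⟨J, rfl, rfl, h3⟩ := h
  set K : α × β → PMF (γ × ε) := fun x =>
    if hx : R x.1 x.2 then Classical.choose (hFG x.1 x.2 hx)
    else (F x.1).bind fun c => (G x.2).map fun e => (c, e) with hK
  have spec : ∀ x ∈ J.support, (K x).map Prod.fst = F x.1 ∧ (K x).map Prod.snd = G x.2 ∧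
      ∀ y ∈ (K x).support, R' y.1 y.2 := by
    intro x hx
    simp only [hK, dif_pos (h3 x hx)]
    exact Classical.choose_spec (hFG x.1 x.2 (h3 x hx))
  refine ⟨J.bind K, ?_, ?_, fun y hy => ?_⟩
  · rw [PMF.map_bind, PMF.bind_map]
    exact PMF.bind_congr_support J fun x hx => (spec x hx).1
  · rw [PMF.map_bind, PMF.bind_map]
    exact PMF.bind_congr_support J fun x hx => (spec x hx).2.1
  · rw [PMF.mem_support_bind_iff] at hy
    obtain ⟨x, hx, hy⟩ := hy
    exact (spec x hx).2.2 y hy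

theorem Coupled.refl_map {α β : Type*} (p : PMF α) (g : α → β) :
    Coupled (p.map g) p fun b a => b = g a := by
  refine ⟨p.map fun a => (g a, a), ?_, ?_, fun x hx => ?_⟩
  · rw [PMF.map_comp]; rfl
  · rw [PMF.map_comp]; exact PMF.map_id p
  · rw [PMF.mem_support_map_iff] at hx
    obtain ⟨a, _, rfl⟩ := hx
    rfl

theorem Coupled.map_right {α β γ : Type*} {P : PMF α} {Q : PMF β} {g : β → γ} {R : α → γ → Prop}
    (h : Coupled P Q fun a b => R a (g b)) : Coupled P (Q.map g) R := by
  have := Coupled.bind (F := PMF.pure) (G := fun b => PMF.pure (g b)) (R' := R) h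
    fun a b hab => Coupled.pure hab
  rw [PMF.bind_pure] at this
  exact this

theorem Coupled.repeatRun {α : Type*} {F : Mem → PMF Mem} {G : α → PMF α} {T : ℕ}
    {R : ℕ → Mem → α → Prop}
    (hstep : ∀ t < T, ∀ m a, R t m a → Coupled (F m) (G a) (R (t + 1))) {m : Mem} {a : α}
    (h : R 0 m a) : Coupled (repeatRun F T m) (PMF.iter G T a) (R T) := by
  have key : ∀ s t, s + t = T → ∀ m a, R s m a →
      Coupled (_root_.repeatRun F t m) (PMF.iter G t a) (R T) := by
    intro s t
    induction t generalizing s with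
    | zero =>
      rintro rfl m a h
      exact Coupled.pure h
    | succ t ih =>
      intro hst m a h
      exact (hstep s (by omega) m a h).bind fun m' a' h' => ih (s + 1) (by omega) m' a' h'
  exact key 0 T (by omega) m a h

/-- The command is deterministic on the memory `m` and leads to a memory that satisfies `Q`. -/
def Det {n : ℕ} (f : Finset (Fin n) → ℝ) (c : Cmd) (m : Mem) (Q : Mem → Prop) : Prop :=
  ∃ m', c.exec f m = PMF.pure m' ∧ Q m'

section Det

variable {n : ℕ} {f : Finset (Fin n) → ℝ} {m : Mem} {Q : Mem → Prop}

theorem Det.mono {c : Cmd} {Q' : Mem → Prop} (h : Det f c m Q) (hQ : ∀ m, Q m → Q' m) :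
    Det f c m Q' := by
  obtain ⟨m', h1, h2⟩ := h
  exact ⟨m', h1, hQ _ h2⟩

theorem Det.skip (h : Q m) : Det f .skip m Q := ⟨_, rfl, h⟩

theorem Det.nset {a : ℕ} {i e : NExp}
    (h : Q ((m.setNat a (i.eval m) (e.eval m)).charge (i.cost + e.cost + 1))) :
    Det f (.nset a i e) m Q := ⟨_, rfl, h⟩

theorem Det.rset {a : ℕ} {i : NExp} {e : RExp}
    (h : Q ((m.setReal a (i.eval m) (e.eval m)).charge (i.cost + e.cost + 1))) :
    Det f (.rset a i e) m Q := ⟨_, rfl, h⟩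

theorem Det.emit {e : NExp}
    (h : Q ({ m with out := m.out ++ [e.eval m] }.charge (e.cost + 1))) :
    Det f (.emit e) m Q := ⟨_, rfl, h⟩

theorem Det.seq {c₁ c₂ : Cmd} (h : Det f c₁ m fun m' => Det f c₂ m' Q) :
    Det f (.seq c₁ c₂) m Q := by
  obtain ⟨m1, h1, m2, h2, hQ⟩ := h
  exact ⟨m2, by rw [Cmd.exec, h1, PMF.pure_bind, h2], hQ⟩

theorem Det.ite {b : BExp} {c₁ c₂ : Cmd}
    (h1 : b.holds m → Det f c₁ (m.charge (b.cost + 1)) Q)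
    (h2 : ¬ b.holds m → Det f c₂ (m.charge (b.cost + 1)) Q) : Det f (.ite b c₁ c₂) m Q := by
  by_cases h : b.holds m
  · obtain ⟨m', e, hQ⟩ := h1 h
    exact ⟨m', by rw [Cmd.exec, if_pos h, e], hQ⟩
  · obtain ⟨m', e, hQ⟩ := h2 h
    exact ⟨m', by rw [Cmd.exec, if_neg h, e], hQ⟩

theorem Det.loop {e : RExp} {c : Cmd} {T : ℕ} (I : ℕ → Mem → Prop) (hT : ⌈e.eval m⌉₊ = T)
    (h0 : I 0 (m.charge (e.cost + 1)))
    (hstep : ∀ t < T, ∀ m, I t m → Det f c (m.charge 1) (I (t + 1)))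
    (hQ : ∀ m, I T m → Q m) : Det f (.loop e c) m Q := by
  have key : ∀ s t, s + t = T → ∀ m, I s m →
      ∃ m', repeatRun (fun m' => c.exec f (m'.charge 1)) t m = PMF.pure m' ∧ I T m' := by
    intro s t
    induction t generalizing s with
    | zero =>
      rintro rfl m h
      exact ⟨m, rfl, h⟩
    | succ t ih =>
      intro hst m h
      obtain ⟨m1, e1, h1⟩ := hstep s (by omega) m h
      obtain ⟨m2, e2, h2⟩ := ih (s + 1) (by omega) m1 h1
      exact ⟨m2, by rw [repeatRun, e1, PMF.pure_bind, e2], h2⟩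
  obtain ⟨m', e', h'⟩ := key 0 T (by omega) _ h0
  exact ⟨m', by rw [Cmd.exec, hT, e'], hQ _ h'⟩

theorem Det.coupled {α : Type*} {c : Cmd} {R : Mem → α → Prop} {a : α}
    (h : Det f c m fun m' => R m' a) : Coupled (c.exec f m) (PMF.pure a) R := by
  obtain ⟨m', e, hR⟩ := h
  rw [e]
  exact Coupled.pure hR

/-- A deterministic command before a random one. -/
theorem Det.seq_coupled {α : Type*} {c₁ c₂ : Cmd} {q : PMF α} {R : Mem → α → Prop}
    (h : Det f c₁ m fun m' => Coupled (c₂.exec f m') q R) :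
    Coupled ((Cmd.seq c₁ c₂).exec f m) q R := by
  obtain ⟨m', e, hR⟩ := h
  rw [Cmd.exec, e, PMF.pure_bind]
  exact hR

/-- A deterministic command after a random one. -/
theorem Coupled.seq_det {α : Type*} {c₁ c₂ : Cmd} {q : PMF α} {R R' : Mem → α → Prop}
    (h : Coupled (c₁.exec f m) q R) (h2 : ∀ m a, R m a → Det f c₂ m fun m' => R' m' a) :
    Coupled ((Cmd.seq c₁ c₂).exec f m) q R' := by
  have := Coupled.bind (F := c₂.exec f) (G := PMF.pure) (R' := R') h
    fun a b hab => (h2 a b hab).coupled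
  rwa [PMF.bind_pure] at this

end Det

/-! ### Memory updates -/

section Mem

variable (m : Mem) (a i v c : ℕ) (x : ℝ)

@[simp] theorem Mem.charge_nat : (m.charge c).nat = m.nat := rfl
@[simp] theorem Mem.charge_real : (m.charge c).real = m.real := rfl
@[simp] theorem Mem.charge_out : (m.charge c).out = m.out := rfl
@[simp] theorem Mem.charge_queries : (m.charge c).queries = m.queries := rfl
@[simp] theorem Mem.charge_steps : (m.charge c).steps = m.steps + c := rfl
@[simp] theorem Mem.setNat_real : (m.setNat a i v).real = m.real := rfl
@[simp] theorem Mem.setNat_out : (m.setNat a i v).out = m.out := rfl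
@[simp] theorem Mem.setNat_queries : (m.setNat a i v).queries = m.queries := rfl
@[simp] theorem Mem.setNat_steps : (m.setNat a i v).steps = m.steps := rfl
@[simp] theorem Mem.setReal_nat : (m.setReal a i x).nat = m.nat := rfl
@[simp] theorem Mem.setReal_out : (m.setReal a i x).out = m.out := rfl
@[simp] theorem Mem.setReal_queries : (m.setReal a i x).queries = m.queries := rfl
@[simp] theorem Mem.setReal_steps : (m.setReal a i x).steps = m.steps := rfl

@[simp] theorem Mem.setNat_nat (b : ℕ) : (m.setNat a i v).nat b =
    if b = a then Function.update (m.nat a) i v else m.nat b := by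
  simp only [Mem.setNat, Function.update_apply]

@[simp] theorem Mem.setReal_real (b : ℕ) : (m.setReal a i x).real b =
    if b = a then Function.update (m.real a) i x else m.real b := by
  simp only [Mem.setReal, Function.update_apply]

end Mem

/-- `m'` agrees with `m` on the listed arrays of natural numbers and of real numbers. -/
def SameArrays (A B : List ℕ) (m m' : Mem) : Prop :=
  (∀ a ∈ A, m'.nat a = m.nat a) ∧ ∀ b ∈ B, m'.real b = m.real b

/-! ### The program -/

/-! Array `0` of natural numbers and arrays `0` and `1` of real numbers hold the input.  Array `1` of
natural numbers holds the scalars `0, 1` (loop counters), `2` (a rank), `3, 4` (the ends of the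
current segment), `5` (its midpoint) and `6` (a coin); arrays `2`, `3`, `4` hold ranks, the
permutation and a query set.  Array `2` of real numbers holds `‖u_f‖₁` and `‖u_f‖_∞`; array `3` the
values of `f` at the prefixes that end at the ends of the segment and at its midpoint, and `f(V)`;
array `4` the accumulated loss; array `5` the prefix sums of `u_f` along the permutation. -/

/-- A scalar of natural number type. -/
def NExp.scalar (j : ℕ) : NExp := .get 1 (.lit j)

/-- A value of `f` that the sampler keeps. -/
def RExp.scalar (j : ℕ) : RExp := .get 3 (.lit j)

/-- `for (scalar j = 0; scalar j < n; scalar j ++) c`. -/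
def Cmd.forN (j : ℕ) (c : Cmd) : Cmd :=
  .seq (.nset 1 (.lit j) (.lit 0))
    (.loop (.cast (.get 0 (.lit 0)))
      (.seq c (.nset 1 (.lit j) (.add (.scalar j) (.lit 1)))))

/-- Compute `‖u_f‖₁` and `‖u_f‖_∞`. -/
def normsCmd : Cmd :=
  .forN 0 (.seq (.rset 2 (.lit 0) (.add (.get 2 (.lit 0)) (.get 1 (.scalar 0))))
    (.ite (.rle (.get 1 (.scalar 0)) (.get 2 (.lit 1))) .skip
      (.rset 2 (.lit 1) (.get 1 (.scalar 0)))))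

/-- Reset the accumulated loss. -/
def clearCmd : Cmd := .forN 0 (.rset 4 (.scalar 0) (.lit 0))

/-- The test that element `j` comes before element `i` in the sorted order. -/
def beforeTest : BExp :=
  .not (.and (.rle (.get 4 (.scalar 0)) (.get 4 (.scalar 1)))
    (.not (.and (.rle (.get 4 (.scalar 1)) (.get 4 (.scalar 0)))
      (.not (.nle (.scalar 0) (.scalar 1))))))

/-- Sort the elements by accumulated loss. -/
def sortCmd : Cmd :=
  .forN 0 (.seq (.nset 1 (.lit 2) (.lit 0))
    (.seq (.forN 1 (.ite beforeTest (.nset 1 (.lit 2) (.add (.scalar 2) (.lit 1))) .skip))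
      (.seq (.nset 2 (.scalar 0) (.scalar 2)) (.nset 3 (.scalar 2) (.scalar 0)))))

/-- Output the permutation and compute the prefix sums of `u_f` along it. -/
def emitCmd : Cmd :=
  .seq (.rset 5 (.lit 0) (.lit 0))
    (.forN 0 (.seq (.emit (.get 3 (.scalar 0)))
      (.rset 5 (.add (.scalar 0) (.lit 1))
        (.add (.get 5 (.scalar 0)) (.get 1 (.get 3 (.scalar 0)))))))

/-- Query `f` at the prefix of length `scalar 5`. -/
def queryCmd : Cmd :=
  .seq (.forN 0 (.nset 4 (.scalar 0) (.sub (.scalar 5) (.get 2 (.scalar 0)))))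
    (.query 3 (.lit 2) 4)

/-- Start the descent at the segment of all positions. -/
def rootCmd : Cmd :=
  .seq (.nset 1 (.lit 5) (.get 0 (.lit 0)))
    (.seq queryCmd
      (.seq (.nset 1 (.lit 3) (.lit 0))
        (.seq (.nset 1 (.lit 4) (.get 0 (.lit 0)))
          (.seq (.rset 3 (.lit 0) (.lit 0))
            (.seq (.rset 3 (.lit 1) (.scalar 2)) (.rset 3 (.lit 3) (.scalar 2)))))))

/-- The weight of the positions from scalar `a` to scalar `b`, given the values of `f` at the
prefixes that end there. -/
def weightExp (a b : NExp) (fa fb : RExp) : RExp :=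
  .sub (.mul (.lit 2) (.sub (.get 5 b) (.get 5 a))) (.sub fb fa)

/-- One step of the descent. -/
def descendCmd : Cmd :=
  .ite (.nle (.add (.scalar 3) (.lit 2)) (.scalar 4))
    (.seq (.nset 1 (.lit 5) (.half (.add (.scalar 3) (.scalar 4))))
      (.seq queryCmd
        (.seq (.flip 1 (.lit 6)
            (.div (weightExp (.scalar 3) (.scalar 5) (.scalar 0) (.scalar 2))
              (weightExp (.scalar 3) (.scalar 4) (.scalar 0) (.scalar 1))))
          (.ite (.nle (.lit 1) (.scalar 6))
            (.seq (.nset 1 (.lit 4) (.scalar 5)) (.rset 3 (.lit 1) (.scalar 2)))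
            (.seq (.nset 1 (.lit 3) (.scalar 5)) (.rset 3 (.lit 0) (.scalar 2)))))))
    .skip

/-- Add the sampled vector to the accumulated loss. -/
def updateCmd : Cmd :=
  .rset 4 (.get 3 (.scalar 3))
    (.add (.get 4 (.get 3 (.scalar 3)))
      (.div (.sub (.scalar 1) (.scalar 0))
        (.div (weightExp (.scalar 3) (.scalar 4) (.scalar 0) (.scalar 1))
          (weightExp (.lit 0) (.get 0 (.lit 0)) (.lit 0) (.scalar 3)))))

/-- One iteration of `SubmodularFTRL`; `2 log n` halvings reduce `n` positions to one. -/
def iterationCmd : Cmd :=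
  .seq sortCmd (.seq emitCmd (.seq rootCmd
    (.seq (.loop (.mul (.lit 2) (.log (.cast (.get 0 (.lit 0))))) descendCmd) updateCmd)))

/-- The number of iterations, before rounding. -/
def itersExp (A : ℕ) : RExp :=
  .div
    (.mul (.mul (.mul (.mul (.lit A) (.cast (.get 0 (.lit 1))))
      (.add (.mul (.mul (.lit 2) (.cast (.get 0 (.lit 1)))) (.get 2 (.lit 1))) (.get 0 (.lit 0))))
      (.add (.mul (.lit 2) (.get 2 (.lit 0))) (.get 0 (.lit 0))))
      (.log (.cast (.get 0 (.lit 0)))))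
    (.mul (.div (.get 0 (.lit 1)) (.lit 2)) (.div (.get 0 (.lit 1)) (.lit 2)))

/-- The program for `StochDualCertificate`. -/
def certificateCmd (A : ℕ) : Cmd :=
  .seq normsCmd
    (.loop (.cast (.get 0 (.lit 2))) (.seq clearCmd (.loop (itersExp A) iterationCmd)))

/-! ### Correctness of the deterministic parts -/

section Fragments

variable {n : ℕ} {f : Finset (Fin n) → ℝ}

theorem Det.forN {m : Mem} {Q : Mem → Prop} {j : ℕ} {c : Cmd} (I : ℕ → Mem → Prop)
    (hn : m.nat 0 0 = n) (h0 : I 0 (((m.setNat 1 j 0).charge 3).charge 4))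
    (hstep : ∀ t < n, ∀ m, m.nat 1 j = t → I t m →
      Det f c (m.charge 1) fun m' => m'.nat 1 j = t ∧ I (t + 1) ((m'.setNat 1 j (t + 1)).charge 6))
    (hQ : ∀ m, I n m → Q m) : Det f (.forN j c) m Q := by
  refine Det.seq (Det.nset ?_)
  refine Det.loop (T := n) (fun t m => m.nat 1 j = t ∧ I t m) ?_ ⟨?_, h0⟩ ?_ fun m h => hQ m h.2
  · simp [RExp.eval, NExp.eval, hn]
  · simp [NExp.eval]
  · rintro t ht m ⟨h1, h2⟩
    refine Det.seq ((hstep t ht m h1 h2).mono fun m' h => Det.nset ?_)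
    have e : (NExp.add (.scalar j) (.lit 1)).eval m' = t + 1 := by
      simp [NExp.eval, NExp.scalar, h.1]
    rw [e]
    exact ⟨by simp [NExp.eval], h.2⟩

theorem clearCmd_spec {m : Mem} (hn : m.nat 0 0 = n) :
    Det f clearCmd m fun m' => SameArrays [0] [0, 1, 2] m m' ∧ (∀ i < n, m'.real 4 i = 0) ∧
      m'.out = m.out ∧ m'.queries = m.queries ∧ m'.steps ≤ m.steps + (20 * n + 20) := by
  refine Det.forN (fun t m' => SameArrays [0] [0, 1, 2] m m' ∧ (∀ i < t, m'.real 4 i = 0) ∧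
      m'.out = m.out ∧ m'.queries = m.queries ∧ m'.steps ≤ m.steps + (20 * t + 20)) hn ?_ ?_ ?_
  · simp [SameArrays]
  · rintro t ht m1 hc ⟨⟨hA, hB⟩, h0, ho, hq, hs⟩
    refine Det.rset ?_
    simp [SameArrays, NExp.eval, NExp.scalar, RExp.eval, NExp.cost, RExp.cost,
      Function.update_apply, hc, ho, hq] at hA hB ⊢
    refine ⟨⟨hA, hB⟩, fun i hi => ?_, by omega⟩
    by_cases h : i = t
    · simp [h]
    · simp [h, h0 i (by omega)]
  · exact fun m h => h

theorem queryCmd_spec {π : Equiv.Perm (Fin n)} {m : Mem} (hn : m.nat 0 0 = n)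
    (hr : ∀ v : Fin n, m.nat 2 v = π.symm v) :
    Det f queryCmd m fun m' => SameArrays [0, 2, 3] [0, 1, 2, 4, 5] m m' ∧
      (∀ j, j ≠ 0 → m'.nat 1 j = m.nat 1 j) ∧ (∀ j, j ≠ 2 → m'.real 3 j = m.real 3 j) ∧
      m'.real 3 2 = f (prefixSet π (m.nat 1 5)) ∧ m'.out = m.out ∧
      m'.queries = m.queries + 1 ∧ m'.steps ≤ m.steps + (30 * n + 20) := by
  refine Det.seq ?_
  refine Det.forN (fun t m' => SameArrays [0, 2, 3] [0, 1, 2, 3, 4, 5] m m' ∧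
      (∀ j, j ≠ 0 → m'.nat 1 j = m.nat 1 j) ∧
      (∀ v < t, m'.nat 4 v = m.nat 1 5 - m.nat 2 v) ∧ m'.out = m.out ∧
      m'.queries = m.queries ∧ m'.steps ≤ m.steps + (30 * t + 10)) hn ?_ ?_ ?_
  · simp [SameArrays]
    exact fun j hj => by simp [hj]
  · rintro t ht m1 hc ⟨⟨hA, hB⟩, h1, h4, ho, hq, hs⟩
    refine Det.nset ?_
    simp [SameArrays, NExp.eval, NExp.scalar, NExp.cost, Function.update_apply, hc, ho, hq]
      at hA hB ⊢
    refine ⟨⟨hA, hB⟩, fun j hj => by simp [hj, h1 j hj], fun v hv => ?_, by omega⟩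
    by_cases h : v = t
    · simp [h, h1 5, hA]
    · simp [h, h4 v (by omega)]
  · rintro m1 ⟨⟨hA, hB⟩, h1, h4, ho, hq, hs⟩
    refine ⟨_, rfl, ?_⟩
    -- truncated subtraction: `r - rank v` is nonzero exactly for the first `r` elements
    have hset : (Finset.univ.filter fun v : Fin n => m1.nat 4 (v : ℕ) ≠ 0) =
        prefixSet π (m.nat 1 5) := by
      ext v
      have h := h4 v v.2
      rw [hr] at h
      simp only [prefixSet, Finset.mem_filter, Finset.mem_univ, true_and, h]
      omega
    rw [hset]
    simp [SameArrays, NExp.eval, NExp.cost, Function.update_apply, ho, hq] at hA hB ⊢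
    simp [hA, hB]
    refine ⟨h1, fun j hj => by simp [hj], by omega⟩

theorem sortCmd_spec {H : Fin n → ℝ} {m : Mem} (hn : m.nat 0 0 = n)
    (hH : ∀ i : Fin n, m.real 4 i = H i) :
    Det f sortCmd m fun m' => SameArrays [0] [0, 1, 2, 4] m m' ∧
      (∀ v : Fin n, m'.nat 2 v = (Tuple.sort H).symm v) ∧
      (∀ i : Fin n, m'.nat 3 i = Tuple.sort H i) ∧ m'.out = m.out ∧
      m'.queries = m.queries ∧ m'.steps ≤ m.steps + (n * (60 * n + 60) + 20) := by
  set π := Tuple.sort H with hπ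
  refine Det.forN (fun t m' => SameArrays [0] [0, 1, 2, 4] m m' ∧
      (∀ v : Fin n, (v : ℕ) < t → m'.nat 2 v = π.symm v) ∧
      (∀ i : Fin n, (π i : ℕ) < t → m'.nat 3 i = π i) ∧ m'.out = m.out ∧
      m'.queries = m.queries ∧ m'.steps ≤ m.steps + (t * (60 * n + 60) + 20)) hn ?_ ?_ ?_
  · simp [SameArrays]
  · rintro t ht m1 hc ⟨⟨hA, hB⟩, h2, h3, ho, hq, hs⟩
    refine Det.seq (Det.nset (Det.seq ?_))
    simp only [List.forall_mem_cons, List.not_mem_nil, false_imp_iff, implies_true, and_true]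
      at hA hB
    set cnt : ℕ → ℕ := fun s => ((Finset.range s).filter fun j =>
      ¬(m.real 4 t ≤ m.real 4 j ∧ ¬(m.real 4 j ≤ m.real 4 t ∧ ¬t ≤ j))).card with hcnt
    refine Det.forN (n := n) (fun s m' => SameArrays [0, 2, 3] [0, 1, 2, 4] m1 m' ∧
      m'.nat 1 0 = t ∧ m'.nat 1 2 = cnt s ∧ m'.out = m.out ∧
      m'.queries = m.queries ∧ m'.steps ≤ m1.steps + (60 * s + 20)) ?_ ?_ ?_ ?_
    · simp [hA, hn]
    · simp [SameArrays, NExp.eval, NExp.cost, hc, ho, hq, hcnt]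
    · rintro s hs' m2 hc2 ⟨⟨hA2, hB2⟩, h10, h12, ho2, hq2, hs2⟩
      simp only [List.forall_mem_cons, List.not_mem_nil, false_imp_iff, implies_true, and_true]
        at hA2 hB2
      have hR : m2.real 4 = m.real 4 := by rw [hB2.2.2.2, hB.2.2.2]
      have htest : beforeTest.holds (m2.charge 1) ↔
          ¬(m.real 4 t ≤ m.real 4 s ∧ ¬(m.real 4 s ≤ m.real 4 t ∧ ¬t ≤ s)) := by
        simp only [beforeTest, BExp.holds, RExp.eval, NExp.eval, NExp.scalar, Mem.charge_nat,
          Mem.charge_real, hR, h10, hc2]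
      have hcs : cnt (s + 1) = cnt s + if ¬(m.real 4 t ≤ m.real 4 s ∧
          ¬(m.real 4 s ≤ m.real 4 t ∧ ¬t ≤ s)) then 1 else 0 := by
        simp only [hcnt, Finset.range_add_one, Finset.filter_insert]
        by_cases h : ¬(m.real 4 t ≤ m.real 4 s ∧ ¬(m.real 4 s ≤ m.real 4 t ∧ ¬t ≤ s))
        · rw [if_pos h, if_pos h, Finset.card_insert_of_notMem (by simp)]
        · rw [if_neg h, if_neg h, add_zero]
      refine Det.ite (fun hb => Det.nset ?_) fun hb => Det.skip ?_
      · rw [htest] at hb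
        rw [if_pos hb] at hcs
        simp [SameArrays, NExp.eval, NExp.scalar, NExp.cost, BExp.cost, RExp.cost, beforeTest,
          h10, h12, hc2, ho2, hq2, hA2, hB2, hcs]
        omega
      · rw [htest] at hb
        rw [if_neg hb] at hcs
        simp [SameArrays, NExp.scalar, NExp.cost, BExp.cost, RExp.cost, beforeTest, h10, h12, hc2, ho2, hq2, hA2, hB2, hcs]
        omega
    · rintro m2 ⟨⟨hA2, hB2⟩, h10, h12, ho2, hq2, hs2⟩
      simp only [List.forall_mem_cons, List.not_mem_nil, false_imp_iff, implies_true, and_true]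
        at hA2 hB2
      have hrank : cnt n = π.symm ⟨t, ht⟩ :=
        card_before_eq_sort_symm H (m.real 4) hH ⟨t, ht⟩
      rw [hrank] at h12
      refine Det.seq (Det.nset (Det.nset ?_))
      have hmul : (t + 1) * (60 * n + 60) = t * (60 * n + 60) + (60 * n + 60) := by ring
      simp [SameArrays, NExp.eval, NExp.scalar, NExp.cost,
          Function.update_apply, h10, h12, ho2, hq2, hA2, hB2, hA, hB]
      refine ⟨fun v hv => ?_, fun i hi => ?_, by omega⟩
      · by_cases h : (v : ℕ) = t
        · have : v = ⟨t, ht⟩ := Fin.ext h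
          simp [this]
        · simp [h, h2 v (by omega)]
      · by_cases h : (π i : ℕ) = t
        · have e : π i = ⟨t, ht⟩ := Fin.ext h
          simp [← e, h]
        · have e : (i : ℕ) ≠ π.symm ⟨t, ht⟩ := by
            intro e
            apply h
            rw [Fin.ext e]
            simp
          simp [e, h3 i (by omega)]
  · rintro m1 ⟨hAB, h2, h3, ho, hq, hs⟩
    exact ⟨hAB, fun v => h2 v v.2, fun i => h3 i (π i).2, ho, hq, hs⟩

theorem emitCmd_spec {π : Equiv.Perm (Fin n)} {m : Mem} (hn : m.nat 0 0 = n)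
    (hu : ∀ i : Fin n, m.real 1 i = upperVec f i) (hp : ∀ i : Fin n, m.nat 3 i = π i) :
    Det f emitCmd m fun m' => SameArrays [0, 2, 3] [0, 1, 2, 4] m m' ∧
      (∀ i ≤ n, m'.real 5 i = prefixUpper f π i) ∧
      m'.out = m.out ++ List.ofFn (fun i => (π i : ℕ)) ∧
      m'.queries = m.queries ∧ m'.steps ≤ m.steps + (40 * n + 20) := by
  refine Det.seq (Det.rset ?_)
  refine Det.forN (fun t m' => SameArrays [0, 2, 3] [0, 1, 2, 4] m m' ∧
      (∀ i ≤ t, m'.real 5 i = prefixUpper f π i) ∧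
      m'.out = m.out ++ (List.ofFn fun i => (π i : ℕ)).take t ∧
      m'.queries = m.queries ∧ m'.steps ≤ m.steps + (40 * t + 20)) ?_ ?_ ?_ ?_
  · simpa using hn
  · simp [SameArrays, NExp.eval, RExp.eval, NExp.cost, RExp.cost, prefixUpper]
  · rintro t ht m1 hc ⟨⟨hA, hB⟩, h5, ho, hq, hs⟩
    refine Det.seq (Det.emit (Det.rset ?_))
    simp only [List.forall_mem_cons, List.not_mem_nil, false_imp_iff, implies_true, and_true]
      at hA hB
    have hp' : m.nat 3 t = π ⟨t, ht⟩ := hp ⟨t, ht⟩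
    have hsum : prefixUpper f π (t + 1) = prefixUpper f π t + upperVec f (π ⟨t, ht⟩) := by
      rw [prefixUpper, Finset.sum_range_succ, dif_pos ht, prefixUpper]
    have htake : (List.ofFn fun i => (π i : ℕ)).take (t + 1) =
        (List.ofFn fun i => (π i : ℕ)).take t ++ [(π ⟨t, ht⟩ : ℕ)] := by
      rw [List.take_add_one, List.getElem?_ofFn, dif_pos ht]
      rfl
    simp [SameArrays, NExp.eval, NExp.scalar, RExp.eval, NExp.cost, RExp.cost,
      Function.update_apply, hc, ho, hq, hA, hB, hp', htake, hu]
    refine ⟨fun i hi => ?_, by omega⟩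
    by_cases h : i = t + 1
    · simp [h, hsum, h5 t le_rfl]
    · simp [h, h5 i (by omega)]
  · rintro m1 ⟨hAB, h5, ho, hq, hs⟩
    refine ⟨hAB, h5, ?_, hq, hs⟩
    rw [ho, List.take_of_length_le (by simp)]

theorem rootCmd_spec {π : Equiv.Perm (Fin n)} {m : Mem} (hn : m.nat 0 0 = n)
    (hr : ∀ v : Fin n, m.nat 2 v = π.symm v) :
    Det f rootCmd m fun m' => SameArrays [0, 2, 3] [0, 1, 2, 4, 5] m m' ∧
      m'.nat 1 3 = 0 ∧ m'.nat 1 4 = n ∧ m'.real 3 0 = 0 ∧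
      m'.real 3 1 = f (prefixSet π n) ∧ m'.real 3 3 = f (prefixSet π n) ∧ m'.out = m.out ∧
      m'.queries = m.queries + 1 ∧ m'.steps ≤ m.steps + (30 * n + 60) := by
  refine Det.seq (Det.nset (Det.seq ?_))
  refine (queryCmd_spec (π := π) (by simpa using hn) (by simpa using hr)).mono ?_
  rintro m1 ⟨⟨hA, hB⟩, h1, h3, h32, ho, hq, hs⟩
  refine Det.seq (Det.nset (Det.seq (Det.nset (Det.seq (Det.rset (Det.seq (Det.rset
    (Det.rset ?_))))))))
  simp [SameArrays, NExp.eval, NExp.cost, RExp.eval, RExp.cost, RExp.scalar]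
    at hA hB h32 ho hq hs ⊢
  simp [hA, hB, h32, ho, hq, hn]
  omega

end Fragments

/-! ### The program simulates the algorithm -/

section Iteration

variable {n : ℕ} {f : Finset (Fin n) → ℝ}

theorem normsCmd_spec (hu : ∀ i, 0 ≤ upperVec f i) {m : Mem} (hn : m.nat 0 0 = n)
    (hm : ∀ i : Fin n, m.real 1 i = upperVec f i) (h0 : m.real 2 0 = 0) (h1 : m.real 2 1 = 0) :
    Det f normsCmd m fun m' => SameArrays [0] [0, 1] m m' ∧
      m'.real 2 0 = l1norm (upperVec f) ∧ m'.real 2 1 = ‖upperVec f‖ ∧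
      m'.out = m.out ∧ m'.queries = m.queries ∧ m'.steps ≤ m.steps + (40 * n + 20) := by
  refine Det.forN (fun t m' => SameArrays [0] [0, 1] m m' ∧
      m'.real 2 0 = (∑ i ∈ Finset.range t, if h : i < n then upperVec f ⟨i, h⟩ else 0) ∧
      (∀ i : Fin n, (i : ℕ) < t → upperVec f i ≤ m'.real 2 1) ∧ 0 ≤ m'.real 2 1 ∧
      m'.real 2 1 ≤ ‖upperVec f‖ ∧ m'.out = m.out ∧ m'.queries = m.queries ∧
      m'.steps ≤ m.steps + (40 * t + 20)) hn ?_ ?_ ?_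
  · simp [SameArrays, h0, h1]
  · rintro t ht m1 hc ⟨⟨hA, hB⟩, hs1, hle, hnn, hnorm, ho, hq, hs⟩
    refine Det.seq (Det.rset ?_)
    simp only [List.forall_mem_cons, List.not_mem_nil, false_imp_iff, implies_true, and_true]
      at hA hB
    have hut : m.real 1 t = upperVec f ⟨t, ht⟩ := hm ⟨t, ht⟩
    have hnt : upperVec f ⟨t, ht⟩ ≤ ‖upperVec f‖ :=
      (Real.le_norm_self _).trans (norm_le_pi_norm (upperVec f) ⟨t, ht⟩)
    have hsum : (∑ i ∈ Finset.range (t + 1), if h : i < n then upperVec f ⟨i, h⟩ else 0) =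
        m1.real 2 0 + upperVec f ⟨t, ht⟩ := by
      rw [Finset.sum_range_succ, dif_pos ht, hs1]
    refine Det.ite (fun hb => Det.skip ?_) fun hb => Det.rset ?_
    · simp [BExp.holds, RExp.eval, NExp.eval, NExp.scalar, hc, hB, hut] at hb
      simp [SameArrays, NExp.eval, NExp.scalar, RExp.eval, NExp.cost, RExp.cost, BExp.cost,
        hc, ho, hq, hA, hB, hut, hsum, hnn, hnorm]
      refine ⟨fun i hi => ?_, by omega⟩
      rcases Nat.lt_succ_iff_lt_or_eq.1 (Nat.lt_succ_of_le hi) with h | h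
      · exact hle i h
      · have : i = ⟨t, ht⟩ := Fin.ext h
        rw [this]
        exact hb
    · simp [BExp.holds, RExp.eval, NExp.eval, NExp.scalar, hc, hB, hut] at hb
      simp [SameArrays, NExp.eval, NExp.scalar, RExp.eval, NExp.cost, RExp.cost, BExp.cost,
        hc, ho, hq, hA, hB, hut, hsum, hu, hnt]
      refine ⟨fun i hi => ?_, by omega⟩
      rcases Nat.lt_succ_iff_lt_or_eq.1 (Nat.lt_succ_of_le hi) with h | h
      · exact (hle i h).trans hb.le
      · have : i = ⟨t, ht⟩ := Fin.ext h
        rw [this]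
  · rintro m1 ⟨hAB, hs1, hle, hnn, hnorm, ho, hq, hs⟩
    refine ⟨hAB, ?_, le_antisymm hnorm ?_, ho, hq, hs⟩
    · rw [hs1, l1norm_of_nonneg hu, Finset.sum_range]
      exact Finset.sum_congr rfl fun i _ => by simp
    · refine (pi_norm_le_iff_of_nonneg hnn).2 fun i => ?_
      rw [Real.norm_eq_abs, abs_of_nonneg (hu i)]
      exact hle i i.2

/-- What the descent may rely on in the memory at its start. -/
structure SamplerReady (f : Finset (Fin n) → ℝ) (π : Equiv.Perm (Fin n)) (m : Mem) : Prop where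
  size : m.nat 0 0 = n
  rank : ∀ v : Fin n, m.nat 2 v = π.symm v
  perm : ∀ i : Fin n, m.nat 3 i = π i
  upper : ∀ i ≤ n, m.real 5 i = prefixUpper f π i

/-- The state of the descent after `t` steps: the current segment `(a, b)` with the values of `f`
at its ends.  Its length minus one is at least halved in every step. -/
def DescentState (f : Finset (Fin n) → ℝ) (π : Equiv.Perm (Fin n)) (m₀ : Mem) (t : ℕ) (m : Mem)
    (p : ℕ × ℕ) : Prop :=
  SameArrays [0, 2, 3] [0, 1, 2, 4, 5] m₀ m ∧ m.real 3 3 = m₀.real 3 3 ∧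
    (m.nat 1 3 = p.1 ∧ m.nat 1 4 = p.2 ∧ p.1 < p.2 ∧ p.2 ≤ n ∧
      (p.2 - p.1 - 1) * 2 ^ t ≤ n - 1) ∧
    (m.real 3 0 = f (prefixSet π p.1) ∧ m.real 3 1 = f (prefixSet π p.2)) ∧
    m.out = m₀.out ∧ m.queries ≤ m₀.queries + t ∧ m.steps ≤ m₀.steps + t * (30 * n + 100)

/-- A step of the descent loop simulates `treeStep`; the coin's bias is computed from the values of
`f` at the two ends and at the midpoint. -/
theorem descendCmd_coupled {π : Equiv.Perm (Fin n)} {m₀ : Mem} (h₀ : SamplerReady f π m₀) {t : ℕ}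
    {m : Mem} {p : ℕ × ℕ} (h : DescentState f π m₀ t m p) :
    Coupled (descendCmd.exec f (m.charge 1)) (treeStep (posWeight f π) p)
      (DescentState f π m₀ (t + 1)) := by
  obtain ⟨a, b⟩ := p
  obtain ⟨⟨hA, hB⟩, h33, ⟨ha, hb, hab, hbn, hlen⟩, ⟨hfa, hfb⟩, ho, hq, hs⟩ := h
  simp only at ha hb hab hbn hlen hfa hfb
  simp only [List.forall_mem_cons, List.not_mem_nil, false_imp_iff, implies_true, and_true]
    at hA hB
  have hmul : (t + 1) * (30 * n + 100) = t * (30 * n + 100) + (30 * n + 100) := by ring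
  have htest : (BExp.nle (.add (.scalar 3) (.lit 2)) (.scalar 4)).holds (m.charge 1) ↔
      a + 2 ≤ b := by
    simp [BExp.holds, NExp.eval, NExp.scalar, ha, hb]
  rw [treeStep, descendCmd, Cmd.exec]
  simp only
  by_cases hlong : a + 2 ≤ b
  swap
  · rw [if_neg (fun h => hlong (htest.1 h)), if_neg hlong]
    refine Coupled.pure ?_
    have hz : b - a - 1 = 0 := by omega
    refine ⟨⟨?_, ?_⟩, ?_⟩
    · simp [hA]
    · simp [hB]
    · simp [BExp.cost, NExp.cost, NExp.scalar, h33, ha, hb, hab, hbn, hz, hfa, hfb, ho]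
      omega
  rw [if_pos (htest.2 hlong), if_pos hlong]
  set c := (a + b) / 2 with hc
  have hac : a < c := by omega
  have hcb : c < b := by omega
  have hlen1 : (c - a - 1) * 2 ^ (t + 1) ≤ n - 1 := by
    refine le_trans ?_ hlen
    rw [pow_succ, mul_comm (2 ^ t), ← mul_assoc]
    exact Nat.mul_le_mul_right _ (by omega)
  have hlen2 : (b - c - 1) * 2 ^ (t + 1) ≤ n - 1 := by
    refine le_trans ?_ hlen
    rw [pow_succ, mul_comm (2 ^ t), ← mul_assoc]
    exact Nat.mul_le_mul_right _ (by omega)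
  refine Det.seq_coupled (Det.nset (Det.seq_coupled ?_))
  refine (queryCmd_spec (π := π) (by simp [hA, h₀.size]) (by simpa [hA] using h₀.rank)).mono ?_
  rintro m2 ⟨⟨hA2, hB2⟩, h1, h3, h32, ho2, hq2, hs2⟩
  simp only [List.forall_mem_cons, List.not_mem_nil, false_imp_iff, implies_true, and_true]
    at hA2 hB2
  simp [NExp.eval, NExp.scalar, NExp.cost, BExp.cost, ha, hb, ← hc] at hA2 hB2 h1 h3 h32 ho2 hq2 hs2
  have hc2 : m2.nat 1 5 = c := by simpa using h1 5 (by norm_num)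
  have ha2 : m2.nat 1 3 = a := by simpa [ha] using h1 3 (by norm_num)
  have hb2 : m2.nat 1 4 = b := by simpa [hb] using h1 4 (by norm_num)
  have hfa2 : m2.real 3 0 = f (prefixSet π a) := by rw [h3 0 (by norm_num), hfa]
  have hfb2 : m2.real 3 1 = f (prefixSet π b) := by rw [h3 1 (by norm_num), hfb]
  have h332 : m2.real 3 3 = m₀.real 3 3 := by rw [h3 3 (by norm_num), h33]
  have hup : ∀ i ≤ n, m2.real 5 i = prefixUpper f π i := fun i hi => by
    rw [hB2.2.2.2.2, hB.2.2.2.2, h₀.upper i hi]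
  have hbias : (RExp.div (weightExp (.scalar 3) (.scalar 5) (.scalar 0) (.scalar 2))
      (weightExp (.scalar 3) (.scalar 4) (.scalar 0) (.scalar 1))).eval m2 =
      segWeight (posWeight f π) a c / segWeight (posWeight f π) a b := by
    rw [segWeight_posWeight f π hac.le (hcb.le.trans hbn), segWeight_posWeight f π hab.le hbn]
    simp [weightExp, RExp.eval, NExp.eval, NExp.scalar, RExp.scalar, hc2, ha2, hb2, hfa2, hfb2,
      h32, hup a (by omega), hup b hbn, hup c (by omega)]
  rw [Cmd.exec, Cmd.exec, hbias]
  refine Coupled.bind (Coupled.refl_map _ _) ?_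
  rintro m3 x rfl
  refine Det.coupled (Det.ite (fun hx => ?_) fun hx => ?_)
  · have hx' : x = true := by
      by_contra hcon
      simp [BExp.holds, NExp.eval, NExp.scalar, hcon] at hx
    refine Det.seq (Det.nset (Det.rset ?_))
    simp [DescentState, SameArrays, NExp.eval, NExp.scalar, NExp.cost, RExp.eval, RExp.cost,
      RExp.scalar, BExp.cost, weightExp, hx', hA, hB, hA2, hB2, hc2, ha2, hfa2, h32, h332, ho2, ho,
      hac, hcb.le.trans hbn, hlen1]
    omega
  · have hx' : x = false := by
      by_contra hcon
      simp [BExp.holds, NExp.eval, NExp.scalar, hcon] at hx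
    refine Det.seq (Det.nset (Det.rset ?_))
    simp [DescentState, SameArrays, NExp.eval, NExp.scalar, NExp.cost, RExp.eval, RExp.cost,
      RExp.scalar, BExp.cost, weightExp, hx', hA, hB, hA2, hB2, hc2, hb2, hfb2, h32, h332, ho2, ho,
      hcb, hbn, hlen2]
    omega

/-- The number of steps of the descent. -/
noncomputable def descentSteps (n : ℕ) : ℕ := ⌈2 * Real.log n⌉₊

theorem le_two_pow_descentSteps {n : ℕ} (hn : 2 ≤ n) : n ≤ 2 ^ descentSteps n := by
  have hn' : (2 : ℝ) ≤ n := by exact_mod_cast hn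
  have hlog : 0 ≤ Real.log n := Real.log_nonneg (by linarith)
  have h1 : (2 * Real.log n : ℝ) ≤ descentSteps n := Nat.le_ceil _
  have h2 : Real.log n ≤ descentSteps n * Real.log 2 := by
    nlinarith [Real.log_two_gt_d9]
  rw [← Real.log_pow] at h2
  have h3 := (Real.log_le_log_iff (by linarith) (by positivity)).1 h2
  exact_mod_cast h3

theorem descentSteps_le {n : ℕ} (hn : 2 ≤ n) :
    descentSteps n ≤ 2 * n ∧ (descentSteps n : ℝ) + 1 ≤ 6 * Real.log n := by
  have hn' : (2 : ℝ) ≤ n := by exact_mod_cast hn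
  have hlog2 : Real.log 2 ≤ Real.log n := Real.log_le_log (by norm_num) hn'
  have hlog : 1 / 2 ≤ Real.log n := by linarith [Real.log_two_gt_d9]
  have h1 := (Nat.ceil_lt_add_one (by linarith : 0 ≤ 2 * Real.log n)).le
  have h2 := Real.log_le_sub_one_of_pos (by linarith : (0 : ℝ) < n)
  constructor
  · have : (descentSteps n : ℝ) ≤ ((2 * n : ℕ) : ℝ) := by
      push_cast
      exact h1.trans (by linarith)
    exact_mod_cast this
  · have : (descentSteps n : ℝ) ≤ 2 * Real.log n + 1 := h1
    linarith

/-- A single position left: the update adds the vector sampled there. -/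
theorem updateCmd_spec (h0 : f ∅ = 0) (hf : IsSubmodular f) (hu : ∀ i, 0 ≤ upperVec f i)
    {π : Equiv.Perm (Fin n)} {m₀ m : Mem} (h₀ : SamplerReady f π m₀)
    (hV : m₀.real 3 3 = f (prefixSet π n)) {H : Fin n → ℝ} (hH : ∀ i : Fin n, m₀.real 4 i = H i)
    {t a b : ℕ} (h : DescentState f π m₀ t m (a, b)) (hb : b = a + 1) :
    Det f updateCmd m fun m' => SameArrays [0] [0, 1, 2] m₀ m' ∧
      (∀ i : Fin n, m'.real 4 i = (H + sampledVec f π a) i) ∧ m'.out = m₀.out ∧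
      m'.queries ≤ m₀.queries + t ∧ m'.steps ≤ m₀.steps + (t * (30 * n + 100) + 100) := by
  subst hb
  obtain ⟨⟨hA, hB⟩, h33, ⟨ha, hb, -, hbn, -⟩, ⟨hfa, hfb⟩, ho, hq, hs⟩ := h
  simp only [List.forall_mem_cons, List.not_mem_nil, false_imp_iff, implies_true, and_true]
    at hA hB
  simp only at ha hb hbn hfa hfb
  have han : a < n := hbn
  have hperm : m.nat 3 a = π ⟨a, han⟩ := by rw [hA.2.2]; exact h₀.perm ⟨a, han⟩
  have hup : ∀ i ≤ n, m.real 5 i = prefixUpper f π i := fun i hi => by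
    rw [hB.2.2.2.2, h₀.upper i hi]
  have hw : (weightExp (.scalar 3) (.scalar 4) (.scalar 0) (.scalar 1)).eval m =
      sampleVec f π (π ⟨a, han⟩) := by
    have h1 := segWeight_posWeight f π (Nat.le_succ a) hbn
    rw [segWeight, Nat.succ_eq_add_one, Nat.Ico_succ_singleton, Finset.sum_singleton, posWeight,
      dif_pos han] at h1
    rw [h1]
    simp [weightExp, RExp.eval, NExp.eval, NExp.scalar, RExp.scalar, ha, hb, hfa, hfb,
      hup a (by omega), hup (a + 1) hbn]
  have hW : (weightExp (.lit 0) (.get 0 (.lit 0)) (.lit 0) (.scalar 3)).eval m =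
      l1norm (sampleVec f π) := by
    rw [l1norm_of_nonneg (sampleVec_nonneg h0 hf hu π), ← segWeight_posWeight_total,
      segWeight_posWeight f π n.zero_le le_rfl]
    simp [weightExp, RExp.eval, NExp.eval, RExp.scalar, hA, h₀.size, h33, hV,
      hup 0 (by omega), hup n le_rfl, prefixSet_zero, h0]
  have hg : (RExp.sub (.scalar 1) (.scalar 0)).eval m = subgrad f π (π ⟨a, han⟩) := by
    rw [subgrad_apply]
    simp [RExp.eval, RExp.scalar, NExp.eval, hfa, hfb]
  refine Det.rset ?_
  have hval : (RExp.add (.get 4 (.get 3 (.scalar 3)))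
      (.div (.sub (.scalar 1) (.scalar 0))
        (.div (weightExp (.scalar 3) (.scalar 4) (.scalar 0) (.scalar 1))
          (weightExp (.lit 0) (.get 0 (.lit 0)) (.lit 0) (.scalar 3))))).eval m =
      H (π ⟨a, han⟩) + subgrad f π (π ⟨a, han⟩) /
        (sampleVec f π (π ⟨a, han⟩) / l1norm (sampleVec f π)) := by
    change _ + (RExp.sub (.scalar 1) (.scalar 0)).eval m /
      ((weightExp (.scalar 3) (.scalar 4) (.scalar 0) (.scalar 1)).eval m /
        (weightExp (.lit 0) (.get 0 (.lit 0)) (.lit 0) (.scalar 3)).eval m) = _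
    rw [hw, hW, hg]
    simp [RExp.eval, NExp.eval, NExp.scalar, ha, hperm, hB, hH]
  rw [hval]
  simp [SameArrays, NExp.eval, NExp.scalar, NExp.cost, RExp.cost, RExp.scalar, weightExp, ha,
    hperm, hA, hB, ho]
  refine ⟨fun i => ?_, by omega⟩
  rw [sampledVec, dif_pos han]
  by_cases hi : i = π ⟨a, han⟩
  · subst hi
    simp
  · have : (i : ℕ) ≠ π ⟨a, han⟩ := fun h => hi (Fin.ext h)
    rw [Function.update_of_ne this, Pi.single_eq_of_ne hi, hH, add_zero]

/-- One iteration of the program simulates one iteration of the algorithm. -/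
theorem iterationCmd_coupled (hn2 : 2 ≤ n) (h0 : f ∅ = 0) (hf : IsSubmodular f)
    (hu : ∀ i, 0 ≤ upperVec f i) {m : Mem} (hn : m.nat 0 0 = n)
    (hm : ∀ i : Fin n, m.real 1 i = upperVec f i) {H : Fin n → ℝ}
    (hH : ∀ i : Fin n, m.real 4 i = H i) (L : List (Equiv.Perm (Fin n))) :
    Coupled (iterationCmd.exec f m) (lossStep f (H, L)) fun m' s =>
      SameArrays [0] [0, 1, 2] m m' ∧ (∀ i : Fin n, m'.real 4 i = s.1 i) ∧
      s.2 = L ++ [Tuple.sort H] ∧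
      m'.out = m.out ++ List.ofFn (fun i => (Tuple.sort H i : ℕ)) ∧
      m'.queries ≤ m.queries + (descentSteps n + 1) ∧ m'.steps ≤ m.steps + 1000 * n ^ 2 := by
  set π := Tuple.sort H with hπ
  refine Det.seq_coupled ((sortCmd_spec hn hH).mono ?_)
  rintro m1 ⟨⟨hA1, hB1⟩, hr1, hp1, ho1, hq1, hs1⟩
  simp only [List.forall_mem_cons, List.not_mem_nil, false_imp_iff, implies_true, and_true]
    at hA1 hB1
  refine Det.seq_coupled ((emitCmd_spec (f := f) (π := π) (by rw [hA1, hn])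
    (by rw [hB1.2.1]; exact hm) hp1).mono ?_)
  rintro m2 ⟨⟨hA2, hB2⟩, h52, ho2, hq2, hs2⟩
  simp only [List.forall_mem_cons, List.not_mem_nil, false_imp_iff, implies_true, and_true]
    at hA2 hB2
  refine Det.seq_coupled ((rootCmd_spec (f := f) (π := π) (by rw [hA2.1, hA1, hn])
    (by rw [hA2.2.1]; exact hr1)).mono ?_)
  rintro m3 ⟨⟨hA3, hB3⟩, ha3, hb3, hfa3, hfb3, hV3, ho3, hq3, hs3⟩
  simp only [List.forall_mem_cons, List.not_mem_nil, false_imp_iff, implies_true, and_true]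
    at hA3 hB3
  have hready : SamplerReady f π (m3.charge 7) :=
    { size := by simp [hA3, hA2, hA1, hn]
      rank := fun v => by simp [hA3, hA2, hr1, hπ]
      perm := fun i => by simp [hA3, hA2, hp1, hπ]
      upper := fun i hi => by simp [hB3, h52 i hi] }
  rw [lossStep, ← hπ,
    vSampling_eq_map_iter_treeStep h0 hf hu π (by omega) (le_two_pow_descentSteps hn2),
    PMF.map_comp]
  have hloop : Coupled ((Cmd.loop (.mul (.lit 2) (.log (.cast (.get 0 (.lit 0))))) descendCmd).exec
      f m3) (PMF.iter (treeStep (posWeight f π)) (descentSteps n) (0, n))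
      (DescentState f π (m3.charge 7) (descentSteps n)) := by
    have hT : ⌈(RExp.mul (.lit 2) (.log (.cast (.get 0 (.lit 0))))).eval m3⌉₊ =
        descentSteps n := by
      simp [RExp.eval, NExp.eval, hA3, hA2, hA1, hn, descentSteps]
    rw [Cmd.exec, hT]
    refine Coupled.repeatRun (fun t _ m p h => descendCmd_coupled hready h) ?_
    refine ⟨⟨fun _ _ => rfl, fun _ _ => rfl⟩, rfl, ⟨ha3, hb3, by simp only; omega, le_rfl, ?_⟩,
      ⟨?_, hfb3⟩, rfl, le_rfl, ?_⟩
    · simp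
    · simp [hfa3, prefixSet_zero, h0]
    · simp [RExp.cost, NExp.cost]
  refine Coupled.seq_det (R := fun m p => DescentState f π (m3.charge 7) (descentSteps n) m p) ?_ ?_
    |>.map_right
  · exact hloop
  · rintro m4 ⟨a, b⟩ h4
    have hb : b = a + 1 := by
      obtain ⟨-, -, ⟨-, -, hab, hbn, hlen⟩, -⟩ := h4
      simp only at hab hbn hlen
      have hpow := le_two_pow_descentSteps hn2
      by_contra hcon
      have h1 : 1 ≤ b - a - 1 := by omega
      have h2 := Nat.mul_le_mul_right (2 ^ descentSteps n) h1
      omega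
    refine (updateCmd_spec h0 hf hu hready (by simpa using hV3) (H := H)
      (fun i => by simp [hB3, hB2, hB1, hH]) h4 hb).mono ?_
    rintro m5 ⟨⟨hA5, hB5⟩, h45, ho5, hq5, hs5⟩
    simp only [List.forall_mem_cons, List.not_mem_nil, false_imp_iff, implies_true, and_true]
      at hA5 hB5
    simp only [Mem.charge_out, Mem.charge_queries, Mem.charge_steps] at ho5 hq5 hs5
    refine ⟨?_, h45, rfl, ?_, by omega, ?_⟩
    · simp [SameArrays, hA5, hB5, hA3, hB3, hA2, hB2, hA1, hB1]
    · rw [ho5, ho3, ho2, ho1]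
    · have hT := (descentSteps_le hn2).1
      have h6 : descentSteps n * (30 * n + 100) ≤ 2 * n * (30 * n + 100) :=
        Nat.mul_le_mul_right _ hT
      nlinarith

end Iteration

section Total

variable {n : ℕ} {f : Finset (Fin n) → ℝ}

theorem encodePerms_append (L L' : List (Equiv.Perm (Fin n))) :
    encodePerms (L ++ L') = encodePerms L ++ encodePerms L' := by
  simp [encodePerms]

/-- The arrays that stay fixed after the norms have been computed. -/
structure InputReady (f : Finset (Fin n) → ℝ) (k N : ℕ) (φ δ : ℝ) (m : Mem) : Prop where
  size : m.nat 0 0 = n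
  sparsity : m.nat 0 1 = k
  runs : m.nat 0 2 = N
  phi : m.real 0 0 = φ
  delta : m.real 0 1 = δ
  upper : ∀ i : Fin n, m.real 1 i = upperVec f i
  l1 : m.real 2 0 = l1norm (upperVec f)
  linf : m.real 2 1 = ‖upperVec f‖

theorem InputReady.of_sameArrays {k N : ℕ} {φ δ : ℝ} {m m' : Mem}
    (h : InputReady f k N φ δ m) (hs : SameArrays [0] [0, 1, 2] m m') :
    InputReady f k N φ δ m' := by
  obtain ⟨hA, hB⟩ := hs
  simp only [List.forall_mem_cons, List.not_mem_nil, false_imp_iff, implies_true, and_true]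
    at hA hB
  constructor
  · rw [hA, h.size]
  · rw [hA, h.sparsity]
  · rw [hA, h.runs]
  · rw [hB.1, h.phi]
  · rw [hB.1, h.delta]
  · rw [hB.2.1]; exact h.upper
  · rw [hB.2.2, h.l1]
  · rw [hB.2.2, h.linf]

theorem InputReady.charge {k N : ℕ} {φ δ : ℝ} {m : Mem} (h : InputReady f k N φ δ m) (c : ℕ) :
    InputReady f k N φ δ (m.charge c) :=
  h.of_sameArrays ⟨fun _ _ => rfl, fun _ _ => rfl⟩

theorem ceil_itersExp (A : ℕ) {k N : ℕ} {φ δ : ℝ} {m : Mem} (h : InputReady f k N φ δ m) :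
    ⌈(itersExp A).eval m⌉₊ = ftrlIters A f k φ (δ / 2) := by
  rw [ftrlIters, Uinf, Uone]
  congr 1
  simp [itersExp, RExp.eval, NExp.eval, h.size, h.sparsity, h.phi, h.delta, h.l1, h.linf]
  ring

/-- One run of the program simulates one run of `SubmodularFTRL`. -/
theorem run_coupled (hn2 : 2 ≤ n) (h0 : f ∅ = 0) (hf : IsSubmodular f)
    (hu : ∀ i, 0 ≤ upperVec f i) (A : ℕ) {k N : ℕ} {φ δ : ℝ} {m : Mem}
    (h : InputReady f k N φ δ m) :
    Coupled ((Cmd.seq clearCmd (.loop (itersExp A) iterationCmd)).exec f m)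
      (lossRun f (ftrlIters A f k φ (δ / 2))) fun m' L =>
      InputReady f k N φ δ m' ∧ m'.out = m.out ++ encodePerms L ∧
      m'.queries ≤ m.queries + ftrlIters A f k φ (δ / 2) * (descentSteps n + 1) ∧
      m'.steps ≤ m.steps +
        (ftrlIters A f k φ (δ / 2) * (1000 * n ^ 2 + 1) + (20 * n + 100)) := by
  set M := ftrlIters A f k φ (δ / 2) with hM
  refine Det.seq_coupled ((clearCmd_spec h.size).mono ?_)
  rintro m1 ⟨hs1, h41, ho1, hq1, ht1⟩
  have h1 := h.of_sameArrays hs1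
  rw [Cmd.exec, ceil_itersExp A h1, ← hM, lossRun]
  refine Coupled.map_right ((Coupled.repeatRun (R := fun t m' s =>
    InputReady f k N φ δ m' ∧ (∀ i : Fin n, m'.real 4 i = s.1 i) ∧
    m'.out = m.out ++ encodePerms s.2 ∧ m'.queries ≤ m.queries + t * (descentSteps n + 1) ∧
    m'.steps ≤ m.steps + (t * (1000 * n ^ 2 + 1) + (20 * n + 100))) ?_ ?_).mono ?_)
  · rintro t ht m2 ⟨H, L⟩ ⟨h2, h42, ho2, hq2, ht2⟩
    have h2' := h2.charge 1
    refine (iterationCmd_coupled hn2 h0 hf hu h2'.size h2'.upper (H := H) h42 L).mono ?_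
    rintro m3 ⟨H', L'⟩ ⟨hs3, h43, hL3, ho3, hq3, ht3⟩
    simp only at hL3 h43 ho2 ho3 ⊢
    subst hL3
    refine ⟨h2'.of_sameArrays hs3, h43, ?_, ?_, ?_⟩
    · rw [ho3, Mem.charge_out, ho2, encodePerms_append, List.append_assoc]
      simp [encodePerms]
    · rw [Mem.charge_queries] at hq3
      rw [Nat.succ_mul]
      omega
    · rw [Mem.charge_steps] at ht3
      rw [Nat.succ_mul]
      omega
  · refine ⟨h1.charge _, fun i => h41 i i.2, ?_, ?_, ?_⟩
    · simp [encodePerms, ho1]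
    · simp [hq1]
    · simp [itersExp, RExp.cost, NExp.cost]
      omega
  · rintro m2 ⟨H, L⟩ ⟨h2, -, ho2, hq2, ht2⟩
    exact ⟨h2, ho2, hq2, ht2⟩

theorem stochDualCertificate_eq_iter (A : ℕ) (f : Finset (Fin n) → ℝ) (k : ℕ) (φ δ : ℝ)
    (N : ℕ) : stochDualCertificate A f k φ δ N =
      PMF.iter (fun L => (submodularFTRL A f k φ (δ / 2)).map fun L' => L ++ L') N [] := by
  induction N with
  | zero => rfl
  | succ N ih => rw [stochDualCertificate, PMF.iter_succ', ih]

/-- The program simulates the algorithm, with bounds on the number of queries and steps. -/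
theorem certificateCmd_coupled (hn2 : 2 ≤ n) (h0 : f ∅ = 0) (hf : IsSubmodular f)
    (hu : ∀ i, 0 ≤ upperVec f i) (A k N : ℕ) {φ δ : ℝ}
    (hη : 0 < δ / 2 / (Uinf f k φ * Uone f φ)) :
    Coupled ((certificateCmd A).exec f (inputMem f k N φ δ)) (stochDualCertificate A f k φ δ N)
      fun m L => m.out = encodePerms L ∧
        m.queries ≤ N * (ftrlIters A f k φ (δ / 2) * (descentSteps n + 1)) ∧
        m.steps ≤ N * (ftrlIters A f k φ (δ / 2) * (1000 * n ^ 2 + 1) + (20 * n + 101)) +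
          (40 * n + 30) := by
  set M := ftrlIters A f k φ (δ / 2) with hM
  have hin : ∀ i : Fin n, (inputMem f k N φ δ).real 1 i = upperVec f i := fun i => by
    simp [inputMem]
  refine Det.seq_coupled ((normsCmd_spec hu (m := inputMem f k N φ δ) (by simp [inputMem]) hin
    (by simp [inputMem]) (by simp [inputMem])).mono ?_)
  rintro m1 ⟨⟨hA, hB⟩, hl1, hlinf, ho1, hq1, ht1⟩
  simp only [List.forall_mem_cons, List.not_mem_nil, false_imp_iff, implies_true, and_true]
    at hA hB
  have h1 : InputReady f k N φ δ m1 :=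
    { size := by rw [hA]; simp [inputMem]
      sparsity := by rw [hA]; simp [inputMem]
      runs := by rw [hA]; simp [inputMem]
      phi := by rw [hB.1]; simp [inputMem]
      delta := by rw [hB.1]; simp [inputMem]
      upper := by rw [hB.2]; exact hin
      l1 := hl1
      linf := hlinf }
  have hT : ⌈(RExp.cast (.get 0 (.lit 2))).eval m1⌉₊ = N := by
    simp [RExp.eval, NExp.eval, h1.runs]
  have ho0 : (inputMem f k N φ δ).out = [] := rfl
  have hq0 : (inputMem f k N φ δ).queries = 0 := rfl
  have ht0 : (inputMem f k N φ δ).steps = 0 := rfl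
  rw [Cmd.exec, hT, stochDualCertificate_eq_iter]
  refine (Coupled.repeatRun (R := fun t m L => InputReady f k N φ δ m ∧ m.out = encodePerms L ∧
    m.queries ≤ t * (M * (descentSteps n + 1)) ∧
    m.steps ≤ t * (M * (1000 * n ^ 2 + 1) + (20 * n + 101)) + (40 * n + 30)) ?_ ?_).mono
    fun m L h => h.2
  · rintro t ht m2 L ⟨h2, ho2, hq2, ht2⟩
    rw [submodularFTRL_eq_lossRun A f k φ _ hη]
    refine Coupled.map_right ((run_coupled hn2 h0 hf hu A (h2.charge 1)).mono ?_)
    rintro m3 L' ⟨h3, ho3, hq3, ht3⟩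
    rw [Mem.charge_queries, ← hM] at hq3
    rw [Mem.charge_steps, ← hM] at ht3
    refine ⟨h3, ?_, ?_, ?_⟩
    · rw [ho3, Mem.charge_out, ho2, encodePerms_append]
    · rw [Nat.succ_mul]
      omega
    · rw [Nat.succ_mul]
      omega
  · refine ⟨h1.charge _, ?_, ?_, ?_⟩
    · simp [encodePerms, ho1, ho0]
    · simp [hq1, hq0]
    · simp [RExp.cost, NExp.cost]
      omega

end Total

theorem mainTheorem4 (c C : ℝ) (hc : 0 < c) (hC : 0 < C) :
    ∃ (A p q : ℕ) (B : ℝ) (prog : Cmd), 1 ≤ A ∧ 0 < B ∧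
      ∀ (n : ℕ) (f : Finset (Fin n) → ℝ) (k N : ℕ) (φ δ : ℝ),
        2 ≤ n → f ∅ = 0 → IsSubmodular f → (∀ i, 0 ≤ upperVec f i) → 0 < k →
        |minValue f| ≤ φ → 0 < δ → δ ≤ φ → c * (‖upperVec f‖ / k) ≤ φ →
        ⌈(k : ℝ) ^ 4 * φ ^ 2 / δ ^ 2⌉₊ ≤ N →
        -- the number of permutations
        (∀ L ∈ (stochDualCertificate A f k φ δ N).support,
          L.length = N * ftrlIters A f k φ (δ / 2)) ∧
        (N = ⌈(k : ℝ) ^ 4 * φ ^ 2 / δ ^ 2⌉₊ →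
          ((N * ftrlIters A f k φ (δ / 2) : ℕ) : ℝ) ≤
            B * Real.log n ^ p * ((k : ℝ) ^ 6 * φ ^ 2 * (‖upperVec f‖ + φ) *
              (l1norm (upperVec f) + φ) / δ ^ 4)) ∧
        -- with high probability their average subgradient is a dual certificate
        ENNReal.ofReal (1 - (n : ℝ) ^ (-C)) ≤
          (stochDualCertificate A f k φ δ N).toOuterMeasure
            {L | IsDualCertificate f δ k (avgSubgrad f L)} ∧
        -- the program outputs them, within the time bound
        (prog.exec f (inputMem f k N φ δ)).map Mem.out =
          (stochDualCertificate A f k φ δ N).map encodePerms ∧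
        ∀ m ∈ (prog.exec f (inputMem f k N φ δ)).support, ∀ EO : ℝ, 0 ≤ EO →
          m.time EO ≤ B * Real.log n ^ p * ((N * ftrlIters A f k φ (δ / 2) : ℕ) : ℝ) *
            (EO + (n : ℝ) ^ q) := by
  -- `A` must cover the entropy `4 k log n` of the small sets and the failure probability `n ^ (-C)`
  set A : ℕ := ⌈32 * (12 + 2 * C)⌉₊
  have hA : 32 * (12 + 2 * C) ≤ A := Nat.le_ceil _
  have hA1 : 1 ≤ A := by
    have : (1 : ℝ) ≤ A := by linarith
    exact_mod_cast this
  refine ⟨A, 1, 2, 64 * A + 3000, certificateCmd A, hA1, by positivity, ?_⟩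
  intro n f k N φ δ hn h0 hf hu hk hφ hδ hδφ _ hN
  have hφ0 : 0 < φ := hδ.trans_le hδφ
  obtain ⟨-, hV⟩ := Uinf_pos f k hφ0
  obtain ⟨-, hU⟩ := Uone_pos f hφ0
  have hη : 0 < δ / 2 / (Uinf f k φ * Uone f φ) := by positivity
  have hn' : (2 : ℝ) ≤ n := by exact_mod_cast hn
  have hk' : (1 : ℝ) ≤ k := by exact_mod_cast hk
  have hlog : 1 / 2 ≤ Real.log n := by
    have := Real.log_le_log (by norm_num) hn'
    linarith [Real.log_two_gt_d9]
  have hN0 : 0 < N := by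
    refine lt_of_lt_of_le (Nat.ceil_pos.2 ?_) hN
    positivity
  obtain ⟨hM0, -⟩ := ftrlIters_bounds (f := f) hn hk hδ hδφ hA1
  have hl1 : 0 ≤ l1norm (upperVec f) := Finset.sum_nonneg fun i _ => abs_nonneg _
  obtain ⟨J, hJ1, hJ2, hJ⟩ := certificateCmd_coupled hn h0 hf hu A k N hη
  refine ⟨fun L hL => length_of_mem_support_stochDualCertificate A f k hη N hL, ?_,
    stochDualCertificate_isDualCertificate hn h0 hf hu hk hC hφ hδ hδφ hA hN0, ?_, ?_⟩
  · rintro rfl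
    refine (total_iterations_le hn hk hδ hδφ hA1).trans ?_
    rw [pow_one]
    have h1 : 64 * A * Real.log n ≤ (64 * A + 3000) * Real.log n := by nlinarith
    exact mul_le_mul_of_nonneg_right h1 (by positivity)
  · rw [← hJ1, ← hJ2, PMF.map_comp, PMF.map_comp, ← PMF.bind_pure_comp, ← PMF.bind_pure_comp]
    exact PMF.bind_congr_support J fun x hx => congrArg PMF.pure (hJ x hx).1
  · intro m hm EO hEO
    rw [← hJ1, PMF.mem_support_map_iff] at hm
    obtain ⟨⟨m', L⟩, hx, rfl⟩ := hm
    obtain ⟨-, hq, hs⟩ := hJ _ hx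
    simp only at hq hs ⊢
    set M := ftrlIters A f k φ (δ / 2) with hM
    have hNM : 1 ≤ N * M := Nat.mul_pos hN0 hM0
    have hs' : m'.steps ≤ 1200 * (N * M * n ^ 2) := by
      have hNNM : N ≤ N * M := Nat.le_mul_of_pos_right N hM0
      have h1 : N * n ≤ N * M * n ^ 2 := Nat.mul_le_mul hNNM (by nlinarith)
      have h2 : N * M ≤ N * M * n ^ 2 := Nat.le_mul_of_pos_right _ (by positivity)
      have h3 : n ≤ N * M * n ^ 2 := by nlinarith
      have h4 : N * (M * (1000 * n ^ 2 + 1) + (20 * n + 101)) + (40 * n + 30) =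
          1000 * (N * M * n ^ 2) + N * M + 20 * (N * n) + 101 * N + 40 * n + 30 := by ring
      omega
    have hq' : (m'.queries : ℝ) ≤ (N * M : ℕ) * (6 * Real.log n) := by
      calc (m'.queries : ℝ) ≤ ((N * (M * (descentSteps n + 1)) : ℕ) : ℝ) := by exact_mod_cast hq
        _ = (N * M : ℕ) * ((descentSteps n : ℝ) + 1) := by push_cast; ring
        _ ≤ _ := mul_le_mul_of_nonneg_left (descentSteps_le hn).2 (Nat.cast_nonneg _)
    have hs'' : (m'.steps : ℝ) ≤ 1200 * ((N * M : ℕ) * (n : ℝ) ^ 2) := by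
      exact_mod_cast hs'
    set X : ℝ := ((N * M : ℕ) : ℝ) with hX
    have hX0 : 0 ≤ X := Nat.cast_nonneg _
    have hA0 : (0 : ℝ) ≤ A := Nat.cast_nonneg _
    have hB : 3000 * Real.log n ≤ (64 * A + 3000) * Real.log n := by nlinarith
    calc m'.time EO ≤ X * (6 * Real.log n) * EO + 1200 * (X * (n : ℝ) ^ 2) :=
          add_le_add (mul_le_mul_of_nonneg_right hq' hEO) hs''
      _ ≤ X * (3000 * Real.log n) * EO + 3000 * Real.log n * (X * (n : ℝ) ^ 2) := by
          gcongr
          · norm_num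
          · linarith
      _ = 3000 * Real.log n * (X * (EO + (n : ℝ) ^ 2)) := by ring
      _ ≤ (64 * A + 3000) * Real.log n * (X * (EO + (n : ℝ) ^ 2)) :=
          mul_le_mul_of_nonneg_right hB (by positivity)
      _ = _ := by ring
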